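/- Let $d,k,e\in\mathbb N$, $p\in(2,3)$, $T>0$ and $\Delta_T=\{(s,t)\in[0,T]^2: s\le t\}$. For a path $X$ write $X_{s,t}=X_t-X_s$. For $q\ge 1$ and a path $A$ (with $A_{s,t}=A_t-A_s$) or a two-parameter function $A$ on $\Delta_T$ put $\|A\|_q=(\sup_{\mathcal P}\sum_{[u,v]\in\mathcal P}|A_{u,v}|^q)^{1/q}$, the supremum being over all partitions of $[0,T]$. A càdlàg $p$-rough path $\mathbf X=(X,\mathbb X)$ over $\mathbb R^d$ on $[0,T]$ consists of a càdlàg path $X:[0,T]\to\mathbb R^d$ with $\|X\|_p<\infty$ and a function $\mathbb X:\Delta_T\to\mathbb R^{d\times d}$, càdlàg in each variable separately, with $\|\mathbb X\|_{p/2}<\infty$, such that $\mathbb X_{s,t}=\mathbb X_{s,u}+\mathbb X_{u,t}+X_{s,u}\otimes X_{u,t}$ for $s\le u\le t$; put $\|\mathbf X\|_p=\|X\|_p+\|\mathbb X\|_{p/2}$. For a finite-dimensional normed space $E$, the space $\mathcal V^p_X(E)$ of controlled paths consists of the pairs $(Y,Y')$ of càdlàg paths $Y:[0,T]\to E$, $Y':[0,T]\to\mathcal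 L(\mathbb R^d;E)$ of finite $p$-variation such that $R^Y_{s,t}:=Y_{s,t}-Y'_sX_{s,t}$ is càdlàg in each variable separately with $\|R^Y\|_{p/2}<\infty$. Put $$\|Y,Y'\|_{X,p}=|Y'_0|+\|Y'\|_p+\|R^Y\|_{p/2},\qquad \|Y,Y';\tilde Y,\tilde Y'\|_{X,p}=|Y'_0-\tilde Y'_0|+\|Y'-\tilde Y'\|_p+\|R^Y-R^{\tilde Y}\|_{p/2}.$$ For $(Z,Z')\in\mathcal V^p_X(\mathcal L(\mathbb R^d;\mathbb R^k))$ the rough integral is $\int_0^t Z_s\,d\mathbf X_s=\lim_{|\mathcal P|\to0}\sum_{[u,v]\in\mathcal P}(Z_uX_{u,v}+Z'_u\mathbb X_{u,v})$, the limit being along partitions $\mathcal P$ of $[0,t]$ whose mesh tends to $0$. $C^n_b$ is the space of $n$ times continuously differentiable functions on $\mathbb R^{e+k}=\mathbb R^e\times\mathbb R^k$ with values in $\mathcal L(\mathbb R^d;\mathbb R^k)$ that are bounded together with all derivatives up to order $n$, and $\|f\|_{C^n_b}=\sum_{r=0}^n\|D^rf\|_\infty$. Given $f\in C^3_b$, $(\alpha,\alpha')\in\mathcal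 V^p_X(\mathbb R^e)$ and $(y,y')\in\mathcal V^p_X(\mathbb R^k)$, a solution of the controlled rough differential equation $$Y_t=y_t+\int_0^t f(\alpha_s,Y_s)\,d\mathbf X_s,\qquad t\in[0,T],\tag{1}$$ is a controlled path $(Y,Y')\in\mathcal V^p_X(\mathbb R^k)$ with $Y'=y'+f(\alpha,Y)$ that satisfies (1), where the integrand is the controlled path $(f(\alpha,Y),\,Df(\alpha,Y)(\alpha',Y'))$. **Corollary 3.3.** (i) For every $\mathbf X$, every $f\in C^3_b$ and all controlled paths $(\alpha,\alpha')$, $(y,y')$ as above, equation (1) has a unique solution $(Y,Y')$. Moreover, there is a componentwise non-decreasing function $K_p:[0,\infty)^5\to[0,\infty)$, depending only on $p,d,k,e$, such that always $$\|Y,Y'\|_{X,p}\le K_p\big(\|f\|_{C^2_b},\|y,y'\|_{X,p},\|\alpha\|_p,\|\alpha,\alpha'\|_{X,p},\|\mathbf X\|_p\big).$$ (ii) Let $(Y,Y')$ be the solution of (1) for the data $(y,y'),f,(\alpha,\alpha')$, and $(\tilde Y,\tilde Y')$ the solution of (1), with the same $\mathbf X$, for data $(\tilde y,\tilde y'),\tilde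 f,(\tilde\alpha,\tilde\alpha')$ of the same kind, and suppose that $\|Y,Y'\|_{X,p},\|\tilde Y,\tilde Y'\|_{X,p}\le K$ for some $K>0$. Then $$|Y_0-\tilde Y_0|+\|Y,Y';\tilde Y,\tilde Y'\|_{X,p}\le C\Big(|y_0-\tilde y_0|+\|y,y';\tilde y,\tilde y'\|_{X,p}+\|f-\tilde f\|_{C^2_b}+|\alpha_0-\tilde\alpha_0|+\|\alpha,\alpha';\tilde\alpha,\tilde\alpha'\|_{X,p}\Big),$$ where, for given dimensions $d,k,e$, the constant $C$ depends only on $p$, $\|f\|_{C^3_b}\vee\|\tilde f\|_{C^3_b}$, $\|\alpha,\alpha'\|_{X,p}$, $\|\tilde\alpha,\tilde\alpha'\|_{X,p}$, $K$ and $\|\mathbf X\|_p$, and is locally bounded (bounded on compact sets) as a function of these quantities on $(2,3)\times[0,\infty)^5$. -/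

import Mathlib

open Set Filter Topology
open scoped ENNReal

namespace CadlagRough

noncomputable section

/-- The space `ℝⁿ` with its Euclidean norm. -/
abbrev Vec (n : ℕ) : Type := EuclideanSpace ℝ (Fin n)

/-- The space `ℝ^{d × d}` with its Euclidean (Frobenius) norm. -/
abbrev Mat (d : ℕ) : Type := EuclideanSpace ℝ (Fin d × Fin d)

/-- The space `ℝ^{e + k}`, written as the Euclidean product `ℝᵉ × ℝᵏ`. -/
abbrev Vec₂ (e k : ℕ) : Type := WithLp 2 (Vec e × Vec k)

section Variation

variable {E : Type*} [NormedAddCommGroup E]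

/-- `s = u 0 < u 1 < ⋯ < u n = t` is a partition of the interval `[s, t]`. -/
structure IsPartition (s t : ℝ) (n : ℕ) (u : ℕ → ℝ) : Prop where
  left : u 0 = s
  right : u n = t
  lt_succ : ∀ i < n, u i < u (i + 1)

/-- `f` restricted to `[a, b]` is right-continuous with left limits. -/
def IsCadlag (a b : ℝ) (f : ℝ → E) : Prop :=
  (∀ t ∈ Ico a b, ContinuousWithinAt f (Ici t) t) ∧
  (∀ t ∈ Ioc a b, ∃ l : E, Tendsto f (𝓝[<] t) (𝓝 l))

/-- The two-parameter function of increments `X_{s,t} = X_t - X_s` of a path. -/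
def incr (X : ℝ → E) : ℝ → ℝ → E := fun s t => X t - X s

/-- The extended-real `q`-variation `(sup_P ∑_{[u,v] ∈ P} |A_{u,v}|^q)^{1/q}` over `[s, t]`
of a two-parameter function `A`. -/
def eVar (q : ℝ) (A : ℝ → ℝ → E) (s t : ℝ) : ℝ≥0∞ :=
  (⨆ (n : ℕ) (u : ℕ → ℝ) (_ : IsPartition s t n u),
    ∑ i ∈ Finset.range n, ‖A (u i) (u (i + 1))‖ₑ ^ q) ^ (1 / q)

/-- The `q`-variation over `[s, t]` as a real number (meaningful where `eVar` is finite). -/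
def pVar (q : ℝ) (A : ℝ → ℝ → E) (s t : ℝ) : ℝ := (eVar q A s t).toReal

/-- `X ∈ D^p([0,T]; E)`: càdlàg with finite `p`-variation. -/
structure IsPath (p T : ℝ) (X : ℝ → E) : Prop where
  cadlag : IsCadlag 0 T X
  finite : eVar p (incr X) 0 T < ∞

/-- `A ∈ D₂^q(Δ_T; E)`: càdlàg in each variable separately, with finite `q`-variation. -/
structure IsPath₂ (q T : ℝ) (A : ℝ → ℝ → E) : Prop where
  cadlag_left : ∀ t ∈ Icc 0 T, IsCadlag 0 t (fun s => A s t)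
  cadlag_right : ∀ s ∈ Icc 0 T, IsCadlag s T (fun t => A s t)
  finite : eVar q A 0 T < ∞

end Variation

/-- `(X, XX)` is a càdlàg `p`-rough path over `ℝᵈ` on `[0, T]`. -/
structure IsRoughPath {d : ℕ} (p T : ℝ) (X : ℝ → Vec d) (XX : ℝ → ℝ → Mat d) : Prop where
  path : IsPath p T X
  path₂ : IsPath₂ (p / 2) T XX
  chen : ∀ s u t : ℝ, 0 ≤ s → s ≤ u → u ≤ t → t ≤ T → ∀ i j : Fin d,
    XX s t (i, j) = XX s u (i, j) + XX u t (i, j) + (X u i - X s i) * (X t j - X u j)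

/-- The seminorm `‖(X, XX)‖_p = ‖X‖_p + ‖XX‖_{p/2}` over `[0, T]`. -/
def roughNorm {d : ℕ} (p T : ℝ) (X : ℝ → Vec d) (XX : ℝ → ℝ → Mat d) : ℝ :=
  pVar p (incr X) 0 T + pVar (p / 2) XX 0 T

section Controlled

variable {d : ℕ} {E : Type*} [NormedAddCommGroup E] [NormedSpace ℝ E]

/-- The remainder `R^Y_{s,t} = Y_{s,t} - Y'_s X_{s,t}`. -/
def remainder (X : ℝ → Vec d) (Y : ℝ → E) (Y' : ℝ → Vec d →L[ℝ] E) : ℝ → ℝ → E :=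
  fun s t => (Y t - Y s) - Y' s (X t - X s)

/-- `(Y, Y') ∈ 𝒱^p_X([0,T]; E)`: a controlled path with respect to `X`. -/
structure IsControlled (p T : ℝ) (X : ℝ → Vec d) (Y : ℝ → E) (Y' : ℝ → Vec d →L[ℝ] E) :
    Prop where
  path : IsPath p T Y
  deriv_path : IsPath p T Y'
  remainder_path : IsPath₂ (p / 2) T (remainder X Y Y')

/-- `‖Y, Y'‖_{X,p} = |Y'_0| + ‖Y'‖_p + ‖R^Y‖_{p/2}` over `[0, T]`. -/
def ctrlNorm (p T : ℝ) (X : ℝ → Vec d) (Y : ℝ → E) (Y' : ℝ → Vec d →L[ℝ] E) : ℝ :=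
  ‖Y' 0‖ + pVar p (incr Y') 0 T + pVar (p / 2) (remainder X Y Y') 0 T

/-- `‖Y, Y'; Z, Z'‖_{X,p} = |Y'_0 - Z'_0| + ‖Y' - Z'‖_p + ‖R^Y - R^Z‖_{p/2}` over `[0, T]`. -/
def ctrlDist (p T : ℝ) (X : ℝ → Vec d) (Y : ℝ → E) (Y' : ℝ → Vec d →L[ℝ] E)
    (Z : ℝ → E) (Z' : ℝ → Vec d →L[ℝ] E) : ℝ :=
  ‖Y' 0 - Z' 0‖ + pVar p (incr (fun t => Y' t - Z' t)) 0 T +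
    pVar (p / 2) (fun s t => remainder X Y Y' s t - remainder X Z Z' s t) 0 T

/-- The action on `A ∈ ℝ^{d × d}` of `B ∈ ℒ(ℝᵈ; ℒ(ℝᵈ; E)) ≅ ℒ(ℝᵈ ⊗ ℝᵈ; E)`, determined by
`a ⊗ b ↦ B a b`. -/
def tensorApply (B : Vec d →L[ℝ] Vec d →L[ℝ] E) (A : Mat d) : E :=
  ∑ i : Fin d, ∑ j : Fin d,
    A (i, j) • B (EuclideanSpace.single i (1 : ℝ)) (EuclideanSpace.single j (1 : ℝ))

/-- `I` is the rough integral `∫_s^t Y d(X, XX)`: the limit, as the mesh of the partition of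
`[s, t]` tends to zero, of the sums `∑ (Y_u X_{u,v} + Y'_u XX_{u,v})`. -/
def HasRoughIntegral (X : ℝ → Vec d) (XX : ℝ → ℝ → Mat d)
    (Y : ℝ → Vec d →L[ℝ] E) (Y' : ℝ → Vec d →L[ℝ] Vec d →L[ℝ] E) (s t : ℝ) (I : E) : Prop :=
  ∀ ε > 0, ∃ δ > 0, ∀ (n : ℕ) (u : ℕ → ℝ), IsPartition s t n u →
    (∀ i < n, u (i + 1) - u i < δ) →
    ‖(∑ i ∈ Finset.range n, (Y (u i) (X (u (i + 1)) - X (u i)) +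
      tensorApply (Y' (u i)) (XX (u i) (u (i + 1))))) - I‖ < ε

end Controlled

section VectorFields

variable {V W : Type*} [NormedAddCommGroup V] [NormedSpace ℝ V]
  [NormedAddCommGroup W] [NormedSpace ℝ W]

/-- `f ∈ C^n_b(V; W)`: `f` is `n` times continuously differentiable, and `f` and its
derivatives up to order `n` are bounded. -/
structure IsCb (n : ℕ) (f : V → W) : Prop where
  contDiff : ContDiff ℝ n f
  bounded : ∀ i ≤ n, ∃ M : ℝ, ∀ x, ‖iteratedFDeriv ℝ i f x‖ ≤ M

/-- `‖f‖_{C^n_b} = ‖f‖_∞ + ‖Df‖_∞ + ⋯ + ‖D^n f‖_∞` (meaningful for `f ∈ C^n_b`). -/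
def cbNorm (n : ℕ) (f : V → W) : ℝ :=
  ∑ i ∈ Finset.range (n + 1), ⨆ x, ‖iteratedFDeriv ℝ i f x‖

end VectorFields

section Equation

variable {d k e : ℕ}

/-- The coefficient path `t ↦ f(α_t, Y_t)`. -/
def coeff (f : Vec₂ e k → Vec d →L[ℝ] Vec k) (α : ℝ → Vec e) (Y : ℝ → Vec k) :
    ℝ → Vec d →L[ℝ] Vec k :=
  fun t => f (WithLp.toLp 2 (α t, Y t))

/-- Its derivative `t ↦ Df(α_t, Y_t) (α'_t, Y'_t)` as a controlled path. -/
def coeff' (f : Vec₂ e k → Vec d →L[ℝ] Vec k) (α : ℝ → Vec e) (α' : ℝ → Vec d →L[ℝ] Vec e)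
    (Y : ℝ → Vec k) (Y' : ℝ → Vec d →L[ℝ] Vec k) : ℝ → Vec d →L[ℝ] Vec d →L[ℝ] Vec k :=
  fun t => (fderiv ℝ f (WithLp.toLp 2 (α t, Y t))).comp
    ((WithLp.prodContinuousLinearEquiv 2 ℝ (Vec e) (Vec k)).symm.toContinuousLinearMap.comp
      ((α' t).prod (Y' t)))

/-- `(Y, Y')` is a solution on `[0, T]` of the controlled rough differential equation
`Y_t = y_t + ∫_0^t f(α_s, Y_s) d(X, XX)_s`: it is a controlled path with `Y' = y' + f(α, Y)`,
and for every `t` the rough integral exists and equals `Y_t - y_t`. -/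
structure IsSolution (p T : ℝ) (X : ℝ → Vec d) (XX : ℝ → ℝ → Mat d)
    (f : Vec₂ e k → Vec d →L[ℝ] Vec k) (α : ℝ → Vec e) (α' : ℝ → Vec d →L[ℝ] Vec e)
    (y : ℝ → Vec k) (y' : ℝ → Vec d →L[ℝ] Vec k)
    (Y : ℝ → Vec k) (Y' : ℝ → Vec d →L[ℝ] Vec k) : Prop where
  controlled : IsControlled p T X Y Y'
  deriv_eq : ∀ t ∈ Icc 0 T, Y' t = y' t + coeff f α Y t
  integral_eq : ∀ t ∈ Icc 0 T,
    HasRoughIntegral X XX (coeff f α Y) (coeff' f α α' Y Y') 0 t (Y t - y t)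

end Equation

end

end CadlagRough

open CadlagRough

/-! All estimates are proved for Euler schemes on finite grids, uniformly in the grid. The
variations of the data are dominated by one superadditive control `w`, with gauge `v = w ^ (1 / p)`.
A jump keeps `w` large on arbitrarily short time intervals, but on a grid it can be isolated in a
single step, and an Euler scheme has no error over a single step.

The engine is the discrete sewing lemma `norm_defect_le`. An interval is cut into a left part, one
step and a right part, both parts carrying at most half of `w`; since `3 / p > 1`, errors of order
`v ^ 3` then contract. The increment of the germ may be estimated with the bound already obtained on
the left part, which closes a circle: a third-order error over a block of small `w` makes the
candidate controlled with a constant fixed by the data alone, because `f` is bounded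
(`exists_ctrlY`), and a controlled candidate gives a germ with third-order increments.
`Superadd.chain` glues a bounded number of blocks and single steps into `exists_euler_bound`. The
same scheme for differences, where a third derivative of the vector field enters, yields
`exists_euler_stability`.

For existence, Euler schemes on all finite sets of times converge pointwise along an ultrafilter,
and closed bounds survive. Among them is an error bound by a multiple of `K ^ (θ - 1) * w s t ^ θ`
with `θ > 1`, where `K` dominates `min (w s m) (w m t)` for all intermediate `m`. A jump lies on one
side of `m` only, so `K` tends to `0` with the mesh (`IsControl.mesh`); hence the compensated
Riemann sums converge. For stability, two solutions are restricted to a common fine grid, and their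
small one-step errors are moved into the inhomogeneity (`correct`), so that the result for Euler
schemes applies. Uniqueness is stability for equal data.

Finally, constants valid for data of size at most `n` are summed over `n` to give the monotone bound
and the locally bounded Lipschitz constant. The exponent `p` enters through the contraction factor
`2 ^ (1 - 3 / p)`, which degenerates only as `p` tends to `3`. -/

namespace CadlagRough

/-! ### Taylor estimates for vector fields. -/

section Calculus

variable {U W : Type*} [NormedAddCommGroup U] [NormedSpace ℝ U]
  [NormedAddCommGroup W] [NormedSpace ℝ W]

/-- `Df` is the derivative of `f`, both are bounded by `M`, and `Df` is `M`-Lipschitz. -/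
structure C2Bound (M : ℝ) (f : U → W) (Df : U → U →L[ℝ] W) : Prop where
  deriv : ∀ x, HasFDerivAt f (Df x) x
  bound : ∀ x, ‖f x‖ ≤ M
  bound_deriv : ∀ x, ‖Df x‖ ≤ M
  lip_deriv : ∀ x y, ‖Df x - Df y‖ ≤ M * ‖x - y‖

namespace C2Bound

variable {M : ℝ} {f : U → W} {Df : U → U →L[ℝ] W} {D2f : U → U →L[ℝ] U →L[ℝ] W}

theorem nonneg (h : C2Bound M f Df) : 0 ≤ M := (norm_nonneg _).trans (h.bound 0)

theorem mono {N : ℝ} (h : C2Bound M f Df) (hMN : M ≤ N) : C2Bound N f Df where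
  deriv := h.deriv
  bound x := (h.bound x).trans hMN
  bound_deriv x := (h.bound_deriv x).trans hMN
  lip_deriv x y := (h.lip_deriv x y).trans (by gcongr)

theorem lip (h : C2Bound M f Df) (x y : U) : ‖f x - f y‖ ≤ M * ‖x - y‖ :=
  convex_univ.norm_image_sub_le_of_norm_hasFDerivWithin_le
    (fun z _ => (h.deriv z).hasFDerivWithinAt) (fun z _ => h.bound_deriv z)
    (mem_univ y) (mem_univ x)

theorem continuous (h : C2Bound M f Df) : Continuous f :=
  continuous_iff_continuousAt.2 fun x => (h.deriv x).continuousAt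

theorem continuous_deriv (h : C2Bound M f Df) : Continuous Df :=
  (LipschitzWith.of_dist_le_mul (K := ⟨M, h.nonneg⟩) fun x y => by
    rw [dist_eq_norm, dist_eq_norm]; exact h.lip_deriv x y).continuous

theorem taylor (h : C2Bound M f Df) (x y : U) :
    ‖f y - f x - Df x (y - x)‖ ≤ M * ‖y - x‖ ^ 2 := by
  have := (convex_segment (𝕜 := ℝ) x y).norm_image_sub_le_of_norm_hasFDerivWithin_le' (φ := Df x)
    (C := M * ‖y - x‖)
    (fun z _ => (h.deriv z).hasFDerivWithinAt) (fun z hz => ?_)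
    (left_mem_segment ℝ x y) (right_mem_segment ℝ x y)
  · linarith [this, sq (‖y - x‖)]
  · refine (h.lip_deriv z x).trans ?_
    have := norm_sub_le_of_mem_segment hz
    have := h.nonneg
    gcongr

/-- Replacing `a₁` by `a₀ + (b₁ - b₀)` costs a Lipschitz term. The two increments then have the same
step `b₁ - b₀`, and `x ↦ f (x + h) - f x` is Lipschitz with constant `M * ‖h‖` because `Df` is
Lipschitz. -/
theorem increment_sub (h : C2Bound M f Df) (a₀ a₁ b₀ b₁ : U) :
    ‖(f a₁ - f a₀) - (f b₁ - f b₀)‖ ≤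
      M * ‖(a₁ - a₀) - (b₁ - b₀)‖ + M * ‖b₁ - b₀‖ * ‖a₀ - b₀‖ := by
  have h1 := h.lip a₁ (a₀ + (b₁ - b₀))
  have h2 : ‖(f (a₀ + (b₁ - b₀)) - f a₀) - (f (b₀ + (b₁ - b₀)) - f b₀)‖ ≤
      M * ‖b₁ - b₀‖ * ‖a₀ - b₀‖ := by
    refine convex_univ.norm_image_sub_le_of_norm_hasFDerivWithin_le
      (f := fun x => f (x + (b₁ - b₀)) - f x) (f' := fun x => Df (x + (b₁ - b₀)) - Df x)
      (fun z _ => HasFDerivAt.hasFDerivWithinAt ?_) (fun z _ => ?_) (mem_univ b₀) (mem_univ a₀)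
    · exact ((hasFDerivAt_comp_add_right (b₁ - b₀)).2 (h.deriv _)).sub (h.deriv z)
    · simpa using h.lip_deriv (z + (b₁ - b₀)) z
  have e1 : a₁ - (a₀ + (b₁ - b₀)) = (a₁ - a₀) - (b₁ - b₀) := by abel
  have e2 : (f a₁ - f a₀) - (f b₁ - f b₀) = (f a₁ - f (a₀ + (b₁ - b₀))) +
      ((f (a₀ + (b₁ - b₀)) - f a₀) - (f (b₀ + (b₁ - b₀)) - f b₀)) := by
    rw [add_sub_cancel b₀ b₁]; abel
  rw [e1] at h1
  rw [e2]
  exact (norm_add_le _ _).trans (add_le_add h1 h2)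

/-- Two moves: from `u` to `v` at the base point `a`, by the mean value inequality on a ball
containing both, and then from `a` to `b` with `v` fixed. The second move needs a Lipschitz second
derivative, that is, `f` of class `C³`. -/
theorem taylor_sub (h : C2Bound M f Df) (h' : C2Bound M Df D2f) (a b u v : U) :
    ‖(f (a + u) - f a - Df a u) - (f (b + v) - f b - Df b v)‖ ≤
      M * (‖u‖ + ‖v‖) * ‖u - v‖ + M * ‖v‖ ^ 2 * ‖a - b‖ := by
  have h1 : ‖f (a + u) - f (a + v) - Df a (u - v)‖ ≤ M * (‖u‖ + ‖v‖) * ‖u - v‖ := by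
    refine (convex_closedBall (0 : U) (‖u‖ + ‖v‖)).norm_image_sub_le_of_norm_hasFDerivWithin_le'
      (f := fun x => f (a + x)) (f' := fun x => Df (a + x)) (x := v) (y := u)
      (fun z _ => HasFDerivAt.hasFDerivWithinAt ?_) (fun z hz => ?_) (by simp) (by simp)
    · exact (hasFDerivAt_comp_add_left a).2 (h.deriv _)
    · refine (h.lip_deriv _ _).trans ?_
      have := h.nonneg
      have hz' : ‖z‖ ≤ ‖u‖ + ‖v‖ := by simpa using hz
      rw [add_sub_cancel_left]
      gcongr
  have h2 : ‖(f (a + v) - f a - Df a v) - (f (b + v) - f b - Df b v)‖ ≤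
      M * ‖v‖ ^ 2 * ‖a - b‖ := by
    refine convex_univ.norm_image_sub_le_of_norm_hasFDerivWithin_le
      (f := fun x => f (x + v) - f x - Df x v)
      (f' := fun x => Df (x + v) - Df x - (D2f x).flip v)
      (fun z _ => HasFDerivAt.hasFDerivWithinAt ?_) (fun z _ => ?_) (mem_univ b) (mem_univ a)
    · have e : HasFDerivAt (fun x => Df x v) ((D2f z).flip v) z := by
        have := (ContinuousLinearMap.apply ℝ W v).hasFDerivAt.comp z (h'.deriv z)
        exact this.congr_fderiv (by ext w; rfl)
      exact (((hasFDerivAt_comp_add_right v).2 (h.deriv _)).sub (h.deriv z)).sub e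
    -- Symmetry of the second derivative identifies the derivative in the base point with the Taylor
    -- remainder of `Df` in direction `v`, which is quadratic in `v`.
    · have e : (D2f z).flip v = D2f z v := by
        ext w
        exact second_derivative_symmetric h.deriv (h'.deriv z) w v
      have := h'.taylor z (z + v)
      rw [add_sub_cancel_left] at this
      rw [e]
      exact this
  have e : (f (a + u) - f a - Df a u) - (f (b + v) - f b - Df b v) =
      (f (a + u) - f (a + v) - Df a (u - v)) +
        ((f (a + v) - f a - Df a v) - (f (b + v) - f b - Df b v)) := by
    rw [map_sub]; abel
  rw [e]
  exact (norm_add_le _ _).trans (add_le_add h1 h2)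

end C2Bound

end Calculus

/-! ### Controlled paths over a single interval. -/

section Controlled

variable {V U W : Type*} [NormedAddCommGroup V] [NormedSpace ℝ V]
  [NormedAddCommGroup U] [NormedSpace ℝ U] [NormedAddCommGroup W] [NormedSpace ℝ W]

/-- The bounds of size `c` for a controlled path with values `a`, `b` and Gubinelli derivatives
`a'`, `b'` at the end points of an interval of size `v`, on which the driver has increment `x`. -/
structure Ctrl (c v : ℝ) (x : V) (a b : U) (a' b' : V →L[ℝ] U) : Prop where
  left : ‖a'‖ ≤ c
  right : ‖b'‖ ≤ c
  deriv : ‖b' - a'‖ ≤ c * v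
  rem : ‖b - a - a' x‖ ≤ c * v ^ 2

namespace Ctrl

variable {c c₁ v M : ℝ} {x : V} {a b a₁ b₁ : U} {a' b' a₁' b₁' : V →L[ℝ] U}

theorem nonneg (h : Ctrl c v x a b a' b') : 0 ≤ c := (norm_nonneg _).trans h.left

theorem mono (h : Ctrl c v x a b a' b') (hv : 0 ≤ v) (hc : c ≤ c₁) :
    Ctrl c₁ v x a b a' b' where
  left := h.left.trans hc
  right := h.right.trans hc
  deriv := h.deriv.trans (by gcongr)
  rem := h.rem.trans (by gcongr)

theorem mono_gauge {v₁ : ℝ} (h : Ctrl c v x a b a' b') (hv : 0 ≤ v) (hv₁ : v ≤ v₁) :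
    Ctrl c v₁ x a b a' b' where
  left := h.left
  right := h.right
  deriv := h.deriv.trans (by have := h.nonneg; gcongr)
  rem := h.rem.trans (by have := h.nonneg; gcongr)

theorem norm_sub_le (h : Ctrl c v x a b a' b') (hx : ‖x‖ ≤ v) (hv : v ≤ M) :
    ‖b - a‖ ≤ c * (1 + M) * v := by
  have hc := h.nonneg
  have h0 : 0 ≤ v := (norm_nonneg _).trans hx
  have e : b - a = (b - a - a' x) + a' x := by abel
  have h1 : ‖a' x‖ ≤ c * v := (a'.le_opNorm x).trans (by gcongr; exact h.left)
  have h2 : c * v ^ 2 ≤ c * (M * v) := by rw [sq]; gcongr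
  calc ‖b - a‖ ≤ ‖b - a - a' x‖ + ‖a' x‖ := by rw [e]; exact (norm_add_le _ _).trans (by simp)
    _ ≤ c * v ^ 2 + c * v := add_le_add h.rem h1
    _ ≤ c * (1 + M) * v := by linarith

theorem add (h : Ctrl c v x a b a' b') (h₁ : Ctrl c₁ v x a₁ b₁ a₁' b₁') :
    Ctrl (c + c₁) v x (a + a₁) (b + b₁) (a' + a₁') (b' + b₁') where
  left := (norm_add_le _ _).trans (add_le_add h.left h₁.left)
  right := (norm_add_le _ _).trans (add_le_add h.right h₁.right)
  deriv := by
    rw [add_sub_add_comm, add_mul]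
    exact (norm_add_le _ _).trans (add_le_add h.deriv h₁.deriv)
  rem := by
    have e : b + b₁ - (a + a₁) - (a' + a₁') x = (b - a - a' x) + (b₁ - a₁ - a₁' x) := by
      rw [add_apply]; abel
    rw [e, add_mul]
    exact (norm_add_le _ _).trans (add_le_add h.rem h₁.rem)

theorem map (h : Ctrl c v x a b a' b') (ι : U →L[ℝ] W) (hι : ‖ι‖ ≤ 1) :
    Ctrl c v x (ι a) (ι b) (ι.comp a') (ι.comp b') := by
  have key : ∀ {r : ℝ} {z : U}, ‖z‖ ≤ r → ‖ι z‖ ≤ r := fun {r z} hz =>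
    (ι.le_of_opNorm_le hι z).trans (by simpa using hz)
  have key' : ∀ {r : ℝ} {z : V →L[ℝ] U}, ‖z‖ ≤ r → ‖ι.comp z‖ ≤ r := fun {r z} hz =>
    (ι.opNorm_comp_le z).trans ((mul_le_of_le_one_left (norm_nonneg z) hι).trans hz)
  refine ⟨key' h.left, key' h.right, ?_, ?_⟩
  · rw [← ContinuousLinearMap.comp_sub]; exact key' h.deriv
  · have := key h.rem
    rwa [map_sub, map_sub] at this

/-- The remainder of the composition is the Taylor remainder of `f`, quadratic in `b - a`, plus `Df
a` applied to the old remainder. Only bounds up to the second derivative enter; `M` also serves as a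
bound for the gauge. -/
theorem comp {f : U → W} {Df : U → U →L[ℝ] W} (h : Ctrl c v x a b a' b') (hf : C2Bound M f Df)
    (hx : ‖x‖ ≤ v) (hv : v ≤ M) :
    Ctrl (M * c + M * (c * (1 + M)) ^ 2) v x (f a) (f b) ((Df a).comp a') ((Df b).comp b') := by
  have hc := h.nonneg
  have hM := hf.nonneg
  have h0 : 0 ≤ v := (norm_nonneg _).trans hx
  have hab := h.norm_sub_le hx hv
  have hQ : 0 ≤ M * (c * (1 + M)) ^ 2 := by positivity
  refine ⟨?_, ?_, ?_, ?_⟩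
  · have := (Df a).opNorm_comp_le a'
    have := mul_le_mul (hf.bound_deriv a) h.left (norm_nonneg _) hM
    linarith
  · have := (Df b).opNorm_comp_le b'
    have := mul_le_mul (hf.bound_deriv b) h.right (norm_nonneg _) hM
    linarith
  · have e : (Df b).comp b' - (Df a).comp a' = (Df b - Df a).comp b' + (Df a).comp (b' - a') := by
      simp
    rw [e]
    refine (norm_add_le _ _).trans ?_
    have h1 : ‖(Df b - Df a).comp b'‖ ≤ (M * (c * (1 + M) * v)) * c := by
      refine ((Df b - Df a).opNorm_comp_le b').trans (mul_le_mul ?_ h.right (norm_nonneg _) ?_)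
      · exact (hf.lip_deriv b a).trans (by gcongr)
      · positivity
    have h2 : ‖(Df a).comp (b' - a')‖ ≤ M * (c * v) :=
      ((Df a).opNorm_comp_le _).trans (mul_le_mul (hf.bound_deriv a) h.deriv (norm_nonneg _) hM)
    have h3 : (M * (c * (1 + M) * v)) * c ≤ M * (c * (1 + M)) ^ 2 * v := by
      have : M * (c * (1 + M)) ^ 2 * v - (M * (c * (1 + M) * v)) * c
        = M * M * (1 + M) * c ^ 2 * v := by ring
      have : 0 ≤ M * M * (1 + M) * c ^ 2 * v := by positivity
      linarith
    linarith
  · have e : f b - f a - (Df a).comp a' x = (f b - f a - Df a (b - a)) +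
        Df a (b - a - a' x) := by
      simp only [map_sub, ContinuousLinearMap.comp_apply]; abel
    rw [e]
    refine (norm_add_le _ _).trans ?_
    have h1 : ‖f b - f a - Df a (b - a)‖ ≤ M * (c * (1 + M) * v) ^ 2 :=
      (hf.taylor a b).trans (by gcongr)
    have h2 : ‖Df a (b - a - a' x)‖ ≤ M * (c * v ^ 2) :=
      ((Df a).le_opNorm _).trans (mul_le_mul (hf.bound_deriv a) h.rem (norm_nonneg _) hM)
    linarith [mul_pow (c * (1 + M)) v 2]

end Ctrl

/-- Stability of the composition with a regular function. -/
theorem exists_ctrl_comp_sub (M c : ℝ) (hM : 0 ≤ M) (hc : 0 ≤ c) : ∃ C, 0 ≤ C ∧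
    ∀ {f g : U → W} {Df Dg : U → U →L[ℝ] W} {D2g : U → U →L[ℝ] U →L[ℝ] W} {η H v : ℝ} {x : V}
      {a b a₁ b₁ : U} {a' b' a₁' b₁' : V →L[ℝ] U},
      C2Bound M g Dg → C2Bound M Dg D2g →
      C2Bound η (fun z => f z - g z) (fun z => Df z - Dg z) → η ≤ H → ‖x‖ ≤ v → v ≤ M →
      Ctrl M v x a b a' b' → Ctrl M v x a₁ b₁ a₁' b₁' →
      Ctrl (c * H) v x (a - a₁) (b - b₁) (a' - a₁') (b' - b₁') →
      ‖a - a₁‖ ≤ H → ‖b - b₁‖ ≤ H →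
      Ctrl (C * H) v x (f a - g a₁) (f b - g b₁) ((Df a).comp a' - (Dg a₁).comp a₁')
        ((Df b).comp b' - (Dg b₁).comp b₁') := by
  set N := M * (1 + M) with hN
  have hN0 : 0 ≤ N := by positivity
  -- `C1` will bound the Gubinelli derivatives at the end points, `C2` their increment and `C3` the
  -- remainder.
  set C1 := M + M * M + M * c with hC1
  set C2 := N * M + (M * (c * (1 + M)) + M * N) * M + M * N * c + (1 + M) * M + M * c with hC2
  set C3 := N ^ 2 + (M * (N + N) * (c * (1 + M)) + M * N ^ 2) + M + M * M + M * c with hC3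
  have p1 : 0 ≤ C1 := by positivity
  have p2 : 0 ≤ C2 := by positivity
  have p3 : 0 ≤ C3 := by positivity
  refine ⟨C1 + C2 + C3, by positivity, ?_⟩
  intro f g Df Dg D2g η H v x a b a₁ b₁ a' b' a₁' b₁' hg hg' hh hηH hx hv h h₁ hd ha hb
  have hη := hh.nonneg
  have hH : 0 ≤ H := hη.trans hηH
  have h0 : 0 ≤ v := (norm_nonneg _).trans hx
  have hab : ‖b - a‖ ≤ N * v := h.norm_sub_le hx hv
  have hab₁ : ‖b₁ - a₁‖ ≤ N * v := h₁.norm_sub_le hx hv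
  have hdd : ‖(b - a) - (b₁ - a₁)‖ ≤ c * (1 + M) * H * v := by
    have := hd.norm_sub_le hx hv
    rw [sub_sub_sub_comm]
    linarith
  have opc : ∀ (S : U →L[ℝ] W) (R : V →L[ℝ] U) {s r : ℝ}, ‖S‖ ≤ s → ‖R‖ ≤ r →
      ‖S.comp R‖ ≤ s * r := fun S R s r hs hr =>
    (S.opNorm_comp_le R).trans (mul_le_mul hs hr (norm_nonneg _) ((norm_nonneg _).trans hs))
  have opa : ∀ (S : U →L[ℝ] W) (z : U) {s r : ℝ}, ‖S‖ ≤ s → ‖z‖ ≤ r →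
      ‖S z‖ ≤ s * r := fun S z s r hs hr =>
    (S.le_opNorm z).trans (mul_le_mul hs hr (norm_nonneg _) ((norm_nonneg _).trans hs))
  have side : ∀ {z z₁ : U} {z' z₁' : V →L[ℝ] U}, ‖z - z₁‖ ≤ H → ‖z'‖ ≤ M →
      ‖z' - z₁'‖ ≤ c * H → ‖(Df z).comp z' - (Dg z₁).comp z₁'‖ ≤ C1 * H := by
    intro z z₁ z' z₁' e1 e2 e3
    have e : (Df z).comp z' - (Dg z₁).comp z₁' = (Df z - Dg z).comp z' +
      (Dg z - Dg z₁).comp z' + (Dg z₁).comp (z' - z₁') := by simp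
    rw [e]
    have i1 := opc (Df z - Dg z) z' (hh.bound_deriv z) e2
    have i2 := opc (Dg z - Dg z₁) z' (s := M * H) ((hg.lip_deriv z z₁).trans (by gcongr)) e2
    have i3 := opc (Dg z₁) (z' - z₁') (hg.bound_deriv z₁) e3
    have i4 : η * M ≤ H * M := by gcongr
    have := norm_add₃_le (a := (Df z - Dg z).comp z') (b := (Dg z - Dg z₁).comp z')
      (c := (Dg z₁).comp (z' - z₁'))
    have : C1 * H = H * M + M * H * M + M * (c * H) := by rw [hC1]; ring
    linarith
  have q1 : 0 ≤ C1 * H := by positivity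
  have q2 : 0 ≤ C2 * H := by positivity
  have q3 : 0 ≤ C3 * H := by positivity
  have q1v : 0 ≤ C1 * H * v := by positivity
  have q3v : 0 ≤ C3 * H * v := by positivity
  have q1v2 : 0 ≤ C1 * H * v ^ 2 := by positivity
  have q2v2 : 0 ≤ C2 * H * v ^ 2 := by positivity
  refine ⟨?_, ?_, ?_, ?_⟩
  · have := side ha h.left hd.left
    linarith
  · have := side hb h.right hd.right
    linarith
  -- Each of the five terms carries one factor of size `H` (a difference of functions, points or
  -- derivatives) and one of size `v` (an increment over the interval). The second is a four-point
  -- increment of `Dg`, for which `hg'` is needed.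
  · have e : (Df b).comp b' - (Dg b₁).comp b₁' - ((Df a).comp a' - (Dg a₁).comp a₁') =
        ((Df b - Dg b) - (Df a - Dg a)).comp b' + ((Dg b - Dg a) - (Dg b₁ - Dg a₁)).comp b' +
        (Dg b₁ - Dg a₁).comp (b' - b₁') + (Df a - Dg a₁).comp (b' - a') +
        (Dg a₁).comp ((b' - b₁') - (a' - a₁')) := by
      simp only [ContinuousLinearMap.comp_sub, ContinuousLinearMap.sub_comp]; abel
    have i1 := opc ((Df b - Dg b) - (Df a - Dg a)) b' (s := H * (N * v))
      ((hh.lip_deriv b a).trans (by gcongr)) h.right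
    have i2 := opc ((Dg b - Dg a) - (Dg b₁ - Dg a₁)) b'
      (s := M * (c * (1 + M) * H * v) + M * (N * v) * H)
      ((hg'.increment_sub a b a₁ b₁).trans (by gcongr)) h.right
    have i3 := opc (Dg b₁ - Dg a₁) (b' - b₁') (s := M * (N * v))
      ((hg.lip_deriv b₁ a₁).trans (by gcongr)) hd.right
    have i4 := opc (Df a - Dg a₁) (b' - a') (s := H + M * H) (by
      have : Df a - Dg a₁ = (Df a - Dg a) + (Dg a - Dg a₁) := by abel
      rw [this]
      refine (norm_add_le _ _).trans (add_le_add ((hh.bound_deriv a).trans hηH)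
        ((hg.lip_deriv a a₁).trans (by gcongr)))) h.deriv
    have i5 := opc (Dg a₁) ((b' - b₁') - (a' - a₁')) (hg.bound_deriv a₁) hd.deriv
    have : C2 * H * v = H * (N * v) * M + (M * (c * (1 + M) * H * v) + M * (N * v) * H) * M +
        M * (N * v) * (c * H) + (H + M * H) * (M * v) + M * (c * H * v) := by rw [hC2]; ring
    rw [e]
    refine (norm_add_le _ _).trans ((add_le_add (norm_add₄_le ..) le_rfl).trans ?_)
    linarith
  · have e : f b - g b₁ - (f a - g a₁) - ((Df a).comp a' - (Dg a₁).comp a₁') x =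
        ((f b - g b) - (f a - g a) - (Df a - Dg a) (b - a)) +
        ((g (a + (b - a)) - g a - Dg a (b - a)) -
          (g (a₁ + (b₁ - a₁)) - g a₁ - Dg a₁ (b₁ - a₁))) +
        (Df a - Dg a) (b - a - a' x) + (Dg a - Dg a₁) (b - a - a' x) +
        Dg a₁ ((b - b₁) - (a - a₁) - (a' - a₁') x) := by
      rw [add_sub_cancel, add_sub_cancel]
      simp only [map_sub, ContinuousLinearMap.comp_apply, sub_apply]; abel
    have i1 : ‖(f b - g b) - (f a - g a) - (Df a - Dg a) (b - a)‖ ≤ H * (N * v) ^ 2 :=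
      (hh.taylor a b).trans (by gcongr)
    -- The difference of the Taylor remainders of the same `g` along the two paths is the term that
    -- requires a third derivative.
    have i2 := (hg.taylor_sub hg' a a₁ (b - a) (b₁ - a₁)).trans
      (show _ ≤ M * (N * v + N * v) * (c * (1 + M) * H * v) + M * (N * v) ^ 2 * H by gcongr)
    have i3 := opa (Df a - Dg a) (b - a - a' x) ((hh.bound_deriv a).trans hηH) h.rem
    have i4 := opa (Dg a - Dg a₁) (b - a - a' x) (s := M * H)
      ((hg.lip_deriv a a₁).trans (by gcongr)) h.rem
    have i5 := opa (Dg a₁) ((b - b₁) - (a - a₁) - (a' - a₁') x) (hg.bound_deriv a₁) hd.rem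
    have : C3 * H * v ^ 2 = H * (N * v) ^ 2 +
        (M * (N * v + N * v) * (c * (1 + M) * H * v) + M * (N * v) ^ 2 * H) +
        H * (M * v ^ 2) + M * H * (M * v ^ 2) + M * (c * H * v ^ 2) := by rw [hC3]; ring
    rw [e]
    refine (norm_add_le _ _).trans ((add_le_add (norm_add₄_le ..) le_rfl).trans ?_)
    linarith

end Controlled

end CadlagRough

namespace CadlagRough

/-! ### The discrete sewing lemma. -/

section Sewing

variable {E : Type*} [NormedAddCommGroup E]

/-- The error of the one-step approximation `Ξ i j` of the sum of `Ξ l (l + 1)` over `[i, j)`. -/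
def defect (Ξ : ℕ → ℕ → E) (i j : ℕ) : E := ∑ l ∈ Finset.Ico i j, Ξ l (l + 1) - Ξ i j

theorem defect_succ (Ξ : ℕ → ℕ → E) (i : ℕ) : defect Ξ i (i + 1) = 0 := by
  simp [defect]

/-- Splitting at `m` and again at `m + 1` isolates one step, whose defect is zero. Two increments of
`Ξ` appear, one for each cut. -/
theorem defect_split (Ξ : ℕ → ℕ → E) {i m j : ℕ} (him : i ≤ m) (hmj : m < j) :
    defect Ξ i j = defect Ξ i m + defect Ξ (m + 1) j - (Ξ i j - Ξ i m - Ξ m j) -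
      (Ξ m j - Ξ m (m + 1) - Ξ (m + 1) j) := by
  have e1 := Finset.sum_Ico_consecutive (fun l => Ξ l (l + 1)) him hmj.le
  have e2 := Finset.sum_eq_sum_Ico_succ_bot hmj (fun l => Ξ l (l + 1))
  simp only [defect]
  rw [← e1, e2]
  abel

/-- The discrete sewing lemma, in a form in which the bound on the increment of `Ξ` may use the
bound to be proved on the left subinterval. -/
theorem norm_defect_le {Ξ : ℕ → ℕ → E} {Φ : ℕ → ℕ → ℝ} {Γ K γ : ℝ} {s t : ℕ}
    (hΞ : ∀ i, Ξ i i = 0) (hΦ : ∀ i j, i ≤ j → 0 ≤ Φ i j)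
    (hmono : ∀ i m j, i ≤ m → m ≤ j → Φ m j ≤ Φ i j)
    (hsplit : ∀ i j, i < j → ∃ m, i ≤ m ∧ m < j ∧ Φ i m + Φ (m + 1) j ≤ (1 - γ) * Φ i j)
    (hK0 : 0 ≤ K) (hΓ : 0 ≤ Γ) (hK : 2 * K ≤ γ * Γ)
    (H : ∀ i m j, s ≤ i → i ≤ m → m ≤ j → j ≤ t → ‖defect Ξ i m‖ ≤ Γ * Φ i m →
      ‖Ξ i j - Ξ i m - Ξ m j‖ ≤ K * Φ i j) :
    ∀ i j, s ≤ i → i ≤ j → j ≤ t → ‖defect Ξ i j‖ ≤ Γ * Φ i j := by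
  suffices h : ∀ n i j, j - i = n → s ≤ i → i ≤ j → j ≤ t → ‖defect Ξ i j‖ ≤ Γ * Φ i j from
    fun i j => h _ i j rfl
  intro n
  induction n using Nat.strong_induction_on with
  | _ n ih =>
    intro i j hn hi hij hj
    rcases hij.eq_or_lt with rfl | hlt
    · simp only [defect, Finset.Ico_self, Finset.sum_empty, hΞ, sub_zero, norm_zero]
      exact mul_nonneg hΓ (hΦ _ _ le_rfl)
    obtain ⟨m, him, hmj, hm⟩ := hsplit i j hlt
    have h1 := ih (m - i) (by omega) i m rfl hi him (by omega)
    have h2 := ih (j - (m + 1)) (by omega) (m + 1) j rfl (by omega) hmj hj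
    have h3 := H i m j hi him hmj.le hj h1
    -- The second cut starts with the single step from `m` to `m + 1`; its defect vanishes, so the
    -- condition on the left subinterval is free.
    have h4 := H m (m + 1) j (by omega) (by omega) hmj hj (by
      rw [defect_succ, norm_zero]; exact mul_nonneg hΓ (hΦ _ _ (by omega)))
    have h5 : K * Φ m j ≤ K * Φ i j := by
      have := hmono i m j him hmj.le
      gcongr
    have h6 : Γ * Φ i m + Γ * Φ (m + 1) j ≤ Γ * ((1 - γ) * Φ i j) := by
      rw [← mul_add]; gcongr
    -- The two cuts cost `2 * K * Φ i j`, which is what the contraction by `1 - γ` leaves available.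
    have h7 : 2 * K * Φ i j ≤ γ * Γ * Φ i j := by
      have := hΦ i j hij
      gcongr
    rw [defect_split Ξ him hmj]
    refine (norm_sub_le _ _).trans ?_
    have h8 := norm_sub_le (defect Ξ i m + defect Ξ (m + 1) j) (Ξ i j - Ξ i m - Ξ m j)
    have h9 := norm_add_le (defect Ξ i m) (defect Ξ (m + 1) j)
    linarith

end Sewing

/-! ### Superadditive functions on grids: halving and chaining. -/

section Superadditive

/-- `w` is nonnegative and superadditive on intervals. -/
structure Superadd (w : ℕ → ℕ → ℝ) : Prop where
  nonneg : ∀ i j, i ≤ j → 0 ≤ w i j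
  add_le : ∀ i m j, i ≤ m → m ≤ j → w i m + w m j ≤ w i j

namespace Superadd

variable {w : ℕ → ℕ → ℝ}

theorem self (hw : Superadd w) (i : ℕ) : w i i = 0 := by
  have := hw.add_le i i i le_rfl le_rfl
  have := hw.nonneg i i le_rfl
  linarith

theorem mono (hw : Superadd w) {i i' j' j : ℕ} (h1 : i ≤ i') (h2 : i' ≤ j') (h3 : j' ≤ j) :
    w i' j' ≤ w i j := by
  have := hw.add_le i i' j h1 (h2.trans h3)
  have := hw.add_le i' j' j h2 h3
  have := hw.nonneg i i' h1
  have := hw.nonneg j' j h3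
  linarith

/-- Take for `m` the last index before `j` with `w i m ≤ w i j / 2`. One step further more than half
is used up, so superadditivity leaves less than half for the rest. No continuity of `w` is needed:
whatever happens between `m` and `m + 1` belongs to neither part. -/
theorem exists_half (hw : Superadd w) {i j : ℕ} (hij : i < j) :
    ∃ m, i ≤ m ∧ m < j ∧ w i m ≤ w i j / 2 ∧ w (m + 1) j ≤ w i j / 2 := by
  have hi : w i i ≤ w i j / 2 := by
    rw [hw.self]; have := hw.nonneg i j hij.le; linarith
  have hP : ∃ k, (fun k => k ≤ j - 1 ∧ i ≤ k ∧ w i k ≤ w i j / 2) k := ⟨i, by omega, le_rfl, hi⟩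
  classical
  set m := Nat.findGreatest (fun k => i ≤ k ∧ w i k ≤ w i j / 2) (j - 1) with hm
  have h1 : i ≤ m ∧ w i m ≤ w i j / 2 :=
    Nat.findGreatest_spec (P := fun k => i ≤ k ∧ w i k ≤ w i j / 2) (show i ≤ j - 1 by omega)
      ⟨le_rfl, hi⟩
  have h2 : m ≤ j - 1 := Nat.findGreatest_le _
  refine ⟨m, h1.1, by omega, h1.2, ?_⟩
  rcases h2.eq_or_lt with h3 | h3
  · have : m + 1 = j := by omega
    rw [this, hw.self]
    have := hw.nonneg i j hij.le
    linarith
  · have h4 : ¬ (i ≤ m + 1 ∧ w i (m + 1) ≤ w i j / 2) :=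
      Nat.findGreatest_is_greatest (P := fun k => i ≤ k ∧ w i k ≤ w i j / 2)
        (Nat.lt_succ_self m) (by omega)
    have h5 : w i j / 2 < w i (m + 1) := by
      by_contra h; exact h4 ⟨by omega, not_lt.1 h⟩
    have := hw.add_le i (m + 1) j (by omega) (by omega)
    linarith

/-- Two halves contribute at most `2 * (w i j / 2) ^ θ = 2 ^ (1 - θ) * w i j ^ θ`, a true
contraction when `θ > 1`. -/
theorem split_rpow (hw : Superadd w) {θ γ : ℝ} (hθ : 1 ≤ θ) (hγ : (2 : ℝ) ^ (1 - θ) ≤ 1 - γ)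
    {i j : ℕ} (hij : i < j) :
    ∃ m, i ≤ m ∧ m < j ∧ w i m ^ θ + w (m + 1) j ^ θ ≤ (1 - γ) * w i j ^ θ := by
  obtain ⟨m, h1, h2, h3, h4⟩ := hw.exists_half hij
  refine ⟨m, h1, h2, ?_⟩
  have h0 := hw.nonneg i j hij.le
  have e1 := Real.rpow_le_rpow (hw.nonneg _ _ h1) h3 (by linarith : 0 ≤ θ)
  have e2 := Real.rpow_le_rpow (hw.nonneg _ _ h2) h4 (by linarith : 0 ≤ θ)
  have e3 : (w i j / 2) ^ θ + (w i j / 2) ^ θ = (2 : ℝ) ^ (1 - θ) * w i j ^ θ := by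
    rw [Real.div_rpow h0 zero_le_two, Real.rpow_sub zero_lt_two, Real.rpow_one]; ring
  have e4 : (2 : ℝ) ^ (1 - θ) * w i j ^ θ ≤ (1 - γ) * w i j ^ θ := by
    have := Real.rpow_nonneg h0 θ
    gcongr
  linarith

/-- Propagation of a property from `0` over blocks of size `w ≤ δ` and single steps. -/
theorem chain (hw : Superadd w) {δ : ℝ} (hδ : 0 ≤ δ) {Good : ℝ → ℕ → Prop} {F : ℝ → ℝ} {C₀ : ℝ}
    (h0 : Good C₀ 0) (hstep : ∀ C m, Good C m → Good (F C) (m + 1))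
    (hblock : ∀ C m b, m ≤ b → w m b ≤ δ → Good C m → Good (F C) b) (n b : ℕ)
    (hb : w 0 b ≤ n * δ) : Good (F^[2 * n + 1] C₀) b := by
  induction n generalizing b with
  | zero =>
    refine hblock _ 0 b (Nat.zero_le _) ?_ h0
    simp only [Nat.cast_zero, zero_mul] at hb
    linarith
  | succ n ih =>
    have e : F^[2 * (n + 1) + 1] C₀ = F (F (F^[2 * n + 1] C₀)) := by
      rw [← Function.iterate_succ_apply' F, ← Function.iterate_succ_apply' F]
      congr 1
    rw [e]
    have hbb : w b b ≤ δ := by rw [hw.self]; exact hδ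
    by_cases hn : w 0 b ≤ n * δ
    -- Two trivial blocks bring the number of iterations of `F` up to the required count.
    · exact hblock _ b b le_rfl hbb (hblock _ b b le_rfl hbb (ih b hn))
    classical
    -- The last index reached with budget `n * δ`. The step from `m` to `m + 1` exceeds that budget,
    -- so at most `δ` remains from `m + 1` to `b`: each further `δ` costs one step and one block,
    -- hence the count `2 * n + 1`.
    set m := Nat.findGreatest (fun k => w 0 k ≤ n * δ) b with hm
    have h1 : w 0 m ≤ n * δ :=
      Nat.findGreatest_spec (P := fun k => w 0 k ≤ n * δ) (Nat.zero_le b)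
        (by rw [hw.self]; positivity)
    have h2 : m ≤ b := Nat.findGreatest_le _
    have h3 : m < b := lt_of_le_of_ne h2 (fun h => hn (h ▸ h1))
    have h4 : ¬ w 0 (m + 1) ≤ n * δ :=
      Nat.findGreatest_is_greatest (P := fun k => w 0 k ≤ n * δ) (Nat.lt_succ_self m) h3
    refine hblock _ (m + 1) b h3 ?_ (hstep _ m (ih m h1))
    have := hw.add_le 0 (m + 1) b (Nat.zero_le _) h3
    push_cast at hb
    linarith [not_le.1 h4]

end Superadd

end Superadditive

/-! ### Rough differential equations over an ordered set of times. -/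

noncomputable section Systems

set_option maxSynthPendingDepth 3

variable {ι κ V E U : Type*} [NormedAddCommGroup V] [NormedSpace ℝ V]
  [NormedAddCommGroup E] [NormedSpace ℝ E] [NormedAddCommGroup U] [NormedSpace ℝ U]

/-- The compensated one-step approximation `Z_i X_{i,j} + Z'_i 𝕏_{i,j}` of a rough integral. -/
def germ (X : ι → V) (T : ι → ι → (V →L[ℝ] V →L[ℝ] E) →L[ℝ] E)
    (Z : ι → V →L[ℝ] E) (Z' : ι → V →L[ℝ] V →L[ℝ] E) (i j : ι) : E :=
  Z i (X j - X i) + T i j (Z' i)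

/-- A level-two rough driver on `ι` with gauge `v`; the second level acts through `T`. -/
structure Driver [LE ι] (v : ι → ι → ℝ) (X : ι → V)
    (T : ι → ι → (V →L[ℝ] V →L[ℝ] E) →L[ℝ] E) : Prop where
  X_le : ∀ i j, i ≤ j → ‖X j - X i‖ ≤ v i j
  T_le : ∀ i j, i ≤ j → ‖T i j‖ ≤ v i j ^ 2
  chen : ∀ i m j, i ≤ m → m ≤ j → ∀ B,
    T i j B = T i m B + T m j B + B (X m - X i) (X j - X m)

section Germ

variable {X : ι → V} {T : ι → ι → (V →L[ℝ] V →L[ℝ] E) →L[ℝ] E}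
  {Z : ι → V →L[ℝ] E} {Z' : ι → V →L[ℝ] V →L[ℝ] E}

theorem germ_self [Preorder ι] {v : ι → ι → ℝ} (h : Driver v X T) (i : ι) :
    germ X T Z Z' i i = 0 := by
  have := h.chen i i i le_rfl le_rfl (Z' i)
  simp only [sub_self, map_zero, add_zero] at this
  simp [germ, left_eq_add.1 this]

theorem germ_sub (Z₁ : ι → V →L[ℝ] E) (Z₁' : ι → V →L[ℝ] V →L[ℝ] E) (i j : ι) :
    germ X T (fun i => Z i - Z₁ i) (fun i => Z' i - Z₁' i) i j =
      germ X T Z Z' i j - germ X T Z₁ Z₁' i j := by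
  simp only [germ, sub_apply, map_sub]
  abel

/-- By Chen's relation only the remainder of `Z` on `[i, m]` applied to the increment of `X` on `[m,
j]`, and the second level on `[m, j]` applied to the increment of `Z'`, survive. Both are of third
order in the gauge. -/
theorem norm_germ_delta_le [Preorder ι] {v : ι → ι → ℝ} (h : Driver v X T) {i m j : ι}
    (him : i ≤ m) (hmj : m ≤ j) {c : ℝ}
    (hZ : Ctrl c (v i m) (X m - X i) (Z i) (Z m) (Z' i) (Z' m)) :
    ‖germ X T Z Z' i j - germ X T Z Z' i m - germ X T Z Z' m j‖ ≤
      c * (v i m ^ 2 * v m j + v i m * v m j ^ 2) := by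
  have hc := hZ.nonneg
  have hv : 0 ≤ v i m := (norm_nonneg _).trans (h.X_le i m him)
  have e : germ X T Z Z' i j - germ X T Z Z' i m - germ X T Z Z' m j =
      -((Z m - Z i - Z' i (X m - X i)) (X j - X m)) - T m j (Z' m - Z' i) := by
    have : X j - X i = (X j - X m) + (X m - X i) := by abel
    simp only [germ, h.chen i m j him hmj, sub_apply, map_sub]
    abel
  rw [e]
  refine (norm_sub_le _ _).trans ?_
  rw [norm_neg, mul_add]
  refine add_le_add ?_ ?_
  · refine (ContinuousLinearMap.le_opNorm _ _).trans ?_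
    have := mul_le_mul hZ.rem (h.X_le m j hmj) (norm_nonneg _) (by positivity)
    linarith
  · refine (ContinuousLinearMap.le_opNorm _ _).trans ?_
    have := mul_le_mul (h.T_le m j hmj) hZ.deriv (norm_nonneg _) (by positivity)
    linarith

end Germ

/-- The data `a` (the driving part of the state), `y` (the inhomogeneity), `f` of a controlled
rough differential equation `Y = y + ∫ f(a + J Y) dX`, with a candidate `Y`. -/
structure RDE (ι V E U : Type*) [NormedAddCommGroup V] [NormedSpace ℝ V]
    [NormedAddCommGroup E] [NormedSpace ℝ E] [NormedAddCommGroup U] [NormedSpace ℝ U] where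
  a : ι → U
  a' : ι → V →L[ℝ] U
  y : ι → E
  y' : ι → V →L[ℝ] E
  f : U → V →L[ℝ] E
  Df : U → U →L[ℝ] V →L[ℝ] E
  Y : ι → E

namespace RDE

variable (S S₁ : RDE ι V E U) (J : E →L[ℝ] U)

/-- The argument `a + J Y` of the vector field. -/
def state (i : ι) : U := S.a i + J (S.Y i)

/-- The Gubinelli derivative of the candidate. -/
def Y' (i : ι) : V →L[ℝ] E := S.y' i + S.f (S.state J i)

/-- The Gubinelli derivative of the state. -/
def state' (i : ι) : V →L[ℝ] U := S.a' i + J.comp (S.Y' J i)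

/-- The integrand. -/
def Z (i : ι) : V →L[ℝ] E := S.f (S.state J i)

/-- The Gubinelli derivative of the integrand. -/
def Z' (i : ι) : V →L[ℝ] V →L[ℝ] E := (S.Df (S.state J i)).comp (S.state' J i)

/-- The error made by the candidate in one step of the Euler scheme. -/
def error (X : ι → V) (T : ι → ι → (V →L[ℝ] V →L[ℝ] E) →L[ℝ] E) (i j : ι) : E :=
  S.Y j - S.Y i - (S.y j - S.y i) - germ X T (S.Z J) (S.Z' J) i j

/-- Bounds for the vector field and the driving part of the state. -/
structure StateBound [LE ι] (M : ℝ) (v : ι → ι → ℝ) (X : ι → V) : Prop where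
  f : C2Bound M S.f S.Df
  a : ∀ i j, i ≤ j → Ctrl M (v i j) (X j - X i) (S.a i) (S.a j) (S.a' i) (S.a' j)

/-- Bounds for the data of the equation. -/
structure Bound [LE ι] (M : ℝ) (v : ι → ι → ℝ) (X : ι → V) : Prop extends
    S.StateBound M v X where
  y : ∀ i j, i ≤ j → Ctrl M (v i j) (X j - X i) (S.y i) (S.y j) (S.y' i) (S.y' j)

/-- Bounds for the difference of the data of two equations. -/
structure Dist [LE ι] (η : ℝ) (v : ι → ι → ℝ) (X : ι → V) : Prop where
  f : C2Bound η (fun z => S.f z - S₁.f z) (fun z => S.Df z - S₁.Df z)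
  a_le : ∀ i, ‖S.a i - S₁.a i‖ ≤ η
  a : ∀ i j, i ≤ j → Ctrl η (v i j) (X j - X i) (S.a i - S₁.a i) (S.a j - S₁.a j)
    (S.a' i - S₁.a' i) (S.a' j - S₁.a' j)
  y : ∀ i j, i ≤ j → Ctrl η (v i j) (X j - X i) (S.y i - S₁.y i) (S.y j - S₁.y j)
    (S.y' i - S₁.y' i) (S.y' j - S₁.y' j)

/-- The candidate is a controlled path, with bounds of size `c`, between `i` and `j`. -/
def CtrlY (c : ℝ) (v : ι → ι → ℝ) (X : ι → V) (i j : ι) : Prop :=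
  Ctrl c (v i j) (X j - X i) (S.Y i) (S.Y j) (S.Y' J i) (S.Y' J j)

/-- The difference of two candidates is a controlled path, with bounds of size `c`, between `i`
and `j`. -/
def CtrlSub (c : ℝ) (v : ι → ι → ℝ) (X : ι → V) (i j : ι) : Prop :=
  Ctrl c (v i j) (X j - X i) (S.Y i - S₁.Y i) (S.Y j - S₁.Y j)
    (S.Y' J i - S₁.Y' J i) (S.Y' J j - S₁.Y' J j)

variable {S S₁ J}

theorem ctrl_state {M c : ℝ} {v : ι → ι → ℝ} {X : ι → V} (hJ : ‖J‖ ≤ 1) {i j : ι}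
    (ha : Ctrl M (v i j) (X j - X i) (S.a i) (S.a j) (S.a' i) (S.a' j))
    (hY : S.CtrlY J c v X i j) :
    Ctrl (M + c) (v i j) (X j - X i) (S.state J i) (S.state J j) (S.state' J i) (S.state' J j) :=
  ha.add (hY.map J hJ)

theorem ctrl_state_sub {M c : ℝ} {v : ι → ι → ℝ} {X : ι → V} (hJ : ‖J‖ ≤ 1) {i j : ι}
    (ha : Ctrl M (v i j) (X j - X i) (S.a i - S₁.a i) (S.a j - S₁.a j)
      (S.a' i - S₁.a' i) (S.a' j - S₁.a' j))
    (hY : S.CtrlSub S₁ J c v X i j) :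
    Ctrl (M + c) (v i j) (X j - X i) (S.state J i - S₁.state J i) (S.state J j - S₁.state J j)
      (S.state' J i - S₁.state' J i) (S.state' J j - S₁.state' J j) := by
  have e : ∀ k, S.state J k - S₁.state J k = (S.a k - S₁.a k) + J (S.Y k - S₁.Y k) := fun k => by
    simp only [state, map_sub]; abel
  have e' : ∀ k, S.state' J k - S₁.state' J k =
      (S.a' k - S₁.a' k) + J.comp (S.Y' J k - S₁.Y' J k) := fun k => by
    simp only [state', ContinuousLinearMap.comp_sub]; abel
  rw [e, e, e', e']
  exact ha.add (hY.map J hJ)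

/-- A candidate whose Euler error over one interval is of second order is controlled there. -/
theorem exists_ctrlY (M : ℝ) (hM : 0 ≤ M) : ∃ L, 0 ≤ L ∧
    ∀ {S : RDE ι V E U} {J : E →L[ℝ] U} [LE ι] {v : ι → ι → ℝ} {X : ι → V}
      {T : ι → ι → (V →L[ℝ] V →L[ℝ] E) →L[ℝ] E}, ‖J‖ ≤ 1 → Driver v X T → S.Bound M v X →
      ∀ i j, i ≤ j → v i j ≤ M → ‖S.error J X T i j‖ ≤ v i j ^ 2 → S.CtrlY J L v X i j := by
  -- `r` bounds the remainder of `Y`, `q` its increment and `s` the increment of `Y'`, each relative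
  -- to its power of the gauge. The final `1` in `r` is the assumed size of the Euler error.
  set r := M + (M * (M + (M + M))) + 1 with hr
  set q := (2 * M + r * M) with hq
  have hr0 : 0 ≤ r := by positivity
  have hq0 : 0 ≤ q := by positivity
  set s := M + M * (M * (1 + M) + q) with hs
  have hs0 : 0 ≤ s := by positivity
  refine ⟨2 * M + r + s, by positivity, ?_⟩
  intro S J _ v X T hJ hX hS i j hij hv herr
  have hx := hX.X_le i j hij
  have h0 : 0 ≤ v i j := (norm_nonneg _).trans hx
  have ha := hS.a i j hij
  have hy := hS.y i j hij
  have hJ' : ∀ z, ‖J z‖ ≤ ‖z‖ := fun z => (J.le_of_opNorm_le hJ z).trans (by simp)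
  -- Since `f` is bounded, `Y'` is bounded without any information on `Y`. This makes `L` depend on
  -- `M` only.
  have hYi : ‖S.Y' J i‖ ≤ M + M := (norm_add_le _ _).trans (add_le_add hy.left (hS.f.bound _))
  have hYj : ‖S.Y' J j‖ ≤ M + M := (norm_add_le _ _).trans (add_le_add hy.right (hS.f.bound _))
  have hsi : ‖S.state' J i‖ ≤ M + (M + M) := (norm_add_le _ _).trans (add_le_add ha.left
    ((J.opNorm_comp_le _).trans ((mul_le_of_le_one_left (norm_nonneg _) hJ).trans hYi)))
  have hZ' : ‖S.Z' J i‖ ≤ M * (M + (M + M)) := (ContinuousLinearMap.opNorm_comp_le _ _).trans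
    (mul_le_mul (hS.f.bound_deriv _) hsi (norm_nonneg _) hM)
  have hTZ : ‖T i j (S.Z' J i)‖ ≤ v i j ^ 2 * (M * (M + (M + M))) :=
    ((T i j).le_opNorm _).trans (mul_le_mul (hX.T_le i j hij) hZ' (norm_nonneg _) (by positivity))
  have hrem : ‖S.Y j - S.Y i - S.Y' J i (X j - X i)‖ ≤ r * v i j ^ 2 := by
    have e : S.Y j - S.Y i - S.Y' J i (X j - X i) = (S.y j - S.y i - S.y' i (X j - X i)) +
        T i j (S.Z' J i) + S.error J X T i j := by
      simp only [error, germ, Y', Z, add_apply]; abel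
    rw [e]
    refine (norm_add₃_le ..).trans ?_
    have := hy.rem
    have : r * v i j ^ 2 = M * v i j ^ 2 + v i j ^ 2 * (M * (M + (M + M))) + v i j ^ 2 := by
      rw [hr]; ring
    linarith
  have hYY : ‖S.Y j - S.Y i‖ ≤ q * v i j := by
    have e : S.Y j - S.Y i = (S.Y j - S.Y i - S.Y' J i (X j - X i)) + S.Y' J i (X j - X i) := by
      abel
    have h1 : ‖S.Y' J i (X j - X i)‖ ≤ (M + M) * v i j :=
      ((S.Y' J i).le_opNorm _).trans (mul_le_mul hYi hx (norm_nonneg _) (by positivity))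
    have h2 : r * v i j ^ 2 ≤ r * (M * v i j) := by rw [sq]; gcongr
    have h3 := norm_add_le (S.Y j - S.Y i - S.Y' J i (X j - X i)) (S.Y' J i (X j - X i))
    rw [← e] at h3
    rw [hq]
    linarith
  have hst : ‖S.state J j - S.state J i‖ ≤ (M * (1 + M) + q) * v i j := by
    have e : S.state J j - S.state J i = (S.a j - S.a i) + J (S.Y j - S.Y i) := by
      simp only [state, map_sub]; abel
    rw [e, add_mul]
    exact (norm_add_le _ _).trans (add_le_add (ha.norm_sub_le hx hv) ((hJ' _).trans hYY))
  have hd : ‖S.Y' J j - S.Y' J i‖ ≤ s * v i j := by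
    have e : S.Y' J j - S.Y' J i = (S.y' j - S.y' i) + (S.f (S.state J j) - S.f (S.state J i)) := by
      simp only [Y']; abel
    rw [e]
    refine (norm_add_le _ _).trans ?_
    have := hy.deriv
    have := (hS.f.lip (S.state J j) (S.state J i)).trans (mul_le_mul_of_nonneg_left hst hM)
    have : s * v i j = M * v i j + M * ((M * (1 + M) + q) * v i j) := by rw [hs]; ring
    linarith
  have q1 : 0 ≤ M * v i j := by positivity
  have q2 : 0 ≤ r * v i j := by positivity
  have q3 : 0 ≤ M * v i j ^ 2 := by positivity
  have q4 : 0 ≤ s * v i j ^ 2 := by positivity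
  exact ⟨by linarith, by linarith, by linarith, by linarith⟩

end RDE

end Systems

end CadlagRough

namespace CadlagRough

/-! ### The a priori bound for Euler schemes. -/

noncomputable section Discrete

set_option maxSynthPendingDepth 3

variable {ι V E U : Type*} [NormedAddCommGroup V] [NormedSpace ℝ V]
  [NormedAddCommGroup E] [NormedSpace ℝ E] [NormedAddCommGroup U] [NormedSpace ℝ U]

/-- Remainders add up to the cross term `(b' - a') x₁`, a product of two first-order quantities.
This is the second copy of `c`. -/
theorem Ctrl.trans {c c₁ v v₁ v₂ : ℝ} {x x₁ : V} {a b e : U} {a' b' e' : V →L[ℝ] U}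
    (h : Ctrl c v x a b a' b') (h₁ : Ctrl c₁ v₁ x₁ b e b' e') (h0 : 0 ≤ v) (hv : v ≤ v₂)
    (h0₁ : 0 ≤ v₁) (hv₁ : v₁ ≤ v₂) (hx : ‖x₁‖ ≤ v₂) :
    Ctrl (2 * c + c₁) v₂ (x₁ + x) a e a' e' := by
  have hc := h.nonneg
  have hc₁ := h₁.nonneg
  have g := h.mono_gauge h0 hv
  have g₁ := h₁.mono_gauge h0₁ hv₁
  have h2 : 0 ≤ v₂ := h0.trans hv
  have q : 0 ≤ c * v₂ := by positivity
  refine ⟨by linarith [h.left], by linarith [h₁.right], ?_, ?_⟩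
  · have e1 : e' - a' = (e' - b') + (b' - a') := by abel
    rw [e1]
    refine (norm_add_le _ _).trans ?_
    linarith [g.deriv, g₁.deriv]
  · have e1 : e - a - a' (x₁ + x) = (e - b - b' x₁) + (b - a - a' x) + (b' - a') x₁ := by
      simp only [map_add, sub_apply]; abel
    have e2 : ‖(b' - a') x₁‖ ≤ c * v₂ * v₂ :=
      ((b' - a').le_opNorm _).trans (mul_le_mul g.deriv hx (norm_nonneg _) (by positivity))
    rw [e1]
    refine (norm_add₃_le ..).trans ?_
    linarith [g.rem, g₁.rem]

/-- The gauge `w ^ (1 / p)` of a control. -/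
def gauge (p : ℝ) (w : ι → ι → ℝ) (i j : ι) : ℝ := w i j ^ (1 / p)

section Gauge

variable {p M : ℝ} {w : ι → ι → ℝ} {i j : ι}

theorem gauge_nonneg (h : 0 ≤ w i j) : 0 ≤ gauge p w i j := Real.rpow_nonneg h _

theorem gauge_mono (hp : 0 < p) {i' j' : ι} (h : 0 ≤ w i j) (hle : w i j ≤ w i' j') :
    gauge p w i j ≤ gauge p w i' j' := Real.rpow_le_rpow h hle (by positivity)

theorem gauge_le (hp : 1 ≤ p) (hM : 1 ≤ M) (h : 0 ≤ w i j) (hle : w i j ≤ M) :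
    gauge p w i j ≤ M := by
  refine (Real.rpow_le_rpow h hle (by positivity)).trans ?_
  conv_rhs => rw [← Real.rpow_one M]
  exact Real.rpow_le_rpow_of_exponent_le hM (by rw [div_le_one (by linarith)]; exact hp)

/-- As `p ≤ 3`, the cube compensates the root, so that the smallness threshold for the control can
be chosen independently of `p`. -/
theorem gauge_le_of_le_cube (hp : 0 < p) (hp3 : p ≤ 3) {δ : ℝ} (hδ : 0 < δ) (hδ1 : δ ≤ 1)
    (h : 0 ≤ w i j) (hle : w i j ≤ δ ^ 3) : gauge p w i j ≤ δ := by
  refine (Real.rpow_le_rpow h hle (by positivity)).trans ?_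
  rw [← Real.rpow_natCast, ← Real.rpow_mul hδ.le]
  conv_rhs => rw [← Real.rpow_one δ]
  refine Real.rpow_le_rpow_of_exponent_ge hδ hδ1 ?_
  rw [Nat.cast_ofNat, mul_one_div, le_div_iff₀ hp]
  linarith

theorem gauge_pow (h : 0 ≤ w i j) (n : ℕ) : gauge p w i j ^ n = w i j ^ ((n : ℝ) / p) := by
  rw [gauge, ← Real.rpow_natCast, ← Real.rpow_mul h]
  congr 1
  ring

end Gauge

namespace Superadd

variable {p γ M : ℝ} {w : ℕ → ℕ → ℝ}

theorem gauge_nonneg (hw : Superadd w) {i j : ℕ} (h : i ≤ j) : 0 ≤ gauge p w i j :=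
  CadlagRough.gauge_nonneg (hw.nonneg i j h)

theorem gauge_mono (hw : Superadd w) (hp : 0 < p) {i i' j' j : ℕ} (h1 : i ≤ i') (h2 : i' ≤ j')
    (h3 : j' ≤ j) : gauge p w i' j' ≤ gauge p w i j :=
  CadlagRough.gauge_mono hp (hw.nonneg _ _ h2) (hw.mono h1 h2 h3)

theorem gauge_split (hw : Superadd w) (hp : 0 < p) (hp3 : p ≤ 3)
    (hγ : (2 : ℝ) ^ (1 - 3 / p) ≤ 1 - γ) {i j : ℕ} (hij : i < j) :
    ∃ m, i ≤ m ∧ m < j ∧ gauge p w i m ^ 3 + gauge p w (m + 1) j ^ 3 ≤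
      (1 - γ) * gauge p w i j ^ 3 := by
  obtain ⟨m, h1, h2, h3⟩ := hw.split_rpow (by rwa [one_le_div hp]) hγ hij
  refine ⟨m, h1, h2, ?_⟩
  rw [gauge_pow (hw.nonneg _ _ h1), gauge_pow (hw.nonneg _ _ h2),
    gauge_pow (hw.nonneg _ _ hij.le)]
  exact_mod_cast h3

end Superadd

/-- The product of gauges over adjacent intervals in the increment of a germ. -/
theorem gauge_mul_le {c a b v : ℝ} (hc : 0 ≤ c) (ha : 0 ≤ a) (hb : 0 ≤ b) (hav : a ≤ v)
    (hbv : b ≤ v) : c * (a ^ 2 * b + a * b ^ 2) ≤ 2 * c * v ^ 3 := by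
  have hv : 0 ≤ v := ha.trans hav
  have h1 : a ^ 2 * b ≤ v ^ 2 * v := by gcongr
  have h2 : a * b ^ 2 ≤ v * v ^ 2 := by gcongr
  calc c * (a ^ 2 * b + a * b ^ 2) ≤ c * (v ^ 2 * v + v * v ^ 2) := by gcongr
    _ = 2 * c * v ^ 3 := by ring

namespace RDE

/-- The steps of an exact scheme telescope, so its error over `[i, j]` is precisely the quantity
that the sewing lemma estimates. -/
theorem error_eq_defect {S : RDE ℕ V E U} {J : E →L[ℝ] U} {X : ℕ → V}
    {T : ℕ → ℕ → (V →L[ℝ] V →L[ℝ] E) →L[ℝ] E} (hS : ∀ l, S.error J X T l (l + 1) = 0)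
    {i j : ℕ} (hij : i ≤ j) :
    S.error J X T i j = defect (germ X T (S.Z J) (S.Z' J)) i j := by
  have h : S.Y j - S.Y i - (S.y j - S.y i) =
      ∑ l ∈ Finset.Ico i j, germ X T (S.Z J) (S.Z' J) l (l + 1) := by
    induction j, hij using Nat.le_induction with
    | base => simp
    | succ j hij ih =>
      rw [Finset.sum_Ico_succ_top hij, ← ih, ← sub_eq_zero]
      have := hS j
      simp only [error] at this
      rw [← this]
      abel
  rw [error, h, defect]

/-- The candidate is controlled on all subintervals of `[s, t]`. -/
def CtrlYOn (S : RDE ℕ V E U) (J : E →L[ℝ] U) (c : ℝ) (v : ℕ → ℕ → ℝ) (X : ℕ → V)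
    (s t : ℕ) : Prop := ∀ i j, s ≤ i → i ≤ j → j ≤ t → S.CtrlY J c v X i j

/-- The difference of two candidates is controlled on all subintervals of `[s, t]`. -/
def CtrlSubOn (S S₁ : RDE ℕ V E U) (J : E →L[ℝ] U) (c : ℝ) (v : ℕ → ℕ → ℝ) (X : ℕ → V)
    (s t : ℕ) : Prop := ∀ i j, s ≤ i → i ≤ j → j ≤ t → S.CtrlSub S₁ J c v X i j

section Concat

variable {p : ℝ} {w : ℕ → ℕ → ℝ} {S S₁ : RDE ℕ V E U} {J : E →L[ℝ] U} {X : ℕ → V}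
  {T : ℕ → ℕ → (V →L[ℝ] V →L[ℝ] E) →L[ℝ] E} {c c₁ : ℝ} {s m t : ℕ}

theorem CtrlYOn.concat (hw : Superadd w) (hp : 0 < p) (hX : Driver (gauge p w) X T)
    (h : S.CtrlYOn J c (gauge p w) X s m) (h₁ : S.CtrlYOn J c₁ (gauge p w) X m t)
    (hc : 0 ≤ c) (hc₁ : 0 ≤ c₁) :
    S.CtrlYOn J (2 * c + c₁) (gauge p w) X s t := by
  intro i j hi hij hj
  rcases le_total j m with hjm | hmj
  · exact (h i j hi hij hjm).mono (hw.gauge_nonneg hij) (by linarith)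
  rcases le_total m i with hmi | him
  · exact (h₁ i j hmi hij hj).mono (hw.gauge_nonneg hij) (by linarith)
  have := (h i m hi him le_rfl).trans (h₁ m j le_rfl hmj hj) (hw.gauge_nonneg him)
    (hw.gauge_mono hp le_rfl him hmj) (hw.gauge_nonneg hmj) (hw.gauge_mono hp him hmj le_rfl)
    ((hX.X_le m j hmj).trans (hw.gauge_mono hp him hmj le_rfl))
  rwa [sub_add_sub_cancel] at this

theorem CtrlSubOn.concat (hw : Superadd w) (hp : 0 < p) (hX : Driver (gauge p w) X T)
    (h : S.CtrlSubOn S₁ J c (gauge p w) X s m) (h₁ : S.CtrlSubOn S₁ J c₁ (gauge p w) X m t)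
    (hc : 0 ≤ c) (hc₁ : 0 ≤ c₁) :
    S.CtrlSubOn S₁ J (2 * c + c₁) (gauge p w) X s t := by
  intro i j hi hij hj
  rcases le_total j m with hjm | hmj
  · exact (h i j hi hij hjm).mono (hw.gauge_nonneg hij) (by linarith)
  rcases le_total m i with hmi | him
  · exact (h₁ i j hmi hij hj).mono (hw.gauge_nonneg hij) (by linarith)
  have := (h i m hi him le_rfl).trans (h₁ m j le_rfl hmj hj) (hw.gauge_nonneg him)
    (hw.gauge_mono hp le_rfl him hmj) (hw.gauge_nonneg hmj) (hw.gauge_mono hp him hmj le_rfl)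
    ((hX.X_le m j hmj).trans (hw.gauge_mono hp him hmj le_rfl))
  rwa [sub_add_sub_cancel] at this

end Concat

/-- The a priori bound for Euler schemes. -/
theorem exists_euler_bound (γ M : ℝ) (hγ : 0 < γ) (hM : 1 ≤ M) : ∃ L, 0 ≤ L ∧
    ∀ {p : ℝ}, 2 < p → p < 3 → (2 : ℝ) ^ (1 - 3 / p) ≤ 1 - γ →
    ∀ {w : ℕ → ℕ → ℝ}, Superadd w → (∀ i j, i ≤ j → w i j ≤ M) →
    ∀ {S : RDE ℕ V E U} {J : E →L[ℝ] U} {X : ℕ → V} {T : ℕ → ℕ → (V →L[ℝ] V →L[ℝ] E) →L[ℝ] E},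
      ‖J‖ ≤ 1 → Driver (gauge p w) X T → S.Bound M (gauge p w) X →
      (∀ l, S.error J X T l (l + 1) = 0) → ∀ i j, i ≤ j → S.CtrlY J L (gauge p w) X i j := by
  have hM0 : 0 ≤ M := by linarith
  obtain ⟨L, hL0, hL⟩ := exists_ctrlY (V := V) (E := E) (U := U) (ι := ℕ) M hM0
  -- The constant of `Ctrl.comp` for the state, whose own bound is `M + L`. The germ then has
  -- increments at most `2 * C * v ^ 3`, so sewing asks for `Γ = 4 * C / γ`; and `δ` is chosen to
  -- make `Γ * v ^ 3 ≤ v ^ 2` when `v ≤ δ`.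
  set C := M * (M + L) + M * ((M + L) * (1 + M)) ^ 2 with hC
  have hC0 : 0 ≤ C := by positivity
  set Γ := 4 * C / γ with hΓ
  have hΓ0 : 0 ≤ Γ := by positivity
  set δ := 1 / (1 + Γ) with hδ
  have hδ0 : 0 < δ := by positivity
  have hδ1 : δ ≤ 1 := by rw [hδ, div_le_one (by positivity)]; linarith
  have hΓδ : Γ * δ ≤ 1 := by
    rw [hδ, mul_one_div, div_le_one (by positivity)]; linarith
  set n := ⌈M / δ ^ 3⌉₊ with hn
  set F : ℝ → ℝ := fun c => 2 * c + L with hF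
  have hFn : ∀ k, 0 ≤ F^[k] L := by
    intro k
    induction k with
    | zero => simpa using hL0
    | succ k ih => rw [Function.iterate_succ_apply']; simp only [hF]; linarith
  refine ⟨F^[2 * n + 1] L, hFn _, ?_⟩
  intro p hp2 hp3 hγp w hw hwM S J X T hJ hX hS hE i j hij
  have hp0 : 0 < p := by linarith
  have hvM : ∀ i j, i ≤ j → gauge p w i j ≤ M := fun i j h =>
    gauge_le (by linarith) hM (hw.nonneg i j h) (hwM i j h)
  have hone : ∀ i j, i ≤ j → j ≤ i + 1 → S.CtrlY J L (gauge p w) X i j := by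
    intro i j hij hj
    refine hL hJ hX hS i j hij (hvM i j hij) ?_
    rw [error_eq_defect hE hij]
    rcases hij.eq_or_lt with rfl | h
    · simp only [defect, Finset.Ico_self, Finset.sum_empty, germ_self hX, sub_zero, norm_zero]
      positivity
    · obtain rfl : j = i + 1 := by omega
      rw [defect_succ, norm_zero]; positivity
  have hblock : ∀ s t, s ≤ t → w s t ≤ δ ^ 3 → S.CtrlYOn J L (gauge p w) X s t := by
    intro s t hst hδw
    have hv : gauge p w s t ≤ δ :=
      gauge_le_of_le_cube hp0 hp3.le hδ0 hδ1 (hw.nonneg s t hst) hδw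
    -- The bootstrap: on a block with gauge at most `δ` the sewing bound is stronger than the
    -- second-order bound required by `hL`, which returns the same `L`. The sewing induction below
    -- calls this on its left subintervals.
    have hctrl : ∀ i j, s ≤ i → i ≤ j → j ≤ t →
        ‖defect (germ X T (S.Z J) (S.Z' J)) i j‖ ≤ Γ * gauge p w i j ^ 3 →
        S.CtrlY J L (gauge p w) X i j := by
      intro i j hi hij hj h
      refine hL hJ hX hS i j hij (hvM i j hij) ?_
      rw [error_eq_defect hE hij]
      refine h.trans ?_
      have h0 := hw.gauge_nonneg (p := p) hij
      have h1 : gauge p w i j ≤ δ := (hw.gauge_mono hp0 hi hij hj).trans hv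
      calc Γ * gauge p w i j ^ 3 = Γ * gauge p w i j * gauge p w i j ^ 2 := by ring
        _ ≤ 1 * gauge p w i j ^ 2 := by
            gcongr
            exact (mul_le_mul_of_nonneg_left h1 hΓ0).trans hΓδ
        _ = _ := one_mul _
    have hsew := norm_defect_le (Ξ := germ X T (S.Z J) (S.Z' J))
      (Φ := fun i j => gauge p w i j ^ 3) (Γ := Γ) (K := 2 * C) (γ := γ) (s := s) (t := t)
      (fun i => germ_self hX i) (fun i j h => by have := hw.gauge_nonneg (p := p) h; positivity)
      (fun i m j h1 h2 => by
        have := hw.gauge_nonneg (p := p) h2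
        have := hw.gauge_mono hp0 h1 h2 (le_refl j)
        gcongr)
      (fun i j h => hw.gauge_split hp0 hp3.le hγp h) (by positivity) hΓ0
      (by rw [hΓ, mul_div_cancel₀ _ hγ.ne']; linarith)
      (fun i m j hi him hmj hj h => by
        have h1 := hctrl i m hi him (hmj.trans hj) h
        have h2 := (ctrl_state hJ (hS.a i m him) h1).comp hS.f (hX.X_le i m him) (hvM i m him)
        exact (norm_germ_delta_le hX him hmj h2).trans (gauge_mul_le hC0 (hw.gauge_nonneg him)
          (hw.gauge_nonneg hmj) (hw.gauge_mono hp0 le_rfl him hmj)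
          (hw.gauge_mono hp0 him hmj le_rfl)))
    exact fun i j hi hij hj => hctrl i j hi hij hj (hsew i j hi hij hj)
  -- Blocks are handled by the bootstrap, and single steps, however large, by `hone`. Concatenation
  -- doubles the old constant and adds `L`, which is `F`.
  have hgood := hw.chain (δ := δ ^ 3) (by positivity)
    (Good := fun c b => 0 ≤ c ∧ S.CtrlYOn J c (gauge p w) X 0 b) (F := F) (C₀ := L)
    ⟨hL0, fun i j hi hij hj => hone i j hij (by omega)⟩
    (fun c m h => ⟨by simp only [hF]; linarith [h.1], h.2.concat hw hp0 hX
      (c₁ := L) (fun i j hi hij hj => hone i j hij (by omega)) h.1 hL0⟩)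
    (fun c m b hmb hwm h => ⟨by simp only [hF]; linarith [h.1], h.2.concat hw hp0 hX
      (c₁ := L) (hblock m b hmb hwm) h.1 hL0⟩) n j (by
      refine (hwM 0 j (Nat.zero_le _)).trans ?_
      rw [← div_le_iff₀ (by positivity)]
      exact Nat.le_ceil _)
  exact hgood.2 i j (Nat.zero_le _) hij le_rfl

end RDE

end Discrete

end CadlagRough

namespace CadlagRough

/-! ### Stability of Euler schemes. -/

noncomputable section Stability

set_option maxSynthPendingDepth 3

variable {ι V E U : Type*} [NormedAddCommGroup V] [NormedSpace ℝ V]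
  [NormedAddCommGroup E] [NormedSpace ℝ E] [NormedAddCommGroup U] [NormedSpace ℝ U]

namespace RDE

/-- Two candidates with close data and close Euler errors over one interval are close there. -/
theorem exists_ctrlSub (M : ℝ) (hM : 0 ≤ M) : ∃ C, 0 ≤ C ∧
    ∀ {S S₁ : RDE ι V E U} {J : E →L[ℝ] U} [LE ι] {v : ι → ι → ℝ} {X : ι → V}
      {T : ι → ι → (V →L[ℝ] V →L[ℝ] E) →L[ℝ] E} {η H : ℝ}, ‖J‖ ≤ 1 → Driver v X T →
      S.StateBound M v X → S₁.StateBound M v X → S.Dist S₁ η v X → η ≤ H →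
      ∀ i j, i ≤ j → v i j ≤ M → S.CtrlY J M v X i j → S₁.CtrlY J M v X i j →
      ‖S.Y i - S₁.Y i‖ ≤ H → ‖S.error J X T i j - S₁.error J X T i j‖ ≤ H * v i j ^ 2 →
      ‖(S.Y j - S₁.Y j) - (S.Y i - S₁.Y i)‖ ≤ C * H * v i j ∧
      (‖S.Y j - S₁.Y j‖ ≤ H → S.CtrlSub S₁ J (C * H) v X i j) := by
  -- Constants for differences of the two equations, relative to `H`: `k` for `Y'`, `c1` for `Z'`,
  -- `c2` for the remainder of `Y`, `c3` for the increment of `Y` and `c4` for the increment of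
  -- `Y'`.
  set k := 2 + 2 * M with hk
  have hk0 : 0 ≤ k := by positivity
  set c1 := (M + M) + M * 2 * (M + M) + M * (1 + k) with hc1
  have hc10 : 0 ≤ c1 := by positivity
  set c2 := 1 + c1 + 1 with hc2
  have hc20 : 0 ≤ c2 := by positivity
  set c3 := k + c2 * M with hc3
  have hc30 : 0 ≤ c3 := by positivity
  set N := (M + M) * (1 + M) with hN
  have hN0 : 0 ≤ N := by positivity
  set c4 := 1 + N + (M * ((1 + M) + c3) + M * N * 2) with hc4
  have hc40 : 0 ≤ c4 := by positivity
  refine ⟨k + c2 + c3 + c4, by positivity, ?_⟩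
  intro S S₁ J _ v X T η H hJ hX hS hS₁ hd hηH i j hij hv hY hY₁ hi herr
  have hη := hd.f.nonneg
  have hH : 0 ≤ H := hη.trans hηH
  have hx := hX.X_le i j hij
  have h0 : 0 ≤ v i j := (norm_nonneg _).trans hx
  have hJ' : ∀ z, ‖J z‖ ≤ ‖z‖ := fun z => (J.le_of_opNorm_le hJ z).trans (by simp)
  have hJc : ∀ B : V →L[ℝ] E, ‖J.comp B‖ ≤ ‖B‖ := fun B =>
    (J.opNorm_comp_le _).trans (mul_le_of_le_one_left (norm_nonneg _) hJ)
  have hA := ctrl_state hJ (hS.a i j hij) hY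
  have hA₁ := ctrl_state hJ (hS₁.a i j hij) hY₁
  have hstate : ∀ l, ‖S.Y l - S₁.Y l‖ ≤ H → ‖S.state J l - S₁.state J l‖ ≤ 2 * H := by
    intro l hl
    have e : S.state J l - S₁.state J l = (S.a l - S₁.a l) + J (S.Y l - S₁.Y l) := by
      simp only [state, map_sub]; abel
    rw [e]
    linarith [norm_add_le (S.a l - S₁.a l) (J (S.Y l - S₁.Y l)), hd.a_le l,
      hJ' (S.Y l - S₁.Y l)]
  have hY' : ∀ l, ‖S.Y l - S₁.Y l‖ ≤ H → ‖S.y' l - S₁.y' l‖ ≤ η →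
      ‖S.Y' J l - S₁.Y' J l‖ ≤ k * H := by
    intro l hl hl'
    have e : S.Y' J l - S₁.Y' J l = (S.y' l - S₁.y' l) +
        (S.f (S.state J l) - S₁.f (S.state J l)) +
        (S₁.f (S.state J l) - S₁.f (S₁.state J l)) := by
      simp only [Y']; abel
    rw [e]
    refine (norm_add₃_le ..).trans ?_
    have := (hS₁.f.lip (S.state J l) (S₁.state J l)).trans
      (mul_le_mul_of_nonneg_left (hstate l hl) hM)
    have := hd.f.bound (S.state J l)
    rw [hk]
    linarith
  have hYi' := hY' i hi (hd.y i j hij).left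
  have hsi' : ‖S.state' J i - S₁.state' J i‖ ≤ (1 + k) * H := by
    have e : S.state' J i - S₁.state' J i =
        (S.a' i - S₁.a' i) + J.comp (S.Y' J i - S₁.Y' J i) := by
      simp only [state', ContinuousLinearMap.comp_sub]; abel
    rw [e]
    linarith [norm_add_le (S.a' i - S₁.a' i) (J.comp (S.Y' J i - S₁.Y' J i)),
      (hd.a i j hij).left, hJc (S.Y' J i - S₁.Y' J i)]
  have opc : ∀ (P : U →L[ℝ] V →L[ℝ] E) (R : V →L[ℝ] U) {s r : ℝ}, ‖P‖ ≤ s → ‖R‖ ≤ r →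
      ‖P.comp R‖ ≤ s * r := fun P R s r hs hr =>
    (P.opNorm_comp_le R).trans (mul_le_mul hs hr (norm_nonneg _) ((norm_nonneg _).trans hs))
  have hZ' : ‖S.Z' J i - S₁.Z' J i‖ ≤ c1 * H := by
    have e : S.Z' J i - S₁.Z' J i =
        (S.Df (S.state J i) - S₁.Df (S.state J i)).comp (S.state' J i) +
        (S₁.Df (S.state J i) - S₁.Df (S₁.state J i)).comp (S.state' J i) +
        (S₁.Df (S₁.state J i)).comp (S.state' J i - S₁.state' J i) := by
      simp [Z']
    have i1 := opc _ (S.state' J i) ((hd.f.bound_deriv (S.state J i)).trans hηH) hA.left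
    have i2 := opc (S₁.Df (S.state J i) - S₁.Df (S₁.state J i)) (S.state' J i)
      (s := M * (2 * H)) ((hS₁.f.lip_deriv _ _).trans (by gcongr; exact hstate i hi)) hA.left
    have i3 := opc (S₁.Df (S₁.state J i)) (S.state' J i - S₁.state' J i)
      (hS₁.f.bound_deriv _) hsi'
    rw [e]
    refine (norm_add₃_le ..).trans ?_
    have : c1 * H = H * (M + M) + M * (2 * H) * (M + M) + M * ((1 + k) * H) := by rw [hc1]; ring
    linarith
  have hrem : ‖(S.Y j - S₁.Y j) - (S.Y i - S₁.Y i) - (S.Y' J i - S₁.Y' J i) (X j - X i)‖ ≤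
      c2 * H * v i j ^ 2 := by
    have e : (S.Y j - S₁.Y j) - (S.Y i - S₁.Y i) - (S.Y' J i - S₁.Y' J i) (X j - X i) =
        ((S.y j - S₁.y j) - (S.y i - S₁.y i) - (S.y' i - S₁.y' i) (X j - X i)) +
        T i j (S.Z' J i - S₁.Z' J i) + (S.error J X T i j - S₁.error J X T i j) := by
      simp only [error, germ, Y', Z, add_apply, sub_apply, map_sub]; abel
    have i1 := (hd.y i j hij).rem
    have i2 : ‖T i j (S.Z' J i - S₁.Z' J i)‖ ≤ v i j ^ 2 * (c1 * H) :=
      ((T i j).le_opNorm _).trans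
        (mul_le_mul (hX.T_le i j hij) hZ' (norm_nonneg _) (by positivity))
    have i3 : η * v i j ^ 2 ≤ H * v i j ^ 2 := by gcongr
    rw [e]
    refine (norm_add₃_le ..).trans ?_
    have : c2 * H * v i j ^ 2 = H * v i j ^ 2 + v i j ^ 2 * (c1 * H) + H * v i j ^ 2 := by
      rw [hc2]; ring
    linarith
  have hinc : ‖(S.Y j - S₁.Y j) - (S.Y i - S₁.Y i)‖ ≤ c3 * H * v i j := by
    have e : (S.Y j - S₁.Y j) - (S.Y i - S₁.Y i) =
        ((S.Y j - S₁.Y j) - (S.Y i - S₁.Y i) - (S.Y' J i - S₁.Y' J i) (X j - X i)) +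
        (S.Y' J i - S₁.Y' J i) (X j - X i) := by abel
    have h1 : ‖(S.Y' J i - S₁.Y' J i) (X j - X i)‖ ≤ k * H * v i j :=
      (ContinuousLinearMap.le_opNorm _ _).trans
        (mul_le_mul hYi' hx (norm_nonneg _) (by positivity))
    have h2 : c2 * H * v i j ^ 2 ≤ c2 * H * (M * v i j) := by rw [sq]; gcongr
    have h3 := norm_add_le
      ((S.Y j - S₁.Y j) - (S.Y i - S₁.Y i) - (S.Y' J i - S₁.Y' J i) (X j - X i))
      ((S.Y' J i - S₁.Y' J i) (X j - X i))
    rw [← e] at h3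
    have : c3 * H * v i j = k * H * v i j + c2 * H * (M * v i j) := by rw [hc3]; ring
    linarith
  have q1 : 0 ≤ k * H := by positivity
  have q2 : 0 ≤ c2 * H := by positivity
  have q3 : 0 ≤ c3 * H := by positivity
  have q4 : 0 ≤ c4 * H := by positivity
  have q1v : 0 ≤ k * H * v i j := by positivity
  have q2v : 0 ≤ c2 * H * v i j := by positivity
  have q3v : 0 ≤ c3 * H * v i j := by positivity
  have q4v : 0 ≤ c4 * H * v i j := by positivity
  have q1w : 0 ≤ k * H * v i j ^ 2 := by positivity
  have q3w : 0 ≤ c3 * H * v i j ^ 2 := by positivity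
  have q4w : 0 ≤ c4 * H * v i j ^ 2 := by positivity
  -- The increment of `Y - S₁.Y` is bounded from information at `i` alone, so it can be used to
  -- reach `j`; the remaining bounds use the size of the difference at `j` too.
  refine ⟨by linarith, fun hj => ?_⟩
  have hderiv : ‖(S.Y' J j - S₁.Y' J j) - (S.Y' J i - S₁.Y' J i)‖ ≤ c4 * H * v i j := by
    have e : (S.Y' J j - S₁.Y' J j) - (S.Y' J i - S₁.Y' J i) =
        ((S.y' j - S₁.y' j) - (S.y' i - S₁.y' i)) +
        ((S.f (S.state J j) - S₁.f (S.state J j)) - (S.f (S.state J i) - S₁.f (S.state J i))) +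
        ((S₁.f (S.state J j) - S₁.f (S.state J i)) -
          (S₁.f (S₁.state J j) - S₁.f (S₁.state J i))) := by
      simp only [Y']; abel
    have i1 := (hd.y i j hij).deriv
    have i2 : ‖(S.f (S.state J j) - S₁.f (S.state J j)) -
        (S.f (S.state J i) - S₁.f (S.state J i))‖ ≤ H * (N * v i j) :=
      (hd.f.lip _ _).trans (by gcongr; exact hA.norm_sub_le hx hv)
    have e2 : (S.state J j - S.state J i) - (S₁.state J j - S₁.state J i) =
        ((S.a j - S₁.a j) - (S.a i - S₁.a i)) +
          J ((S.Y j - S₁.Y j) - (S.Y i - S₁.Y i)) := by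
      simp only [state, map_sub]; abel
    have i3 : ‖(S.state J j - S.state J i) - (S₁.state J j - S₁.state J i)‖ ≤
        (H * (1 + M)) * v i j + c3 * H * v i j := by
      rw [e2]
      refine (norm_add_le _ _).trans (add_le_add ?_ ((hJ' _).trans hinc))
      exact ((hd.a i j hij).norm_sub_le hx hv).trans (by gcongr)
    have i4 := (hS₁.f.increment_sub (S.state J i) (S.state J j) (S₁.state J i)
      (S₁.state J j)).trans (show _ ≤ M * ((H * (1 + M)) * v i j + c3 * H * v i j) +
        M * (N * v i j) * (2 * H) by
          gcongr
          · exact hA₁.norm_sub_le hx hv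
          · exact hstate i hi)
    have i5 : η * v i j ≤ H * v i j := by gcongr
    rw [e]
    refine (norm_add₃_le ..).trans ?_
    have : c4 * H * v i j = H * v i j + H * (N * v i j) +
        (M * ((H * (1 + M)) * v i j + c3 * H * v i j) + M * (N * v i j) * (2 * H)) := by
      rw [hc4]; ring
    linarith
  have hYj' := hY' j hj (hd.y i j hij).right
  exact ⟨by linarith, by linarith, by linarith, by linarith⟩

theorem error_sub_eq_defect {S S₁ : RDE ℕ V E U} {J : E →L[ℝ] U} {X : ℕ → V}
    {T : ℕ → ℕ → (V →L[ℝ] V →L[ℝ] E) →L[ℝ] E} (hS : ∀ l, S.error J X T l (l + 1) = 0)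
    (hS₁ : ∀ l, S₁.error J X T l (l + 1) = 0) {i j : ℕ} (hij : i ≤ j) :
    S.error J X T i j - S₁.error J X T i j =
      defect (germ X T (fun i => S.Z J i - S₁.Z J i) (fun i => S.Z' J i - S₁.Z' J i)) i j := by
  rw [error_eq_defect hS hij, error_eq_defect hS₁ hij]
  simp only [defect, germ_sub, Finset.sum_sub_distrib]
  abel

/-- The stability of Euler schemes with respect to the data. -/
theorem exists_euler_stability (γ M : ℝ) (hγ : 0 < γ) (hM : 1 ≤ M) : ∃ C, 0 ≤ C ∧
    ∀ {p : ℝ}, 2 < p → p < 3 → (2 : ℝ) ^ (1 - 3 / p) ≤ 1 - γ →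
    ∀ {w : ℕ → ℕ → ℝ}, Superadd w → (∀ i j, i ≤ j → w i j ≤ M) →
    ∀ {S S₁ : RDE ℕ V E U} {J : E →L[ℝ] U} {X : ℕ → V}
      {T : ℕ → ℕ → (V →L[ℝ] V →L[ℝ] E) →L[ℝ] E} {D2f : U → U →L[ℝ] U →L[ℝ] V →L[ℝ] E} {η : ℝ},
      ‖J‖ ≤ 1 → Driver (gauge p w) X T → S.StateBound M (gauge p w) X → S₁.StateBound M (gauge p w) X →
      C2Bound M S₁.Df D2f → S.Dist S₁ η (gauge p w) X →
      (∀ l, S.error J X T l (l + 1) = 0) → (∀ l, S₁.error J X T l (l + 1) = 0) →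
      (∀ i j, i ≤ j → S.CtrlY J M (gauge p w) X i j) →
      (∀ i j, i ≤ j → S₁.CtrlY J M (gauge p w) X i j) → ‖S.Y 0 - S₁.Y 0‖ ≤ η →
      ∀ i j, i ≤ j → ‖S.Y j - S₁.Y j‖ ≤ C * η ∧ S.CtrlSub S₁ J (C * η) (gauge p w) X i j := by
  have hM0 : 0 ≤ M := by linarith
  obtain ⟨L, hL0, hL⟩ := exists_ctrlSub (V := V) (E := E) (U := U) (ι := ℕ) M hM0
  obtain ⟨R, hR0, hR⟩ := exists_ctrl_comp_sub (V := V) (U := U) (W := V →L[ℝ] E) (M + M) (1 + L)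
    (by positivity) (by positivity)
  -- States differ by at most `2 * H`, since the driving part and the candidate contribute `H` each.
  -- The composition estimate is applied with `2 * H` in place of `H`.
  set C := R * 2 with hC
  have hC0 : 0 ≤ C := by positivity
  set Γ := 4 * C / γ with hΓ
  have hΓ0 : 0 ≤ Γ := by positivity
  -- Two smallness conditions: `Γ * δ ≤ 1` for the bootstrap, and `L * (1 + M) * δ ≤ 1 / 2` to
  -- absorb the growth of the difference over a block.
  set δ := 1 / (1 + Γ + 2 * (L * (1 + M))) with hδ
  have hden : 0 < 1 + Γ + 2 * (L * (1 + M)) := by positivity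
  have hLM0 : 0 ≤ L * (1 + M) := by positivity
  have hδ0 : 0 < δ := by positivity
  have hδ1 : δ ≤ 1 := by rw [hδ, div_le_one hden]; linarith
  have hΓδ : Γ * δ ≤ 1 := by rw [hδ, mul_one_div, div_le_one hden]; linarith
  have hLδ : L * (1 + M) * δ ≤ 1 / 2 := by
    rw [hδ, mul_one_div, div_le_iff₀ hden]; linarith
  set n := ⌈M / δ ^ 3⌉₊ with hn
  -- `F₁` is the loss over a block, `F₂` the loss over a single step with gauge up to `M`, and `F`
  -- the loss after concatenation.
  set F₁ : ℝ → ℝ := fun c => (2 * c + 2) + L * (2 * c + 2) with hF₁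
  set F₂ : ℝ → ℝ := fun c => (1 + L) * ((c + 1) + L * (c + 1) * M) with hF₂
  set F : ℝ → ℝ := fun c => 2 * c + (F₁ c + F₂ c) with hF
  have hF₁0 : ∀ c, 0 ≤ c → 0 ≤ F₁ c := fun c hc => by simp only [hF₁]; positivity
  have hF₂0 : ∀ c, 0 ≤ c → 0 ≤ F₂ c := fun c hc => by simp only [hF₂]; positivity
  have hF0 : ∀ c, 0 ≤ c → 0 ≤ F c := fun c hc => by
    have := hF₁0 c hc; have := hF₂0 c hc; simp only [hF]; positivity
  have hFn : ∀ k, 0 ≤ F^[k] (1 + L) := by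
    intro k
    induction k with
    | zero => simp only [Function.iterate_zero, id]; positivity
    | succ k ih => rw [Function.iterate_succ_apply']; exact hF0 _ ih
  refine ⟨F^[2 * n + 1] (1 + L), hFn _, ?_⟩
  intro p hp2 hp3 hγp w hw hwM S S₁ J X T D2f η hJ hX hS hS₁ hD2 hd hE hE₁ hY hY₁ hY0 i j hij
  have hη := hd.f.nonneg
  have hp0 : 0 < p := by linarith
  have hvM : ∀ i j, i ≤ j → gauge p w i j ≤ M := fun i j h =>
    gauge_le (by linarith) hM (hw.nonneg i j h) (hwM i j h)
  have hone : ∀ {H : ℝ}, η ≤ H → ∀ i j, i ≤ j → j ≤ i + 1 → ‖S.Y i - S₁.Y i‖ ≤ H →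
      ‖(S.Y j - S₁.Y j) - (S.Y i - S₁.Y i)‖ ≤ L * H * gauge p w i j ∧
      (‖S.Y j - S₁.Y j‖ ≤ H → S.CtrlSub S₁ J (L * H) (gauge p w) X i j) := by
    intro H hH i j hij hj hi
    refine hL hJ hX hS hS₁ hd hH i j hij (hvM i j hij) (hY i j hij) (hY₁ i j hij) hi ?_
    have hH0 : 0 ≤ H := hη.trans hH
    rw [error_sub_eq_defect hE hE₁ hij]
    rcases hij.eq_or_lt with rfl | h
    · simp only [defect, Finset.Ico_self, Finset.sum_empty, germ_self hX, sub_zero, norm_zero]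
      positivity
    · obtain rfl : j = i + 1 := by omega
      rw [defect_succ, norm_zero]; positivity
  -- The bootstrap for differences, conditional on a uniform bound `H` for the difference over the
  -- block.
  have hsmall : ∀ {H : ℝ} (s t : ℕ), η ≤ H → s ≤ t → w s t ≤ δ ^ 3 →
      (∀ i, s ≤ i → i ≤ t → ‖S.Y i - S₁.Y i‖ ≤ H) →
      S.CtrlSubOn S₁ J (L * H) (gauge p w) X s t := by
    intro H s t hH hst hδw hYH
    have hH0 : 0 ≤ H := hη.trans hH
    have hv : gauge p w s t ≤ δ :=
      gauge_le_of_le_cube hp0 hp3.le hδ0 hδ1 (hw.nonneg s t hst) hδw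
    set Ξ := germ X T (fun i => S.Z J i - S₁.Z J i) (fun i => S.Z' J i - S₁.Z' J i) with hΞ
    have hctrl : ∀ i j, s ≤ i → i ≤ j → j ≤ t →
        ‖defect Ξ i j‖ ≤ Γ * H * gauge p w i j ^ 3 →
        S.CtrlSub S₁ J (L * H) (gauge p w) X i j := by
      intro i j hi hij hj h
      refine (hL hJ hX hS hS₁ hd hH i j hij (hvM i j hij) (hY i j hij) (hY₁ i j hij)
        (hYH i hi (hij.trans hj)) ?_).2 (hYH j (hi.trans hij) hj)
      rw [error_sub_eq_defect hE hE₁ hij]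
      refine h.trans ?_
      have h0 := hw.gauge_nonneg (p := p) hij
      have h1 : gauge p w i j ≤ δ := (hw.gauge_mono hp0 hi hij hj).trans hv
      calc Γ * H * gauge p w i j ^ 3 = Γ * gauge p w i j * (H * gauge p w i j ^ 2) := by ring
        _ ≤ 1 * (H * gauge p w i j ^ 2) := by
            gcongr
            exact (mul_le_mul_of_nonneg_left h1 hΓ0).trans hΓδ
        _ = _ := one_mul _
    have hsew := norm_defect_le (Ξ := Ξ)
      (Φ := fun i j => gauge p w i j ^ 3) (Γ := Γ * H) (K := 2 * (C * H)) (γ := γ)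
      (s := s) (t := t)
      (fun i => germ_self hX i) (fun i j h => by have := hw.gauge_nonneg (p := p) h; positivity)
      (fun i m j h1 h2 => by
        have := hw.gauge_nonneg (p := p) h2
        have := hw.gauge_mono hp0 h1 h2 (le_refl j)
        gcongr)
      (fun i j h => hw.gauge_split hp0 hp3.le hγp h) (by positivity) (by positivity)
      (by
        have : γ * (Γ * H) = 4 * C * H := by rw [hΓ]; field_simp
        rw [this]; linarith)
      (fun i m j hi him hmj hj h => by
        have hvi := hvM i m him
        have hv0 := hw.gauge_nonneg (p := p) him
        have h1 := ctrl_state_sub hJ (hd.a i m him) (hctrl i m hi him (hmj.trans hj) h)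
        have hA := ctrl_state hJ (hS.a i m him) (hY i m him)
        have hA₁ := ctrl_state hJ (hS₁.a i m him) (hY₁ i m him)
        have hst : ∀ l, s ≤ l → l ≤ t → ‖S.state J l - S₁.state J l‖ ≤ 2 * H := by
          intro l hl hl'
          have e : S.state J l - S₁.state J l = (S.a l - S₁.a l) + J (S.Y l - S₁.Y l) := by
            simp only [state, map_sub]; abel
          rw [e]
          have := (J.le_of_opNorm_le hJ (S.Y l - S₁.Y l))
          linarith [norm_add_le (S.a l - S₁.a l) (J (S.Y l - S₁.Y l)), hd.a_le l,
            hYH l hl hl']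
        have h2 := hR (H := 2 * H) (hS₁.f.mono (by linarith)) (hD2.mono (by linarith)) hd.f
          (by linarith) (hX.X_le i m him) (hvi.trans (by linarith)) hA hA₁
          (h1.mono hv0 (by
            have : 0 ≤ L * H := by positivity
            linarith))
          (hst i hi (him.trans (hmj.trans hj))) (hst m (hi.trans him) (hmj.trans hj))
        refine (norm_germ_delta_le (c := C * H) hX him hmj (h2.mono hv0 ?_)).trans
          (gauge_mul_le (by positivity) hv0
          (hw.gauge_nonneg hmj) (hw.gauge_mono hp0 le_rfl him hmj)
          (hw.gauge_mono hp0 him hmj le_rfl))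
        rw [hC]; linarith)
    exact fun i j hi hij hj => hctrl i j hi hij hj (hsew i j hi hij hj)
  have hblock : ∀ {D : ℝ} (s t : ℕ), 0 ≤ D → s ≤ t → w s t ≤ δ ^ 3 → ‖S.Y s - S₁.Y s‖ ≤ D * η →
      (∀ i, s ≤ i → i ≤ t → ‖S.Y i - S₁.Y i‖ ≤ (2 * D + 2) * η) ∧
      S.CtrlSubOn S₁ J (L * ((2 * D + 2) * η)) (gauge p w) X s t := by
    intro D s t hD hst hδw hYs
    -- The uniform bound is removed with the maximum `Q` of the difference on the block. With `H = η
    -- + Q` the growth is at most `(η + Q) / 2`, so `Q ≤ (η + Q) / 2 + D * η`, that is, `η + Q ≤ (2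
    -- * D + 2) * η`.
    obtain ⟨k, hk, hkmax⟩ := Finset.exists_max_image (Finset.Icc s t)
      (fun i => ‖S.Y i - S₁.Y i‖) ⟨s, Finset.mem_Icc.2 ⟨le_rfl, hst⟩⟩
    obtain ⟨hk1, hk2⟩ := Finset.mem_Icc.1 hk
    set Q := ‖S.Y k - S₁.Y k‖ with hQ
    have hQ0 : 0 ≤ Q := norm_nonneg _
    have h1 := hsmall (H := η + Q) s t (by linarith) hst hδw
      (fun i hi hi' => (hkmax i (Finset.mem_Icc.2 ⟨hi, hi'⟩)).trans (by linarith))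
    have h2 := (h1 s k le_rfl hk1 hk2).norm_sub_le (hX.X_le s k hk1) (hvM s k hk1)
    have h3 : gauge p w s k ≤ δ := gauge_le_of_le_cube hp0 hp3.le hδ0 hδ1 (hw.nonneg s k hk1)
      ((hw.mono le_rfl hk1 hk2).trans hδw)
    have h4 : L * (η + Q) * (1 + M) * gauge p w s k ≤ (η + Q) * (1 / 2) := by
      calc L * (η + Q) * (1 + M) * gauge p w s k = (η + Q) * (L * (1 + M) * gauge p w s k) := by
            ring
        _ ≤ (η + Q) * (L * (1 + M) * δ) := by gcongr
        _ ≤ (η + Q) * (1 / 2) := by gcongr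
    have h5 : Q ≤ ‖(S.Y k - S₁.Y k) - (S.Y s - S₁.Y s)‖ + ‖S.Y s - S₁.Y s‖ := by
      have := norm_add_le ((S.Y k - S₁.Y k) - (S.Y s - S₁.Y s)) (S.Y s - S₁.Y s)
      rwa [sub_add_cancel] at this
    have h6 : η + Q ≤ (2 * D + 2) * η := by linarith
    exact ⟨fun i hi hi' => (hkmax i (Finset.mem_Icc.2 ⟨hi, hi'⟩)).trans (by linarith),
      hsmall s t (by linarith) hst hδw
        (fun i hi hi' => (hkmax i (Finset.mem_Icc.2 ⟨hi, hi'⟩)).trans (by linarith))⟩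
  have hFη : ∀ {c : ℝ}, 0 ≤ c → 0 ≤ F₁ c * η ∧ 0 ≤ F₂ c * η ∧ 0 ≤ c * η ∧
      L * ((2 * c + 2) * η) ≤ F₁ c * η ∧ (2 * c + 2) * η ≤ F₁ c * η := fun {c} hc => by
    have h1 := hF₁0 c hc
    have h2 := hF₂0 c hc
    have h3 : 0 ≤ (2 * c + 2) * η := by positivity
    have h4 : 0 ≤ L * ((2 * c + 2) * η) := by positivity
    refine ⟨by positivity, by positivity, by positivity, ?_, ?_⟩ <;>
    · simp only [hF₁]; linarith
  have hconcat : ∀ {c c₁ : ℝ} {m b : ℕ}, 0 ≤ c → c₁ ≤ F₁ c + F₂ c → 0 ≤ c₁ →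
      S.CtrlSubOn S₁ J (c * η) (gauge p w) X 0 m →
      S.CtrlSubOn S₁ J (c₁ * η) (gauge p w) X m b →
      S.CtrlSubOn S₁ J (F c * η) (gauge p w) X 0 b := by
    intro c c₁ m b hc hc₁ hc₁0 h h₁ i j hi hij hj
    have := h.concat hw hp0 hX h₁ (by positivity) (by positivity) i j hi hij hj
    refine this.mono (hw.gauge_nonneg hij) ?_
    simp only [hF]
    have : c₁ * η ≤ (F₁ c + F₂ c) * η := by gcongr
    linarith
  have hgood := hw.chain (δ := δ ^ 3) (by positivity)
    (Good := fun c b => 0 ≤ c ∧ (∀ i, i ≤ b → ‖S.Y i - S₁.Y i‖ ≤ c * η) ∧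
      S.CtrlSubOn S₁ J (c * η) (gauge p w) X 0 b) (F := F) (C₀ := 1 + L)
    ⟨by positivity, fun i hi => by
        obtain rfl : i = 0 := by omega
        have : 0 ≤ L * η := by positivity
        linarith,
      fun i j hi hij hj => by
        obtain rfl : j = 0 := by omega
        obtain rfl : i = 0 := by omega
        exact ((hone le_rfl 0 0 le_rfl (by omega) hY0).2 hY0).mono (hw.gauge_nonneg le_rfl)
          (by linarith)⟩
    (fun c m h => by
      obtain ⟨hc, hc1, hc2⟩ := h
      obtain ⟨g1, g2, g3, -, -⟩ := hFη hc
      -- Across a single step smallness is unavailable: the increment bound first carries the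
      -- estimate to `m + 1`, and with the enlarged `H` the full control on the step follows.
      have e1 := (hone (H := (c + 1) * η) (by linarith) m (m + 1) (by omega) le_rfl
        ((hc1 m le_rfl).trans (by linarith))).1
      have e2 : ‖S.Y (m + 1) - S₁.Y (m + 1)‖ ≤ ((c + 1) + L * (c + 1) * M) * η := by
        have h5 := norm_add_le ((S.Y (m + 1) - S₁.Y (m + 1)) - (S.Y m - S₁.Y m))
          (S.Y m - S₁.Y m)
        rw [sub_add_cancel] at h5
        have h6 : L * ((c + 1) * η) * gauge p w m (m + 1) ≤ L * ((c + 1) * η) * M := by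
          gcongr
          exact hvM _ _ (by omega)
        have := hc1 m le_rfl
        linarith
      have e0 : 0 ≤ L * (c + 1) * M * η := by positivity
      have e0' : 0 ≤ L * (((c + 1) + L * (c + 1) * M) * η) := by positivity
      have e3 : S.CtrlSubOn S₁ J (F₂ c * η) (gauge p w) X m (m + 1) := by
        intro i j hi hij hj
        have e4 : ∀ l, m ≤ l → l ≤ m + 1 →
            ‖S.Y l - S₁.Y l‖ ≤ ((c + 1) + L * (c + 1) * M) * η := by
          intro l hl hl'
          rcases Nat.lt_or_ge m l with h | h
          · obtain rfl : l = m + 1 := by omega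
            exact e2
          · obtain rfl : l = m := by omega
            exact (hc1 l le_rfl).trans (by linarith)
        have := (hone (H := ((c + 1) + L * (c + 1) * M) * η) (by linarith) i j hij (by omega)
          (e4 i hi (hij.trans hj))).2 (e4 j (hi.trans hij) hj)
        refine this.mono (hw.gauge_nonneg hij) ?_
        simp only [hF₂]
        linarith
      refine ⟨hF0 c hc, fun i hi => ?_, hconcat hc (by linarith [hF₁0 c hc]) (hF₂0 c hc) hc2 e3⟩
      have e5 : ((c + 1) + L * (c + 1) * M) * η ≤ F₂ c * η := by simp only [hF₂]; linarith
      have e6 : F c * η = 2 * (c * η) + (F₁ c * η + F₂ c * η) := by simp only [hF]; ring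
      rcases Nat.lt_or_ge m i with h | h
      · obtain rfl : i = m + 1 := by omega
        linarith
      · linarith [hc1 i h])
    (fun c m b hmb hwm h => by
      obtain ⟨hc, hc1, hc2⟩ := h
      obtain ⟨g1, g2, g3, g4, g5⟩ := hFη hc
      obtain ⟨b1, b2⟩ := hblock m b hc hmb hwm (hc1 m le_rfl)
      refine ⟨hF0 c hc, fun i hi => ?_, hconcat hc (by linarith [hF₂0 c hc]) (hF₁0 c hc) hc2
        (fun i j hi hij hj => (b2 i j hi hij hj).mono (hw.gauge_nonneg hij) g4)⟩
      have e6 : F c * η = 2 * (c * η) + (F₁ c * η + F₂ c * η) := by simp only [hF]; ring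
      rcases le_total i m with h | h
      · linarith [hc1 i h]
      · linarith [b1 i h hi]) n j (by
      refine (hwM 0 j (Nat.zero_le _)).trans ?_
      rw [← div_le_iff₀ (by positivity)]
      exact Nat.le_ceil _)
  exact ⟨hgood.2.1 j le_rfl, hgood.2.2 i j (Nat.zero_le _) hij le_rfl⟩

end RDE

end Stability

end CadlagRough

namespace CadlagRough

/-! ### Partitions and their concatenation. -/

section Partition

variable {s t r : ℝ} {n m : ℕ} {u v : ℕ → ℝ}

namespace IsPartition

theorem mono (h : IsPartition s t n u) {i j : ℕ} (hij : i ≤ j) (hj : j ≤ n) : u i ≤ u j := by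
  induction j, hij using Nat.le_induction with
  | base => exact le_rfl
  | succ j hij ih => exact (ih (by omega)).trans (h.lt_succ j (by omega)).le

theorem mem (h : IsPartition s t n u) {i : ℕ} (hi : i ≤ n) : u i ∈ Icc s t :=
  ⟨h.left ▸ h.mono (Nat.zero_le i) hi, h.right ▸ h.mono hi le_rfl⟩

theorem refl (s : ℝ) : IsPartition s s 0 (fun _ => s) := ⟨rfl, rfl, by simp⟩

theorem singleton (h : s < t) : IsPartition s t 1 (fun i => if i = 0 then s else t) :=
  ⟨by simp, by simp, fun i hi => by obtain rfl : i = 0 := by omega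
                                    simpa using h⟩

end IsPartition

/-- The concatenation of two sequences at the index `n`. -/
def concatSeq (n : ℕ) (u v : ℕ → ℝ) (i : ℕ) : ℝ := if i ≤ n then u i else v (i - n)

theorem concatSeq_left {i : ℕ} (hi : i ≤ n) : concatSeq n u v i = u i := if_pos hi

theorem concatSeq_right (h : u n = v 0) (i : ℕ) : concatSeq n u v (n + i) = v i := by
  rcases Nat.eq_zero_or_pos i with rfl | hi
  · rw [add_zero, concatSeq_left le_rfl, h]
  · rw [concatSeq, if_neg (by omega), Nat.add_sub_cancel_left]

theorem IsPartition.concat (h : IsPartition s r n u) (h' : IsPartition r t m v) :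
    IsPartition s t (n + m) (concatSeq n u v) := by
  have e : u n = v 0 := by rw [h.right, h'.left]
  refine ⟨by rw [concatSeq_left (Nat.zero_le n), h.left], by rw [concatSeq_right e, h'.right],
    fun i hi => ?_⟩
  rcases Nat.lt_or_ge i n with hin | hin
  · rw [concatSeq_left hin.le, concatSeq_left hin]; exact h.lt_succ i hin
  · obtain ⟨k, rfl⟩ := Nat.exists_eq_add_of_le hin
    rw [concatSeq_right e, add_assoc, concatSeq_right e]
    exact h'.lt_succ k (by omega)

theorem sum_concatSeq {M : Type*} [AddCommMonoid M] (F : ℝ → ℝ → M) (h : u n = v 0) :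
    ∑ i ∈ Finset.range (n + m), F (concatSeq n u v i) (concatSeq n u v (i + 1)) =
      ∑ i ∈ Finset.range n, F (u i) (u (i + 1)) + ∑ i ∈ Finset.range m, F (v i) (v (i + 1)) := by
  rw [Finset.sum_range_add]
  congr 1
  · refine Finset.sum_congr rfl fun i hi => ?_
    have := Finset.mem_range.1 hi
    rw [concatSeq_left this.le, concatSeq_left this]
  · refine Finset.sum_congr rfl fun i _ => ?_
    rw [concatSeq_right h, add_assoc, concatSeq_right h]

theorem mesh_concatSeq {δ : ℝ} (h : u n = v 0) (hu : ∀ i < n, u (i + 1) - u i < δ)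
    (hv : ∀ i < m, v (i + 1) - v i < δ) :
    ∀ i < n + m, concatSeq n u v (i + 1) - concatSeq n u v i < δ := by
  intro i hi
  rcases Nat.lt_or_ge i n with hin | hin
  · rw [concatSeq_left hin.le, concatSeq_left hin]; exact hu i hin
  · obtain ⟨k, rfl⟩ := Nat.exists_eq_add_of_le hin
    rw [concatSeq_right h, add_assoc, concatSeq_right h]
    exact hv k (by omega)

theorem exists_partition (hst : s ≤ t) {δ : ℝ} (hδ : 0 < δ) :
    ∃ n u, IsPartition s t n u ∧ ∀ i < n, u (i + 1) - u i < δ := by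
  rcases hst.eq_or_lt with rfl | hlt
  · exact ⟨0, _, IsPartition.refl s, by simp⟩
  set n := ⌈(t - s) / δ⌉₊ + 1 with hn
  have hn0 : (0 : ℝ) < n := by positivity
  have h1 : (t - s) / δ < n := by
    rw [hn]; push_cast
    linarith [Nat.le_ceil ((t - s) / δ)]
  have hd : (t - s) / n < δ := by
    rw [div_lt_iff₀ hn0]; rw [div_lt_iff₀ hδ] at h1; linarith
  have hd0 : 0 < (t - s) / n := div_pos (by linarith) hn0
  refine ⟨n, fun i => s + i * ((t - s) / n), ⟨by simp, ?_, fun i _ => ?_⟩, fun i _ => ?_⟩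
  · rw [mul_div_cancel₀ _ hn0.ne']; ring
  · push_cast; linarith
  · push_cast; linarith

end Partition

/-! ### Controls on a real interval. -/

/-- `w` is a control on `[0, T]`: nonnegative, superadditive, and vanishing at the diagonal from
the right. -/
structure IsControl (T : ℝ) (w : ℝ → ℝ → ℝ) : Prop where
  nonneg : ∀ s t, 0 ≤ s → s ≤ t → t ≤ T → 0 ≤ w s t
  add_le : ∀ s r t, 0 ≤ s → s ≤ r → r ≤ t → t ≤ T → w s r + w r t ≤ w s t
  right : ∀ s, 0 ≤ s → s < T → ∀ ε > 0, ∃ r, s < r ∧ r ≤ T ∧ w s r ≤ ε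

namespace IsControl

variable {T : ℝ} {w w₁ : ℝ → ℝ → ℝ}

theorem self (hw : IsControl T w) {s : ℝ} (h0 : 0 ≤ s) (hT : s ≤ T) : w s s = 0 := by
  have := hw.add_le s s s h0 le_rfl le_rfl hT
  have := hw.nonneg s s h0 le_rfl hT
  linarith

theorem mono (hw : IsControl T w) {a s t b : ℝ} (h0 : 0 ≤ a) (h1 : a ≤ s) (h2 : s ≤ t)
    (h3 : t ≤ b) (hT : b ≤ T) : w s t ≤ w a b := by
  have := hw.add_le a s b h0 h1 (h2.trans h3) hT
  have := hw.add_le s t b (h0.trans h1) h2 h3 hT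
  have := hw.nonneg a s h0 h1 (h2.trans (h3.trans hT))
  have := hw.nonneg t b (h0.trans (h1.trans h2)) h3 hT
  linarith

theorem add (hw : IsControl T w) (hw₁ : IsControl T w₁) :
    IsControl T (fun s t => w s t + w₁ s t) where
  nonneg s t h0 h1 h2 := add_nonneg (hw.nonneg s t h0 h1 h2) (hw₁.nonneg s t h0 h1 h2)
  add_le s r t h0 h1 h2 h3 := by
    linarith [hw.add_le s r t h0 h1 h2 h3, hw₁.add_le s r t h0 h1 h2 h3]
  right s h0 hT ε hε := by
    obtain ⟨r, h1, h2, h3⟩ := hw.right s h0 hT (ε / 2) (half_pos hε)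
    obtain ⟨r₁, g1, g2, g3⟩ := hw₁.right s h0 hT (ε / 2) (half_pos hε)
    refine ⟨min r r₁, lt_min h1 g1, (min_le_left _ _).trans h2, ?_⟩
    have := hw.mono h0 le_rfl (lt_min h1 g1).le (min_le_left r r₁) h2
    have := hw₁.mono h0 le_rfl (lt_min h1 g1).le (min_le_right r r₁) g2
    linarith

theorem div_const (hw : IsControl T w) {c : ℝ} (hc : 0 < c) :
    IsControl T (fun s t => w s t / c) where
  nonneg s t h0 h1 h2 := div_nonneg (hw.nonneg s t h0 h1 h2) hc.le
  add_le s r t h0 h1 h2 h3 := by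
    rw [← add_div]
    have := hw.add_le s r t h0 h1 h2 h3
    gcongr
  right s h0 hT ε hε := by
    obtain ⟨r, h1, h2, h3⟩ := hw.right s h0 hT (ε * c) (by positivity)
    exact ⟨r, h1, h2, by rwa [div_le_iff₀ hc]⟩

/-- `b ↦ w 0 b` is monotone and bounded on `[0, t)`, so its oscillation is small near its left limit
at `t`, and `w a b ≤ w 0 b - w 0 a` by superadditivity. The point `t`, where a jump may sit, stays
excluded. -/
theorem left (hw : IsControl T w) {t : ℝ} (h0 : 0 < t) (hT : t ≤ T) {ε : ℝ} (hε : 0 < ε) :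
    ∃ r, 0 ≤ r ∧ r < t ∧ ∀ a b, r ≤ a → a ≤ b → b < t → w a b ≤ ε := by
  set B := (fun b => w 0 b) '' Ico 0 t with hB
  have hne : B.Nonempty := ⟨w 0 0, 0, ⟨le_rfl, h0⟩, rfl⟩
  have hbdd : BddAbove B := by
    refine ⟨w 0 T, ?_⟩
    rintro _ ⟨b, hb, rfl⟩
    exact hw.mono le_rfl le_rfl hb.1 (hb.2.le.trans hT) le_rfl
  obtain ⟨_, ⟨r, hr, rfl⟩, hr'⟩ := exists_lt_of_lt_csSup hne (sub_lt_self (sSup B) hε)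
  refine ⟨r, hr.1, hr.2, fun a b ha hab hb => ?_⟩
  have h1 := hw.add_le 0 a b le_rfl (hr.1.trans ha) hab (hb.le.trans hT)
  have h2 := le_csSup hbdd ⟨b, ⟨hr.1.trans (ha.trans hab), hb⟩, rfl⟩
  have h3 := hw.mono le_rfl le_rfl hr.1 ha (hab.trans (hb.le.trans hT))
  simp only at h2 hr'
  linarith

/-- This replaces the continuity of `w`. Near a time `τ`, either `m < τ` and `[s, m]` lies strictly
left of `τ`, or `[m, t]` lies to the right of it; `w` is small on each kind of interval. A Lebesgue
number makes this uniform in `τ`. -/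
theorem mesh (hw : IsControl T w) {ε : ℝ} (hε : 0 < ε) : ∃ δ > 0, ∀ s m t, 0 ≤ s → s ≤ m →
    m ≤ t → t ≤ T → t - s < δ → min (w s m) (w m t) ≤ ε := by
  have key : ∀ τ ∈ Icc 0 T, ∃ ρ > 0, ∀ s m t, 0 ≤ s → s ≤ m → m ≤ t → t ≤ T →
      |s - τ| < ρ → |t - τ| < ρ → min (w s m) (w m t) ≤ ε := by
    intro τ hτ
    have hl : ∃ ρ > 0, ∀ a b, 0 ≤ a → τ - ρ ≤ a → a ≤ b → b < τ → w a b ≤ ε := by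
      rcases hτ.1.eq_or_lt with h | h
      · exact ⟨1, one_pos, fun a b ha _ hab hb => by linarith⟩
      · obtain ⟨r, -, h2, h3⟩ := hw.left h hτ.2 hε
        exact ⟨τ - r, by linarith, fun a b _ ha hab hb => h3 a b (by linarith) hab hb⟩
    have hr : ∃ ρ > 0, ∀ a b, τ ≤ a → a ≤ b → b ≤ T → b ≤ τ + ρ → w a b ≤ ε := by
      rcases hτ.2.eq_or_lt with h | h
      · refine ⟨1, one_pos, fun a b ha hab hb _ => ?_⟩
        obtain rfl : a = τ := by linarith
        obtain rfl : b = a := by linarith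
        rw [hw.self hτ.1 hb]
        exact hε.le
      · obtain ⟨r, h1, h2, h3⟩ := hw.right τ hτ.1 h ε hε
        exact ⟨r - τ, by linarith, fun a b ha hab _ hb =>
          (hw.mono hτ.1 ha hab (by linarith) h2).trans h3⟩
    obtain ⟨ρ, hρ, hl⟩ := hl
    obtain ⟨ρ', hρ', hr⟩ := hr
    refine ⟨min ρ ρ', lt_min hρ hρ', fun s m t h0 hsm hmt hT hs ht => ?_⟩
    have h1 := (abs_lt.1 (hs.trans_le (min_le_left _ _))).1
    have h2 := (abs_lt.1 (ht.trans_le (min_le_right _ _))).2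
    rcases lt_or_ge m τ with hm | hm
    · exact (min_le_left _ _).trans (hl s m h0 (by linarith) hsm hm)
    · exact (min_le_right _ _).trans (hr m t hm hmt hT (by linarith))
  choose! ρ hρ hρ' using key
  obtain ⟨δ, hδ, hL⟩ := lebesgue_number_lemma_of_metric (isCompact_Icc (a := (0 : ℝ)) (b := T))
    (c := fun τ : Icc (0 : ℝ) T => Metric.ball τ.1 (ρ τ.1)) (fun _ => Metric.isOpen_ball)
    (fun τ hτ => mem_iUnion.2 ⟨⟨τ, hτ⟩, Metric.mem_ball_self (hρ τ hτ)⟩)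
  refine ⟨δ, hδ, fun s m t h0 hsm hmt hT hst => ?_⟩
  obtain ⟨τ, hτ⟩ := hL s ⟨h0, (hsm.trans hmt).trans hT⟩
  refine hρ' τ.1 τ.2 s m t h0 hsm hmt hT ?_ ?_
  · simpa [Real.dist_eq] using hτ (Metric.mem_ball_self hδ)
  · have : t ∈ Metric.ball s δ := by
      rw [Metric.mem_ball, Real.dist_eq, abs_of_nonneg (by linarith)]; exact hst
    simpa [Real.dist_eq] using hτ this

theorem sum_le (hw : IsControl T w) {u : ℕ → ℝ} {n : ℕ} (hu : ∀ i < n, u i ≤ u (i + 1))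
    (h0 : 0 ≤ u 0) (hT : u n ≤ T) :
    ∑ i ∈ Finset.range n, w (u i) (u (i + 1)) ≤ w (u 0) (u n) := by
  have hmono : ∀ i ≤ n, u 0 ≤ u i := by
    intro i hi
    induction i with
    | zero => exact le_rfl
    | succ i ih => exact (ih (by omega)).trans (hu i (by omega))
  induction n with
  | zero => simp [hw.self h0 hT]
  | succ n ih =>
    rw [Finset.sum_range_succ]
    have h1 := hu n (by omega)
    have := ih (fun i hi => hu i (by omega)) (h1.trans hT) (fun i hi => hmono i (by omega))
    linarith [hw.add_le (u 0) (u n) (u (n + 1)) h0 (hmono n (by omega)) h1 hT]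

end IsControl

/-! ### Finite variation and controls. -/

section Variation

variable {E : Type*} [NormedAddCommGroup E]

/-- The supremum of the sums `∑ |A_{u,v}|^q` over the partitions of `[s, t]`. -/
noncomputable def varSum (q : ℝ) (A : ℝ → ℝ → E) (s t : ℝ) : ℝ≥0∞ :=
  ⨆ (x : ℕ × (ℕ → ℝ)) (_ : IsPartition s t x.1 x.2),
    ∑ i ∈ Finset.range x.1, ‖A (x.2 i) (x.2 (i + 1))‖ₑ ^ q

variable {q T : ℝ} {A : ℝ → ℝ → E}

theorem eVar_eq (s t : ℝ) : eVar q A s t = varSum q A s t ^ (1 / q) := by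
  rw [eVar, varSum, iSup_prod]

theorem le_varSum {s t : ℝ} {n : ℕ} {u : ℕ → ℝ} (h : IsPartition s t n u) :
    ∑ i ∈ Finset.range n, ‖A (u i) (u (i + 1))‖ₑ ^ q ≤ varSum q A s t :=
  le_iSup₂ (f := fun (x : ℕ × (ℕ → ℝ)) (_ : IsPartition s t x.1 x.2) =>
    ∑ i ∈ Finset.range x.1, ‖A (x.2 i) (x.2 (i + 1))‖ₑ ^ q) (n, u) h

theorem varSum_add_le {s r t : ℝ} (hsr : s ≤ r) (hrt : r ≤ t) :
    varSum q A s r + varSum q A r t ≤ varSum q A s t := by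
  refine ENNReal.biSup_add_biSup_le' ?_ ?_ ?_
  · obtain ⟨n, u, h, -⟩ := exists_partition hsr one_pos
    exact ⟨(n, u), h⟩
  · obtain ⟨n, u, h, -⟩ := exists_partition hrt one_pos
    exact ⟨(n, u), h⟩
  · rintro ⟨n, u⟩ hu ⟨m, v⟩ hv
    simp only at hu hv
    have e : u n = v 0 := by rw [hu.right, hv.left]
    refine le_trans (le_of_eq ?_) (le_varSum (hu.concat hv))
    exact (sum_concatSeq (fun a b => ‖A a b‖ₑ ^ q) e).symm

theorem varSum_ne_top (hq : 0 < q) (hA : eVar q A 0 T < ∞) {s t : ℝ} (h0 : 0 ≤ s) (h1 : s ≤ t)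
    (h2 : t ≤ T) : varSum q A s t ≠ ∞ := by
  have h : varSum q A 0 T ≠ ∞ := by
    intro h
    rw [eVar_eq, h, ENNReal.top_rpow_of_pos (by positivity)] at hA
    exact lt_irrefl _ hA
  refine ne_top_of_le_ne_top h ?_
  calc varSum q A s t ≤ varSum q A s T := le_self_add.trans (varSum_add_le h1 h2)
    _ ≤ varSum q A 0 T := le_add_self.trans (varSum_add_le h0 (h1.trans h2))

/-- For smallness to the right of `s`, let `r > s` be such that the variation over `[r, T]` nearly
attains its supremum over starting points in `(s, T]`. Then the variation over `[a, r]` is small for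
all `a` in `(s, r]`. A partition of `[s, r]` is a limit of partitions of `[a, r]` as `a` decreases
to `s`, because `A` is right-continuous in its first variable. -/
theorem isControl_varSum (hq : 0 < q) (hA : eVar q A 0 T < ∞)
    (hc : ∀ t ∈ Icc 0 T, ∀ s ∈ Ico 0 t, ContinuousWithinAt (fun s => A s t) (Ici s) s) :
    IsControl T (fun s t => (varSum q A s t).toReal) := by
  have hadd : ∀ s r t, 0 ≤ s → s ≤ r → r ≤ t → t ≤ T →
      (varSum q A s r).toReal + (varSum q A r t).toReal ≤ (varSum q A s t).toReal := by
    intro s r t h0 h1 h2 h3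
    rw [← ENNReal.toReal_add (varSum_ne_top hq hA h0 h1 (h2.trans h3))
      (varSum_ne_top hq hA (h0.trans h1) h2 h3)]
    exact ENNReal.toReal_mono (varSum_ne_top hq hA h0 (h1.trans h2) h3) (varSum_add_le h1 h2)
  refine ⟨fun _ _ _ _ _ => ENNReal.toReal_nonneg, hadd, fun s h0 hsT ε hε => ?_⟩
  set B := (fun b => (varSum q A b T).toReal) '' Ioc s T with hB
  have hne : B.Nonempty := ⟨_, T, ⟨hsT, le_rfl⟩, rfl⟩
  have hbdd : BddAbove B := by
    refine ⟨(varSum q A 0 T).toReal, ?_⟩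
    rintro _ ⟨b, hb, rfl⟩
    have := hadd 0 b T le_rfl (h0.trans hb.1.le) hb.2 le_rfl
    have h := ENNReal.toReal_nonneg (a := varSum q A 0 b)
    simp only
    linarith
  obtain ⟨_, ⟨r, hr, rfl⟩, hr'⟩ := exists_lt_of_lt_csSup hne (sub_lt_self (sSup B) hε)
  refine ⟨r, hr.1, hr.2, ?_⟩
  refine ENNReal.toReal_le_of_le_ofReal hε.le (iSup₂_le ?_)
  rintro ⟨n, u⟩ hu
  obtain ⟨k, rfl⟩ : ∃ k, n = k + 1 := by
    rcases n with _ | k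
    · have : s = r := by rw [← hu.left, ← hu.right]
      exact absurd hr.1 (by rw [this]; exact lt_irrefl _)
    · exact ⟨k, rfl⟩
  simp only at hu ⊢
  rw [Finset.sum_range_succ', hu.left]
  have hu1 : s < u 1 := by have := hu.lt_succ 0 (by omega); rwa [hu.left] at this
  have hu1r : u 1 ≤ r := (hu.mem (by omega)).2
  have hbound : ∀ᶠ a in 𝓝[>] s, ∑ i ∈ Finset.range k, ‖A (u (i + 1)) (u (i + 1 + 1))‖ₑ ^ q +
      ‖A a (u 1)‖ₑ ^ q ≤ ENNReal.ofReal ε := by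
    filter_upwards [Ioo_mem_nhdsGT hu1] with a ha
    have hpart : IsPartition a r (k + 1) (fun i => if i = 0 then a else u i) := by
      refine ⟨by simp, by simpa using hu.right, fun i hi => ?_⟩
      rcases Nat.eq_zero_or_pos i with rfl | hi'
      · simpa using ha.2
      · simp only [hi'.ne', if_false, Nat.succ_ne_zero]
        exact hu.lt_succ i hi
    have h1 := le_varSum (A := A) (q := q) hpart
    rw [Finset.sum_range_succ'] at h1
    simp only [Nat.succ_ne_zero, if_false, if_true] at h1
    refine h1.trans ?_
    have har : a ≤ r := ha.2.le.trans hu1r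
    have ha0 : 0 ≤ a := h0.trans ha.1.le
    rw [← ENNReal.ofReal_toReal (varSum_ne_top hq hA ha0 har hr.2)]
    refine ENNReal.ofReal_le_ofReal ?_
    have h2 := hadd a r T ha0 har hr.2 le_rfl
    have h3 := le_csSup hbdd ⟨a, ⟨ha.1, har.trans hr.2⟩, rfl⟩
    simp only at h3 hr'
    linarith
  have hlim : Tendsto (fun a => ∑ i ∈ Finset.range k, ‖A (u (i + 1)) (u (i + 1 + 1))‖ₑ ^ q +
      ‖A a (u 1)‖ₑ ^ q) (𝓝[>] s) (𝓝 (∑ i ∈ Finset.range k,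
        ‖A (u (i + 1)) (u (i + 1 + 1))‖ₑ ^ q + ‖A s (u 1)‖ₑ ^ q)) := by
    have h1 : Tendsto (fun a => A a (u 1)) (𝓝[>] s) (𝓝 (A s (u 1))) :=
      (hc (u 1) ⟨h0.trans hu1.le, hu1r.trans hr.2⟩ s ⟨h0, hu1⟩).mono_left
        (nhdsWithin_mono s Ioi_subset_Ici_self)
    exact tendsto_const_nhds.add ((ENNReal.continuous_rpow_const.tendsto _).comp h1.enorm)
  exact le_of_tendsto hlim hbound

theorem pVar_rpow (hq : 0 < q) (s t : ℝ) : pVar q A s t ^ q = (varSum q A s t).toReal := by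
  rw [pVar, eVar_eq, ENNReal.toReal_rpow, ← ENNReal.rpow_mul, one_div_mul_cancel hq.ne',
    ENNReal.rpow_one]

theorem pVar_nonneg (s t : ℝ) : 0 ≤ pVar q A s t := ENNReal.toReal_nonneg

/-- A two-parameter function of finite variation is dominated by a control. -/
theorem exists_isControl (hq1 : 1 ≤ q) (hq3 : q ≤ 3) (hA : eVar q A 0 T < ∞)
    (hc : ∀ t ∈ Icc 0 T, ∀ s ∈ Ico 0 t, ContinuousWithinAt (fun s => A s t) (Ici s) s)
    (hdiag : ∀ t ∈ Icc 0 T, A t t = 0) {c η : ℝ} (hc0 : 0 ≤ c) (hη : 0 < η)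
    (hle : pVar q A 0 T ≤ c * η) :
    ∃ w, IsControl T w ∧ w 0 T ≤ (1 + c) ^ 3 ∧
      ∀ s t, 0 ≤ s → s ≤ t → t ≤ T → ‖A s t‖ ≤ η * w s t ^ (1 / q) := by
  have hq : 0 < q := by linarith
  have hηq : 0 < η ^ q := Real.rpow_pos_of_pos hη q
  -- Dividing by `η ^ q` moves the size of `A` out of the control. Small differences of data are
  -- thus dominated by a control of bounded size, times `η`. The exponent `3` replaces `q ≤ 3`, as
  -- `1 + c ≥ 1`.
  refine ⟨fun s t => (varSum q A s t).toReal / η ^ q, (isControl_varSum hq hA hc).div_const hηq,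
    ?_, fun s t h0 h1 h2 => ?_⟩
  · simp only
    rw [← pVar_rpow hq, ← Real.div_rpow (pVar_nonneg _ _) hη.le]
    have h1 : pVar q A 0 T / η ≤ 1 + c := by
      rw [div_le_iff₀ hη]; linarith
    calc (pVar q A 0 T / η) ^ q ≤ (1 + c) ^ q :=
          Real.rpow_le_rpow (div_nonneg (pVar_nonneg _ _) hη.le) h1 hq.le
      _ ≤ (1 + c) ^ (3 : ℝ) := Real.rpow_le_rpow_of_exponent_le (by linarith) hq3
      _ = (1 + c) ^ 3 := by norm_cast
  · have hv := varSum_ne_top hq hA h0 h1 h2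
    have h3 : ‖A s t‖ ^ q ≤ (varSum q A s t).toReal := by
      rcases h1.eq_or_lt with rfl | hlt
      · rw [hdiag s ⟨h0, h2⟩, norm_zero, Real.zero_rpow hq.ne']
        exact ENNReal.toReal_nonneg
      · have := le_varSum (A := A) (q := q) (IsPartition.singleton hlt)
        simp only [Finset.range_one, Finset.sum_singleton, if_true, zero_add, one_ne_zero,
          if_false] at this
        have := ENNReal.toReal_mono hv this
        rwa [← ENNReal.toReal_rpow, toReal_enorm] at this
    simp only
    rw [Real.div_rpow ENNReal.toReal_nonneg hηq.le, ← Real.rpow_mul hη.le,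
      mul_one_div_cancel hq.ne', Real.rpow_one, mul_div_cancel₀ _ hη.ne']
    have h4 := Real.rpow_le_rpow (by positivity) h3 (by positivity : 0 ≤ 1 / q)
    rwa [← Real.rpow_mul (norm_nonneg _), mul_one_div_cancel hq.ne', Real.rpow_one] at h4

/-- A two-parameter function dominated by a control has finite variation. -/
theorem eVar_le_of_isControl (hq : 0 < q) {w : ℝ → ℝ → ℝ} (hw : IsControl T w) (hT : 0 ≤ T)
    {L : ℝ} (hL : 0 ≤ L)
    (h : ∀ s t, 0 ≤ s → s ≤ t → t ≤ T → ‖A s t‖ ≤ L * w s t ^ (1 / q)) :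
    eVar q A 0 T ≤ ENNReal.ofReal (L * w 0 T ^ (1 / q)) := by
  have hLq : 0 ≤ L ^ q := Real.rpow_nonneg hL q
  have hw0 := hw.nonneg 0 T le_rfl hT le_rfl
  have h1 : varSum q A 0 T ≤ ENNReal.ofReal (L ^ q * w 0 T) := by
    refine iSup₂_le ?_
    rintro ⟨n, u⟩ hu
    simp only at hu ⊢
    have hmem : ∀ i ≤ n, u i ∈ Icc 0 T := fun i hi => hu.mem hi
    have h2 : ∀ i ∈ Finset.range n, ‖A (u i) (u (i + 1))‖ₑ ^ q ≤
        ENNReal.ofReal (L ^ q * w (u i) (u (i + 1))) := by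
      intro i hi
      have hi := Finset.mem_range.1 hi
      have hle := (hu.lt_succ i hi).le
      have h3 := h _ _ (hmem i hi.le).1 hle (hmem (i + 1) hi).2
      have hwi := hw.nonneg _ _ (hmem i hi.le).1 hle (hmem (i + 1) hi).2
      rw [← ofReal_norm, ENNReal.ofReal_rpow_of_nonneg (norm_nonneg _) hq.le]
      refine ENNReal.ofReal_le_ofReal ?_
      refine (Real.rpow_le_rpow (norm_nonneg _) h3 hq.le).trans_eq ?_
      rw [Real.mul_rpow hL (Real.rpow_nonneg hwi _), ← Real.rpow_mul hwi,
        one_div_mul_cancel hq.ne', Real.rpow_one]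
    refine (Finset.sum_le_sum h2).trans ?_
    rw [← ENNReal.ofReal_sum_of_nonneg (fun i hi => ?_), ← Finset.mul_sum]
    · refine ENNReal.ofReal_le_ofReal ?_
      have := hw.sum_le (u := u) (n := n) (fun i hi => (hu.lt_succ i hi).le)
        (hmem 0 (Nat.zero_le n)).1 (hmem n le_rfl).2
      rw [hu.left, hu.right] at this
      gcongr
    · have hi := Finset.mem_range.1 hi
      exact mul_nonneg hLq
        (hw.nonneg _ _ (hmem i hi.le).1 (hu.lt_succ i hi).le (hmem (i + 1) hi).2)
  rw [eVar_eq]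
  refine (ENNReal.rpow_le_rpow h1 (by positivity)).trans_eq ?_
  rw [ENNReal.ofReal_rpow_of_nonneg (by positivity) (by positivity), Real.mul_rpow hLq hw0,
    ← Real.rpow_mul hL, mul_one_div_cancel hq.ne', Real.rpow_one]

theorem pVar_le_of_isControl (hq : 0 < q) {w : ℝ → ℝ → ℝ} (hw : IsControl T w) (hT : 0 ≤ T)
    {L : ℝ} (hL : 0 ≤ L)
    (h : ∀ s t, 0 ≤ s → s ≤ t → t ≤ T → ‖A s t‖ ≤ L * w s t ^ (1 / q)) :
    pVar q A 0 T ≤ L * w 0 T ^ (1 / q) :=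
  ENNReal.toReal_le_of_le_ofReal
    (mul_nonneg hL (Real.rpow_nonneg (hw.nonneg 0 T le_rfl hT le_rfl) _))
    (eVar_le_of_isControl hq hw hT hL h)

end Variation

end CadlagRough

namespace CadlagRough

/-! ### Sewing with a small factor, and solutions in continuous time. -/

noncomputable section Continuous

set_option maxSynthPendingDepth 3

variable {ι V E U : Type*} [NormedAddCommGroup V] [NormedSpace ℝ V]
  [NormedAddCommGroup E] [NormedSpace ℝ E] [NormedAddCommGroup U] [NormedSpace ℝ U]

/-- The exponent of the sewing lemma. -/
def sewExp (p : ℝ) : ℝ := (3 / p + 1) / 2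

/-- The constant of the sewing lemma. -/
def sewConst (p : ℝ) : ℝ := 4 / (1 - (2 : ℝ) ^ (1 - sewExp p))

section Exponent

variable {p : ℝ}

theorem one_lt_sewExp (hp0 : 0 < p) (hp3 : p < 3) : 1 < sewExp p := by
  have : 1 < 3 / p := by rwa [one_lt_div hp0]
  rw [sewExp]; linarith

theorem sewConst_den (hp0 : 0 < p) (hp3 : p < 3) : 0 < 1 - (2 : ℝ) ^ (1 - sewExp p) := by
  have := Real.rpow_lt_one_of_one_lt_of_neg (by norm_num : (1 : ℝ) < 2)
    (by linarith [one_lt_sewExp hp0 hp3] : 1 - sewExp p < 0)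
  linarith

theorem sewConst_nonneg (hp0 : 0 < p) (hp3 : p < 3) : 0 ≤ sewConst p :=
  div_nonneg (by norm_num) (sewConst_den hp0 hp3).le

/-- The gauges of two adjacent intervals of which the smaller has size at most `K`. -/
theorem rpow_mul_le_of_min_le (hp2 : 2 < p) (hp3 : p < 3) {a b W K : ℝ} (ha : 0 ≤ a) (hb : 0 ≤ b)
    (haW : a ≤ W) (hbW : b ≤ W) (hK : min a b ≤ K) :
    (a ^ (1 / p)) ^ 2 * b ^ (1 / p) + a ^ (1 / p) * (b ^ (1 / p)) ^ 2 ≤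
      2 * (K ^ (sewExp p - 1) * W ^ sewExp p) := by
  have hp0 : 0 < p := by linarith
  have hθ := one_lt_sewExp hp0 hp3
  have hμ0 : 0 ≤ min a b := le_min ha hb
  have hW0 : 0 ≤ W := ha.trans haW
  have hμW : min a b ≤ W := (min_le_left a b).trans haW
  have hτ : 0 < 1 / p - (sewExp p - 1) := by
    have : 1 / p - (sewExp p - 1) = (p - 1) / (2 * p) := by rw [sewExp]; field_simp; ring
    rw [this]; apply div_pos <;> linarith
  -- `sewExp p` is the midpoint of `1` and `3 / p`, so `3 / p = (sewExp p - 1) + sewExp p`. The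
  -- first part of the exponent is spent on the smaller interval and gives the power of `K`; the
  -- second exceeds `1` and is kept for sewing.
  have h1 : min a b ^ (1 / p) ≤ K ^ (sewExp p - 1) * W ^ (1 / p - (sewExp p - 1)) := by
    have e : min a b ^ (1 / p) =
        min a b ^ (sewExp p - 1) * min a b ^ (1 / p - (sewExp p - 1)) := by
      rw [← Real.rpow_add_of_nonneg hμ0 (by linarith) hτ.le]; congr 1; ring
    rw [e]
    have e1 := Real.rpow_le_rpow hμ0 hK (by linarith : 0 ≤ sewExp p - 1)
    have e2 := Real.rpow_le_rpow hμ0 hμW hτ.le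
    exact mul_le_mul e1 e2 (Real.rpow_nonneg hμ0 _) (Real.rpow_nonneg (hμ0.trans hK) _)
  have h2 : min a b ^ (1 / p) * (W ^ (1 / p)) ^ 2 ≤ K ^ (sewExp p - 1) * W ^ sewExp p := by
    have e : W ^ sewExp p = W ^ (1 / p - (sewExp p - 1)) * (W ^ (1 / p)) ^ 2 := by
      rw [← Real.rpow_natCast, ← Real.rpow_mul hW0,
        ← Real.rpow_add_of_nonneg hW0 hτ.le (by positivity)]
      congr 1
      rw [sewExp]; push_cast; field_simp; ring
    rw [e, ← mul_assoc]
    gcongr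
  have hA : 0 ≤ a ^ (1 / p) := Real.rpow_nonneg ha _
  have hB : 0 ≤ b ^ (1 / p) := Real.rpow_nonneg hb _
  have hAW : a ^ (1 / p) ≤ W ^ (1 / p) := Real.rpow_le_rpow ha haW (by positivity)
  have hBW : b ^ (1 / p) ≤ W ^ (1 / p) := Real.rpow_le_rpow hb hbW (by positivity)
  have hW : 0 ≤ W ^ (1 / p) := Real.rpow_nonneg hW0 _
  rcases le_total a b with hab | hab
  · rw [min_eq_left hab] at h2
    have h3 : (a ^ (1 / p)) ^ 2 * b ^ (1 / p) ≤ a ^ (1 / p) * (W ^ (1 / p)) ^ 2 := by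
      calc (a ^ (1 / p)) ^ 2 * b ^ (1 / p) = a ^ (1 / p) * (a ^ (1 / p) * b ^ (1 / p)) := by ring
        _ ≤ a ^ (1 / p) * (W ^ (1 / p) * W ^ (1 / p)) := by gcongr
        _ = _ := by ring
    have h4 : a ^ (1 / p) * (b ^ (1 / p)) ^ 2 ≤ a ^ (1 / p) * (W ^ (1 / p)) ^ 2 := by gcongr
    linarith
  · rw [min_eq_right hab] at h2
    have h3 : (a ^ (1 / p)) ^ 2 * b ^ (1 / p) ≤ (W ^ (1 / p)) ^ 2 * b ^ (1 / p) := by gcongr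
    have h4 : a ^ (1 / p) * (b ^ (1 / p)) ^ 2 ≤ b ^ (1 / p) * (W ^ (1 / p)) ^ 2 := by
      calc a ^ (1 / p) * (b ^ (1 / p)) ^ 2 = b ^ (1 / p) * (a ^ (1 / p) * b ^ (1 / p)) := by ring
        _ ≤ b ^ (1 / p) * (W ^ (1 / p) * W ^ (1 / p)) := by gcongr
        _ = _ := by ring
    linarith

end Exponent

/-- The sewing estimate for controlled integrands. -/
theorem norm_defect_germ_le {p : ℝ} (hp2 : 2 < p) (hp3 : p < 3) {w : ℕ → ℕ → ℝ}
    (hw : Superadd w) {X : ℕ → V} {T : ℕ → ℕ → (V →L[ℝ] V →L[ℝ] E) →L[ℝ] E}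
    (hX : Driver (gauge p w) X T) {Z : ℕ → V →L[ℝ] E} {Z' : ℕ → V →L[ℝ] V →L[ℝ] E} {c K : ℝ}
    {s t : ℕ} (hst : s ≤ t) (hc : 0 ≤ c)
    (hZ : ∀ i j, s ≤ i → i ≤ j → j ≤ t →
      Ctrl c (gauge p w i j) (X j - X i) (Z i) (Z j) (Z' i) (Z' j))
    (hK : ∀ m, s ≤ m → m ≤ t → min (w s m) (w m t) ≤ K) :
    ‖defect (germ X T Z Z') s t‖ ≤ sewConst p * c * K ^ (sewExp p - 1) * w s t ^ sewExp p := by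
  have hp0 : 0 < p := by linarith
  have hθ := one_lt_sewExp hp0 hp3
  have hden := sewConst_den hp0 hp3
  have hK0 : 0 ≤ K := (le_min (hw.nonneg s s le_rfl) (hw.nonneg s t hst)).trans
    (hK s le_rfl hst)
  have hKσ : 0 ≤ K ^ (sewExp p - 1) := Real.rpow_nonneg hK0 _
  have hΓ : 0 ≤ sewConst p * c * K ^ (sewExp p - 1) := by
    have := sewConst_nonneg hp0 hp3
    positivity
  refine norm_defect_le (Φ := fun i j => w i j ^ sewExp p) (K := 2 * c * K ^ (sewExp p - 1))
    (γ := 1 - (2 : ℝ) ^ (1 - sewExp p)) (s := s) (t := t)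
    (fun i => germ_self hX i) (fun i j h => Real.rpow_nonneg (hw.nonneg i j h) _)
    (fun i m j h1 h2 => Real.rpow_le_rpow (hw.nonneg m j h2) (hw.mono h1 h2 le_rfl)
      (by linarith))
    (fun i j h => hw.split_rpow hθ.le (by linarith) h) (by positivity) hΓ ?_ ?_ s t le_rfl hst
    le_rfl
  · rw [sewConst]
    have : (1 - (2 : ℝ) ^ (1 - sewExp p)) *
        (4 / (1 - (2 : ℝ) ^ (1 - sewExp p)) * c * K ^ (sewExp p - 1)) =
        4 * c * K ^ (sewExp p - 1) := by
      field_simp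
    rw [this]; linarith
  · intro i m j hi him hmj hj _
    -- The smaller of the two pieces of `[i, j]` is at most the smaller of the two pieces of `[s,
    -- t]` cut at the same `m`, hence at most `K`.
    have h1 := norm_germ_delta_le hX him hmj (hZ i m hi him (hmj.trans hj))
    have h2 := rpow_mul_le_of_min_le (K := K) hp2 hp3 (hw.nonneg i m him) (hw.nonneg m j hmj)
      (hw.mono le_rfl him hmj) (hw.mono him hmj le_rfl)
      ((min_le_min (hw.mono hi him le_rfl) (hw.mono le_rfl hmj hj)).trans
        (hK m (hi.trans him) (hmj.trans hj)))
    calc _ ≤ _ := h1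
      _ ≤ c * (2 * (K ^ (sewExp p - 1) * w i j ^ sewExp p)) := by gcongr; exact h2
      _ = _ := by ring

namespace RDE

/-- The equation along a sequence of times. -/
def reindex (S : RDE ι V E U) (u : ℕ → ι) : RDE ℕ V E U where
  a i := S.a (u i)
  a' i := S.a' (u i)
  y i := S.y (u i)
  y' i := S.y' (u i)
  f := S.f
  Df := S.Df
  Y i := S.Y (u i)

section Reindex

variable [Preorder ι] {S S₁ : RDE ι V E U} {J : E →L[ℝ] U} {p : ℝ} {w : ι → ι → ℝ} {X : ι → V}
  {T : ι → ι → (V →L[ℝ] V →L[ℝ] E) →L[ℝ] E} {u : ℕ → ι} {M η : ℝ}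

theorem _root_.CadlagRough.Driver.reindex (hX : Driver (gauge p w) X T) (hu : Monotone u) :
    Driver (gauge p fun i j => w (u i) (u j)) (fun i => X (u i)) (fun i j => T (u i) (u j)) where
  X_le _ _ h := hX.X_le _ _ (hu h)
  T_le _ _ h := hX.T_le _ _ (hu h)
  chen _ _ _ h1 h2 := hX.chen _ _ _ (hu h1) (hu h2)

theorem StateBound.reindex (hS : S.StateBound M (gauge p w) X) (hu : Monotone u) :
    (S.reindex u).StateBound M (gauge p fun i j => w (u i) (u j)) (fun i => X (u i)) where
  f := hS.f
  a _ _ h := hS.a _ _ (hu h)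

theorem Bound.reindex (hS : S.Bound M (gauge p w) X) (hu : Monotone u) :
    (S.reindex u).Bound M (gauge p fun i j => w (u i) (u j)) (fun i => X (u i)) where
  toStateBound := hS.toStateBound.reindex hu
  y _ _ h := hS.y _ _ (hu h)

theorem Dist.reindex (hS : S.Dist S₁ η (gauge p w) X) (hu : Monotone u) :
    (S.reindex u).Dist (S₁.reindex u) η (gauge p fun i j => w (u i) (u j))
      (fun i => X (u i)) where
  f := hS.f
  a_le _ := hS.a_le _
  a _ _ h := hS.a _ _ (hu h)
  y _ _ h := hS.y _ _ (hu h)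

end Reindex

/-- The Euler error is of smaller order than the control. -/
def Solves {T₀ : ℝ} (S : RDE (Icc (0 : ℝ) T₀) V E U) (J : E →L[ℝ] U) (X : Icc (0 : ℝ) T₀ → V)
    (T : Icc (0 : ℝ) T₀ → Icc (0 : ℝ) T₀ → (V →L[ℝ] V →L[ℝ] E) →L[ℝ] E)
    (w : ℝ → ℝ → ℝ) : Prop :=
  ∀ b > 0, ∃ δ > 0, ∀ s t : Icc (0 : ℝ) T₀, s ≤ t → (t : ℝ) - s < δ →
    ‖S.error J X T s t‖ ≤ b * w s t

variable {T₀ : ℝ} {S S₁ : RDE (Icc (0 : ℝ) T₀) V E U} {J : E →L[ℝ] U} {p : ℝ} {w : ℝ → ℝ → ℝ}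
  {X : Icc (0 : ℝ) T₀ → V} {T : Icc (0 : ℝ) T₀ → Icc (0 : ℝ) T₀ → (V →L[ℝ] V →L[ℝ] E) →L[ℝ] E}
  {M : ℝ}

/-- One factor `w s t ^ (sewExp p - 1)` is bounded by its value on the whole interval, leaving `w s
t`. By `IsControl.mesh`, `K` can be made as small as desired when `t - s` is small. -/
theorem solves_of_error_le (hw : IsControl T₀ w) (hp0 : 0 < p) (hp3 : p < 3) {C : ℝ}
    (hC : 0 ≤ C) (h : ∀ s t : Icc (0 : ℝ) T₀, s ≤ t → ∀ K,
      (∀ m : Icc (0 : ℝ) T₀, s ≤ m → m ≤ t → min (w s m) (w m t) ≤ K) →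
      ‖S.error J X T s t‖ ≤ C * K ^ (sewExp p - 1) * w s t ^ sewExp p) :
    S.Solves J X T w := by
  intro b hb
  have hθ := one_lt_sewExp hp0 hp3
  rcases lt_or_ge T₀ 0 with hT | hT
  · exact ⟨1, one_pos, fun s => absurd (s.2.1.trans s.2.2) (not_le.2 hT)⟩
  have hM0 := hw.nonneg 0 T₀ le_rfl hT le_rfl
  set D := C * w 0 T₀ ^ (sewExp p - 1) + 1 with hD
  have hD0 : 0 < D := by
    have := Real.rpow_nonneg hM0 (sewExp p - 1)
    positivity
  set K := (b / D) ^ (1 / (sewExp p - 1)) with hKdef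
  have hK0 : 0 < K := Real.rpow_pos_of_pos (div_pos hb hD0) _
  have hKσ : K ^ (sewExp p - 1) = b / D := by
    rw [hKdef, ← Real.rpow_mul (div_pos hb hD0).le, one_div_mul_cancel (by linarith),
      Real.rpow_one]
  obtain ⟨δ, hδ, hmesh⟩ := hw.mesh hK0
  refine ⟨δ, hδ, fun s t hst hlt => ?_⟩
  have h1 := h s t hst K (fun m hsm hmt => hmesh s m t s.2.1 hsm hmt t.2.2 hlt)
  have hw0 := hw.nonneg s t s.2.1 hst t.2.2
  have h2 : w s t ^ sewExp p ≤ w 0 T₀ ^ (sewExp p - 1) * w s t := by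
    have e : w s t ^ sewExp p = w s t ^ (sewExp p - 1) * w s t := by
      conv_rhs => rw [← Real.rpow_one (w s t), ← Real.rpow_mul hw0, one_mul]
      rw [← Real.rpow_add_of_nonneg hw0 (by linarith) zero_le_one]; congr 1; ring
    rw [e]
    have := Real.rpow_le_rpow hw0 (hw.mono le_rfl s.2.1 hst t.2.2 le_rfl)
      (by linarith : 0 ≤ sewExp p - 1)
    gcongr
  refine h1.trans ?_
  rw [hKσ]
  calc C * (b / D) * w s t ^ sewExp p ≤ C * (b / D) * (w 0 T₀ ^ (sewExp p - 1) * w s t) := by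
        gcongr
    _ = b * w s t * ((C * w 0 T₀ ^ (sewExp p - 1)) / D) := by ring
    _ ≤ b * w s t * 1 := by
        gcongr
        rw [div_le_one hD0]; linarith
    _ = b * w s t := mul_one _

theorem superadd_comp (hw : IsControl T₀ w) {u : ℕ → Icc (0 : ℝ) T₀} (hu : Monotone u) :
    Superadd (fun i j => w (u i) (u j)) where
  nonneg i j h := hw.nonneg _ _ (u i).2.1 (hu h) (u j).2.2
  add_le i _ j h1 h2 := hw.add_le _ _ _ (u i).2.1 (hu h1) (hu h2) (u j).2.2

/-- A partition of a subinterval as a monotone sequence in `[0, T₀]`. -/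
def _root_.CadlagRough.IsPartition.seq {s t : ℝ} {n : ℕ} {u : ℕ → ℝ} (h : IsPartition s t n u)
    (h0 : 0 ≤ s) (hT : t ≤ T₀) (i : ℕ) : Icc (0 : ℝ) T₀ :=
  ⟨u (min i n), h0.trans (h.mem (min_le_right i n)).1, (h.mem (min_le_right i n)).2.trans hT⟩

theorem _root_.CadlagRough.IsPartition.monotone_seq {s t : ℝ} {n : ℕ} {u : ℕ → ℝ}
    (h : IsPartition s t n u) (h0 : 0 ≤ s) (hT : t ≤ T₀) : Monotone (h.seq h0 hT) :=
  fun _ _ hij => h.mono (min_le_min_right n hij) (min_le_right _ n)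

theorem _root_.CadlagRough.IsPartition.coe_seq {s t : ℝ} {n : ℕ} {u : ℕ → ℝ}
    (h : IsPartition s t n u) (h0 : 0 ≤ s) (hT : t ≤ T₀) {i : ℕ} (hi : i ≤ n) :
    (h.seq h0 hT i : ℝ) = u i := by
  simp [IsPartition.seq, min_eq_left hi]

theorem _root_.CadlagRough.IsPartition.mesh_seq {s t : ℝ} {n : ℕ} {u : ℕ → ℝ}
    (h : IsPartition s t n u) (h0 : 0 ≤ s) (hT : t ≤ T₀) {δ : ℝ} (hδ : 0 < δ)
    (hu : ∀ i < n, u (i + 1) - u i < δ) (i : ℕ) :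
    (h.seq h0 hT (i + 1) : ℝ) - h.seq h0 hT i < δ := by
  simp only [IsPartition.seq]
  rcases Nat.lt_or_ge i n with hi | hi
  · rw [min_eq_left hi.le, min_eq_left hi]; exact hu i hi
  · rw [min_eq_right hi, min_eq_right (by omega)]; simpa using hδ

/-- A candidate that is a controlled path and whose increments are limits of Riemann sums has
small Euler errors. -/
theorem solves_of_riemann (hw : IsControl T₀ w) (hp2 : 2 < p) (hp3 : p < 3) (hM : 1 ≤ M)
    (hwM : w 0 T₀ ≤ M) (hJ : ‖J‖ ≤ 1)
    (hX : Driver (gauge p fun s t : Icc (0 : ℝ) T₀ => w s t) X T)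
    (hS : S.StateBound M (gauge p fun s t : Icc (0 : ℝ) T₀ => w s t) X)
    {L : ℝ} (hL : 0 ≤ L)
    (hY : ∀ s t, s ≤ t → S.CtrlY J L (gauge p fun s t : Icc (0 : ℝ) T₀ => w s t) X s t)
    (hR : ∀ s t : Icc (0 : ℝ) T₀, s ≤ t → ∀ ε > 0, ∃ (u : ℕ → Icc (0 : ℝ) T₀) (n : ℕ),
      Monotone u ∧ u 0 = s ∧ u n = t ∧
      ‖∑ i ∈ Finset.range n, germ X T (S.Z J) (S.Z' J) (u i) (u (i + 1)) -
        (S.Y t - S.Y s - (S.y t - S.y s))‖ ≤ ε) : S.Solves J X T w := by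
  have hp0 : 0 < p := by linarith
  have hc := sewConst_nonneg hp0 hp3
  set c := M * (M + L) + M * ((M + L) * (1 + M)) ^ 2 with hcdef
  have hc0 : 0 ≤ c := by positivity
  refine solves_of_error_le (p := p) (C := sewConst p * c) hw hp0 hp3 (by positivity) ?_
  intro s t hst K hK
  refine le_of_forall_pos_le_add fun ε hε => ?_
  obtain ⟨u, n, hu, hu0, hun, h⟩ := hR s t hst ε hε
  have h1 := norm_defect_germ_le (Z := fun i => S.Z J (u i)) (Z' := fun i => S.Z' J (u i))
    (c := c) (K := K) hp2 hp3 (superadd_comp hw hu) (hX.reindex hu) (Nat.zero_le n) hc0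
    (fun i j _ hij _ => (ctrl_state hJ (hS.a _ _ (hu hij)) (hY _ _ (hu hij))).comp hS.f
      (hX.X_le _ _ (hu hij)) (gauge_le (by linarith) hM
        (hw.nonneg _ _ (u i).2.1 (hu hij) (u j).2.2)
        ((hw.mono le_rfl (u i).2.1 (hu hij) (u j).2.2 le_rfl).trans hwM)))
    (fun m _ hm => by
      rw [hu0, hun]
      exact hK (u m) (hu0 ▸ hu (Nat.zero_le m)) (hun ▸ hu hm))
  rw [hu0, hun] at h1
  -- The error differs from the defect along the partition by the error of the Riemann sum, which is
  -- at most `ε`. The bound `K` runs over all intermediate times, so it does not depend on the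
  -- partition and `ε` may be sent to `0`.
  have e : S.error J X T s t = defect (germ (fun i => X (u i)) (fun i j => T (u i) (u j))
      (fun i => S.Z J (u i)) (fun i => S.Z' J (u i))) 0 n -
      (∑ i ∈ Finset.range n, germ X T (S.Z J) (S.Z' J) (u i) (u (i + 1)) -
        (S.Y t - S.Y s - (S.y t - S.y s))) := by
    simp only [error, defect, germ, Nat.Ico_zero_eq_range, hu0, hun]
    abel
  rw [e]
  exact (norm_sub_le _ _).trans (add_le_add h1 h)

/-- Solutions are limits of Riemann sums. -/
theorem Solves.riemann (h : S.Solves J X T w) (hw : IsControl T₀ w) {ε : ℝ} (hε : 0 < ε) :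
    ∃ δ > 0, ∀ (u : ℕ → Icc (0 : ℝ) T₀) (n : ℕ), Monotone u →
      (∀ i < n, (u (i + 1) : ℝ) - u i < δ) →
      ‖∑ i ∈ Finset.range n, germ X T (S.Z J) (S.Z' J) (u i) (u (i + 1)) -
        (S.Y (u n) - S.Y (u 0) - (S.y (u n) - S.y (u 0)))‖ < ε := by
  rcases lt_or_ge T₀ 0 with hT | hT
  · exact ⟨1, one_pos, fun u => absurd ((u 0).2.1.trans (u 0).2.2) (not_le.2 hT)⟩
  have hM0 := hw.nonneg 0 T₀ le_rfl hT le_rfl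
  obtain ⟨δ, hδ, h⟩ := h (ε / (w 0 T₀ + 1)) (by positivity)
  refine ⟨δ, hδ, fun u n hu hmesh => ?_⟩
  -- The increments of `Y - y` telescope, so only the one-step errors remain. Each is a small
  -- multiple of `w`, and `w` is superadditive.
  have e : ∑ i ∈ Finset.range n, germ X T (S.Z J) (S.Z' J) (u i) (u (i + 1)) -
        (S.Y (u n) - S.Y (u 0) - (S.y (u n) - S.y (u 0))) =
      -∑ i ∈ Finset.range n, S.error J X T (u i) (u (i + 1)) := by
    have e1 := Finset.sum_range_sub (fun i => S.Y (u i) - S.y (u i)) n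
    have e2 : S.Y (u n) - S.Y (u 0) - (S.y (u n) - S.y (u 0)) =
        ∑ i ∈ Finset.range n, ((S.Y (u (i + 1)) - S.y (u (i + 1))) - (S.Y (u i) - S.y (u i))) := by
      rw [e1]; abel
    rw [e2, ← Finset.sum_sub_distrib, ← Finset.sum_neg_distrib]
    refine Finset.sum_congr rfl fun i _ => ?_
    simp only [error]; abel
  rw [e, norm_neg]
  refine (norm_sum_le _ _).trans_lt ?_
  calc ∑ i ∈ Finset.range n, ‖S.error J X T (u i) (u (i + 1))‖
      ≤ ∑ i ∈ Finset.range n, ε / (w 0 T₀ + 1) * w (u i) (u (i + 1)) :=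
        Finset.sum_le_sum fun i hi => h _ _ (hu (Nat.le_succ i)) (hmesh i (Finset.mem_range.1 hi))
    _ ≤ ε / (w 0 T₀ + 1) * w 0 T₀ := by
        rw [← Finset.mul_sum]
        gcongr
        refine (hw.sum_le (u := fun i => (u i : ℝ)) (fun i _ => hu (Nat.le_succ i)) (u 0).2.1
          (u n).2.2).trans ?_
        exact hw.mono le_rfl (u 0).2.1 (hu (Nat.zero_le n)) (u n).2.2 le_rfl
    _ < ε := by
        rw [div_mul_eq_mul_div, div_lt_iff₀ (by positivity)]
        linarith

end RDE

end Continuous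

end CadlagRough

namespace CadlagRough

/-! ### Stability and existence of solutions. -/

noncomputable section Solutions

set_option maxSynthPendingDepth 3

variable {ι V E U : Type*} [NormedAddCommGroup V] [NormedSpace ℝ V]
  [NormedAddCommGroup E] [NormedSpace ℝ E] [NormedAddCommGroup U] [NormedSpace ℝ U]

theorem Superadd.sum_le {w : ℕ → ℕ → ℝ} (hw : Superadd w) {i j : ℕ} (hij : i ≤ j) :
    ∑ l ∈ Finset.Ico i j, w l (l + 1) ≤ w i j := by
  induction j, hij using Nat.le_induction with
  | base => simp [hw.self]
  | succ j hij ih =>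
    rw [Finset.sum_Ico_succ_top hij]
    linarith [hw.add_le i j (j + 1) hij (by omega)]

/-- Since `p > 2`, the factor `w ^ (1 - 2 / p)` is bounded by `M`. Hence an error proportional to
`w` is admissible as a second-order remainder. -/
theorem le_mul_gauge_sq {p M : ℝ} {w : ι → ι → ℝ} {i j : ι} (hp2 : 2 < p) (hM : 1 ≤ M)
    (h : 0 ≤ w i j) (hle : w i j ≤ M) : w i j ≤ M * gauge p w i j ^ 2 := by
  have h1 : 0 ≤ 1 - 2 / p := by
    rw [sub_nonneg, div_le_one (by linarith)]; linarith
  have h2 : w i j = w i j ^ (1 - 2 / p) * w i j ^ (2 / p) := by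
    rw [← Real.rpow_add_of_nonneg h h1 (by positivity), sub_add_cancel, Real.rpow_one]
  have h3 : w i j ^ (1 - 2 / p) ≤ M := by
    refine (Real.rpow_le_rpow h hle h1).trans ?_
    conv_rhs => rw [← Real.rpow_one M]
    refine Real.rpow_le_rpow_of_exponent_le hM ?_
    have : 0 ≤ 2 / p := by positivity
    linarith
  have h4 : gauge p w i j ^ 2 = w i j ^ (2 / p) := by
    rw [gauge_pow h]; norm_cast
  rw [h4]
  conv_lhs => rw [h2]
  have := Real.rpow_nonneg h (2 / p)
  gcongr

theorem Ctrl.perturb {c r v : ℝ} {x : V} {a b a₁ b₁ : U} {a' b' : V →L[ℝ] U}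
    (h : Ctrl c v x a b a' b') (hv : 0 ≤ v) (hr : ‖(b₁ - b) - (a₁ - a)‖ ≤ r * v ^ 2)
    (hr0 : 0 ≤ r) : Ctrl (c + r) v x a₁ b₁ a' b' := by
  have q : 0 ≤ r * v := by positivity
  refine ⟨by linarith [h.left], by linarith [h.right], by linarith [h.deriv], ?_⟩
  have e : b₁ - a₁ - a' x = (b - a - a' x) + ((b₁ - b) - (a₁ - a)) := by abel
  rw [e]
  linarith [norm_add_le (b - a - a' x) ((b₁ - b) - (a₁ - a)), h.rem]

namespace RDE

/-- The equation with the one-step Euler errors of the candidate added to the inhomogeneity. -/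
def correct (S : RDE ℕ V E U) (J : E →L[ℝ] U) (X : ℕ → V)
    (T : ℕ → ℕ → (V →L[ℝ] V →L[ℝ] E) →L[ℝ] E) : RDE ℕ V E U :=
  { S with y := fun i => S.y i + ∑ l ∈ Finset.range i, S.error J X T l (l + 1) }

section Correct

variable {S S₁ : RDE ℕ V E U} {J : E →L[ℝ] U} {X : ℕ → V}
  {T : ℕ → ℕ → (V →L[ℝ] V →L[ℝ] E) →L[ℝ] E} {w : ℕ → ℕ → ℝ} {p b : ℝ}

theorem error_correct (l : ℕ) : (S.correct J X T).error J X T l (l + 1) = 0 := by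
  have h : (S.correct J X T).error J X T l (l + 1) =
      S.error J X T l (l + 1) - S.error J X T l (l + 1) := by
    conv_lhs => rw [error]
    simp only [correct, Finset.sum_range_succ]
    conv_rhs => lhs; rw [error]
    simp only [germ, Z, Z', state, state', Y']
    abel
  rw [h, sub_self]

theorem norm_correct_sub_le (hw : Superadd w) (hb : 0 ≤ b)
    (h : ∀ l, ‖S.error J X T l (l + 1)‖ ≤ b * w l (l + 1)) {i j : ℕ} (hij : i ≤ j) :
    ‖((S.correct J X T).y j - S.y j) - ((S.correct J X T).y i - S.y i)‖ ≤ b * w i j := by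
  simp only [correct, add_sub_cancel_left]
  rw [← Finset.sum_Ico_eq_sub _ hij]
  refine (norm_sum_le _ _).trans ?_
  refine (Finset.sum_le_sum fun l _ => h l).trans ?_
  rw [← Finset.mul_sum]
  have := hw.sum_le hij
  gcongr

end Correct

/-- The stability of solutions with respect to the data. -/
theorem exists_stability (γ M : ℝ) (hγ : 0 < γ) (hM : 1 ≤ M) : ∃ C, 0 ≤ C ∧
    ∀ {p : ℝ}, 2 < p → p < 3 → (2 : ℝ) ^ (1 - 3 / p) ≤ 1 - γ →
    ∀ {T₀ : ℝ} {w : ℝ → ℝ → ℝ} (hT : 0 ≤ T₀), IsControl T₀ w → w 0 T₀ ≤ M →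
    ∀ {S S₁ : RDE (Icc (0 : ℝ) T₀) V E U} {J : E →L[ℝ] U} {X : Icc (0 : ℝ) T₀ → V}
      {T : Icc (0 : ℝ) T₀ → Icc (0 : ℝ) T₀ → (V →L[ℝ] V →L[ℝ] E) →L[ℝ] E}
      {D2f : U → U →L[ℝ] U →L[ℝ] V →L[ℝ] E} {η : ℝ},
      ‖J‖ ≤ 1 → Driver (gauge p fun s t : Icc (0 : ℝ) T₀ => w s t) X T →
      S.StateBound M (gauge p fun s t : Icc (0 : ℝ) T₀ => w s t) X →
      S₁.StateBound M (gauge p fun s t : Icc (0 : ℝ) T₀ => w s t) X →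
      C2Bound M S₁.Df D2f → 0 < η →
      S.Dist S₁ η (gauge p fun s t : Icc (0 : ℝ) T₀ => w s t) X →
      S.Solves J X T w → S₁.Solves J X T w →
      (∀ s t, s ≤ t → S.CtrlY J M (gauge p fun s t : Icc (0 : ℝ) T₀ => w s t) X s t) →
      (∀ s t, s ≤ t → S₁.CtrlY J M (gauge p fun s t : Icc (0 : ℝ) T₀ => w s t) X s t) →
      ‖S.Y ⟨0, le_rfl, hT⟩ - S₁.Y ⟨0, le_rfl, hT⟩‖ ≤ η →
      ∀ s t, s ≤ t → ‖S.Y t - S₁.Y t‖ ≤ C * η ∧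
        S.CtrlSub S₁ J (C * η) (gauge p fun s t : Icc (0 : ℝ) T₀ => w s t) X s t := by
  obtain ⟨C, hC0, hC⟩ := exists_euler_stability (V := V) (E := E) (U := U) γ M hγ hM
  refine ⟨C * 2, by positivity, ?_⟩
  intro p hp2 hp3 hγp T₀ w hT hw hwM S S₁ J X T D2f η hJ hX hS hS₁ hD2 hη hd hsol hsol₁ hY hY₁
    hY0 s t hst
  have hp0 : 0 < p := by linarith
  have hM0 : 0 < M := by linarith
  -- Each solution may contribute `η / 2` to the remainder of the corrected inhomogeneity. Together
  -- with the distance `η` of the data this gives the `η * 2` used below.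
  set b := η / (2 * M) with hb
  have hb0 : 0 < b := by positivity
  have hb2 : b * M ≤ η / 2 := by
    have : b * M = η / 2 := by rw [hb]; field_simp
    exact this.le
  obtain ⟨δ₁, hδ₁, h₁⟩ := hsol b hb0
  obtain ⟨δ₂, hδ₂, h₂⟩ := hsol₁ b hb0
  have hδ : 0 < min δ₁ δ₂ := lt_min hδ₁ hδ₂
  -- The grid begins at `0`, where the initial values are compared, passes through `s` at index `n`,
  -- and ends at `t`.
  obtain ⟨n, u, hu, hum⟩ := exists_partition s.2.1 hδ
  obtain ⟨m, v, hv, hvm⟩ := exists_partition (show (s : ℝ) ≤ t from hst) hδ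
  have e : u n = v 0 := by rw [hu.right, hv.left]
  have hpart := hu.concat hv
  set k : ℕ → Icc (0 : ℝ) T₀ := hpart.seq le_rfl t.2.2 with hk
  have hkm : Monotone k := hpart.monotone_seq le_rfl t.2.2
  have hmesh := hpart.mesh_seq le_rfl t.2.2 hδ (mesh_concatSeq e hum hvm)
  have hk0 : k 0 = ⟨0, le_rfl, hT⟩ := Subtype.ext (by
    rw [hk, hpart.coe_seq le_rfl t.2.2 (Nat.zero_le _), hpart.left])
  have hkn : k n = s := Subtype.ext (by
    rw [hk, hpart.coe_seq le_rfl t.2.2 (by omega), concatSeq_left le_rfl, hu.right])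
  have hkt : k (n + m) = t := Subtype.ext (by
    rw [hk, hpart.coe_seq le_rfl t.2.2 le_rfl, hpart.right])
  have hsup := superadd_comp hw hkm
  have hwk : ∀ i j, i ≤ j → w (k i) (k j) ≤ M := fun i j h =>
    (hw.mono le_rfl (k i).2.1 (hkm h) (k j).2.2 le_rfl).trans hwM
  have herr : ∀ l, ‖(S.reindex k).error J (fun i => X (k i)) (fun i j => T (k i) (k j)) l (l + 1)‖
      ≤ b * w (k l) (k (l + 1)) := fun l =>
    h₁ (k l) (k (l + 1)) (hkm (Nat.le_succ l)) ((hmesh l).trans_le (min_le_left _ _))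
  have herr₁ : ∀ l,
      ‖(S₁.reindex k).error J (fun i => X (k i)) (fun i j => T (k i) (k j)) l (l + 1)‖
      ≤ b * w (k l) (k (l + 1)) := fun l =>
    h₂ (k l) (k (l + 1)) (hkm (Nat.le_succ l)) ((hmesh l).trans_le (min_le_right _ _))
  have hgauge : ∀ i j, i ≤ j → b * w (k i) (k j) ≤
      b * M * gauge p (fun i j => w (k i) (k j)) i j ^ 2 := fun i j h => by
    rw [mul_assoc]
    exact mul_le_mul_of_nonneg_left
      (le_mul_gauge_sq hp2 hM (hsup.nonneg i j h) (hwk i j h)) hb0.le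
  have hc := fun i j (h : i ≤ j) => (norm_correct_sub_le hsup hb0.le herr h).trans (hgauge i j h)
  have hc₁ := fun i j (h : i ≤ j) =>
    (norm_correct_sub_le hsup hb0.le herr₁ h).trans (hgauge i j h)
  have hB := hS.reindex hkm
  have hB₁ := hS₁.reindex hkm
  have hD := hd.reindex hkm
  have hg0 : ∀ i j, i ≤ j → 0 ≤ gauge p (fun i j => w (k i) (k j)) i j := fun i j h =>
    hsup.gauge_nonneg h
  -- Correction changes `y` but neither `y'` nor the candidate, so the candidates become exact Euler
  -- schemes with unchanged `Y'`.
  have hfin := hC (S := (S.reindex k).correct J (fun i => X (k i)) (fun i j => T (k i) (k j)))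
    (S₁ := (S₁.reindex k).correct J (fun i => X (k i)) (fun i j => T (k i) (k j)))
    (D2f := D2f) (η := η * 2) hp2 hp3 hγp hsup hwk hJ (hX.reindex hkm)
    ⟨hB.f, hB.a⟩ ⟨hB₁.f, hB₁.a⟩ hD2
    ⟨hD.f.mono (by linarith), fun i => (hD.a_le i).trans (by linarith),
      fun i j h => (hD.a i j h).mono (hg0 i j h) (by linarith),
      fun i j h => by
        refine ((hD.y i j h).perturb (r := η) (hg0 i j h) ?_ hη.le).mono (hg0 i j h)
          (by linarith)
        have h3 := hc i j h
        have h4 := hc₁ i j h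
        have h5 : b * M * gauge p (fun i j => w (k i) (k j)) i j ^ 2 ≤
            η / 2 * gauge p (fun i j => w (k i) (k j)) i j ^ 2 := by gcongr
        have h6 : ∀ P Q R P₁ Q₁ R₁ O O₁ : E, ‖(P - Q) - (R - O)‖ ≤ η / 2 *
            gauge p (fun i j => w (k i) (k j)) i j ^ 2 → ‖(P₁ - Q₁) - (R₁ - O₁)‖ ≤ η / 2 *
            gauge p (fun i j => w (k i) (k j)) i j ^ 2 →
            ‖((P - P₁) - (Q - Q₁)) - ((R - R₁) - (O - O₁))‖ ≤
            η * gauge p (fun i j => w (k i) (k j)) i j ^ 2 := by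
          intro P Q R P₁ Q₁ R₁ O O₁ g1 g2
          have e : ((P - P₁) - (Q - Q₁)) - ((R - R₁) - (O - O₁)) =
            ((P - Q) - (R - O)) - ((P₁ - Q₁) - (R₁ - O₁)) := by abel
          rw [e]
          linarith [norm_sub_le ((P - Q) - (R - O)) ((P₁ - Q₁) - (R₁ - O₁))]
        exact h6 _ _ _ _ _ _ _ _ (h3.trans h5) (h4.trans h5)⟩
    error_correct error_correct
    (fun i j h => hY (k i) (k j) (hkm h)) (fun i j h => hY₁ (k i) (k j) (hkm h))
    (by
      change ‖S.Y (k 0) - S₁.Y (k 0)‖ ≤ _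
      rw [hk0]; linarith) n (n + m) (by omega)
  have e1 : C * (η * 2) = C * 2 * η := by ring
  rw [e1] at hfin
  obtain ⟨g1, g2⟩ := hfin
  change ‖S.Y (k (n + m)) - S₁.Y (k (n + m))‖ ≤ _ at g1
  change S.CtrlSub S₁ J (C * 2 * η) (gauge p fun s t : Icc (0 : ℝ) T₀ => w s t) X (k n)
    (k (n + m)) at g2
  rw [hkt] at g1
  rw [hkn, hkt] at g2
  exact ⟨g1, g2⟩

/-- The equation with another candidate. -/
def withY (S : RDE ι V E U) (Y : ι → E) : RDE ι V E U := { S with Y := Y }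

/-- The Euler scheme. -/
def euler (S : RDE ℕ V E U) (J : E →L[ℝ] U) (X : ℕ → V)
    (T : ℕ → ℕ → (V →L[ℝ] V →L[ℝ] E) →L[ℝ] E) : ℕ → E
  | 0 => S.y 0
  | i + 1 => S.euler J X T i + (S.y (i + 1) - S.y i) +
      germ X T ((S.withY fun _ => S.euler J X T i).Z J)
        ((S.withY fun _ => S.euler J X T i).Z' J) i (i + 1)

theorem error_euler (S : RDE ℕ V E U) (J : E →L[ℝ] U) (X : ℕ → V)
    (T : ℕ → ℕ → (V →L[ℝ] V →L[ℝ] E) →L[ℝ] E) (l : ℕ) :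
    (S.withY (S.euler J X T)).error J X T l (l + 1) = 0 := by
  have h : S.euler J X T (l + 1) = S.euler J X T l + (S.y (l + 1) - S.y l) +
      germ X T ((S.withY (S.euler J X T)).Z J) ((S.withY (S.euler J X T)).Z' J) l (l + 1) := rfl
  rw [error]
  change S.euler J X T (l + 1) - S.euler J X T l - (S.y (l + 1) - S.y l) - _ = 0
  rw [h]
  abel

theorem _root_.Finset.exists_monotone_enum {ι : Type*} [LinearOrder ι] (P : Finset ι)
    (hP : P.Nonempty) :
    ∃ u : ℕ → ι, Monotone u ∧ (∀ i, u i ∈ P) ∧ ∀ s ∈ P, ∃ i, u i = s := by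
  have hpos : 0 < P.card := hP.card_pos
  refine ⟨fun i => P.orderEmbOfFin rfl ⟨min i (P.card - 1), by omega⟩, fun i j hij => ?_,
    fun i => P.orderEmbOfFin_mem rfl _, fun s hs => ?_⟩
  · refine (P.orderEmbOfFin rfl).monotone ?_
    simp only [Fin.mk_le_mk]
    omega
  · have : s ∈ Set.range (P.orderEmbOfFin rfl) := by rw [Finset.range_orderEmbOfFin]; exact hs
    obtain ⟨i, rfl⟩ := this
    exact ⟨i, congrArg (P.orderEmbOfFin rfl) (Fin.ext (min_eq_left (Nat.le_sub_one_of_lt i.2)))⟩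

/-! ### Existence by compactness. -/

section Existence

theorem tendsto_clm_apply {α : Type*} {l : Filter α} {f : α → V →L[ℝ] E} {g : α → V}
    {f₀ : V →L[ℝ] E} {g₀ : V} (hf : Tendsto f l (𝓝 f₀)) (hg : Tendsto g l (𝓝 g₀)) :
    Tendsto (fun x => f x (g x)) l (𝓝 (f₀ g₀)) :=
  (isBoundedBilinearMap_apply.continuous.tendsto (f₀, g₀)).comp (hf.prodMk_nhds hg)

theorem tendsto_clm_comp {α : Type*} {l : Filter α} {f : α → U →L[ℝ] E} {g : α → V →L[ℝ] U}
    {f₀ : U →L[ℝ] E} {g₀ : V →L[ℝ] U} (hf : Tendsto f l (𝓝 f₀)) (hg : Tendsto g l (𝓝 g₀)) :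
    Tendsto (fun x => (f x).comp (g x)) l (𝓝 (f₀.comp g₀)) :=
  (isBoundedBilinearMap_comp.continuous.tendsto (f₀, g₀)).comp (hf.prodMk_nhds hg)

/-- Existence of solutions on finite sets of times, with uniform bounds. -/
theorem exists_solution_on_finset (γ M : ℝ) (hγ : 0 < γ) (hM : 1 ≤ M) : ∃ L, 0 ≤ L ∧
    ∀ {p : ℝ}, 2 < p → p < 3 → (2 : ℝ) ^ (1 - 3 / p) ≤ 1 - γ →
    ∀ {T₀ : ℝ} {w : ℝ → ℝ → ℝ} (hT : 0 ≤ T₀), IsControl T₀ w → w 0 T₀ ≤ M →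
    ∀ {S : RDE (Icc (0 : ℝ) T₀) V E U} {J : E →L[ℝ] U} {X : Icc (0 : ℝ) T₀ → V}
      {T : Icc (0 : ℝ) T₀ → Icc (0 : ℝ) T₀ → (V →L[ℝ] V →L[ℝ] E) →L[ℝ] E},
      ‖J‖ ≤ 1 → Driver (gauge p fun s t : Icc (0 : ℝ) T₀ => w s t) X T →
      S.Bound M (gauge p fun s t : Icc (0 : ℝ) T₀ => w s t) X →
      ∀ P : Finset (Icc (0 : ℝ) T₀), ∃ Y : Icc (0 : ℝ) T₀ → E,
        Y ⟨0, le_rfl, hT⟩ = S.y ⟨0, le_rfl, hT⟩ ∧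
        ∀ s ∈ insert ⟨0, le_rfl, hT⟩ P, ∀ t ∈ P, s ≤ t →
          (S.withY Y).CtrlY J L (gauge p fun s t : Icc (0 : ℝ) T₀ => w s t) X s t ∧
          ∀ K, (∀ m : Icc (0 : ℝ) T₀, s ≤ m → m ≤ t → min (w s m) (w m t) ≤ K) →
            ‖(S.withY Y).error J X T s t‖ ≤ sewConst p * (M * (M + L) +
              M * ((M + L) * (1 + M)) ^ 2) * K ^ (sewExp p - 1) * w s t ^ sewExp p := by
  obtain ⟨L, hL0, hL⟩ := exists_euler_bound (V := V) (E := E) (U := U) γ M hγ hM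
  refine ⟨L, hL0, ?_⟩
  intro p hp2 hp3 hγp T₀ w hT hw hwM S J X T hJ hX hS P
  set o : Icc (0 : ℝ) T₀ := ⟨0, le_rfl, hT⟩ with ho
  have ho_le : ∀ s : Icc (0 : ℝ) T₀, o ≤ s := fun s => s.2.1
  classical
  obtain ⟨u, hu, -, hsurj⟩ := (insert o P).exists_monotone_enum ⟨o, Finset.mem_insert_self _ _⟩
  have hidx : ∀ s, ∃ i, s ∈ insert o P → u i = s := fun s => by
    by_cases h : s ∈ insert o P
    · obtain ⟨i, hi⟩ := hsurj s h; exact ⟨i, fun _ => hi⟩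
    · exact ⟨0, fun h' => absurd h' h⟩
  choose k hk using hidx
  -- Time `0` is given index `0`, where the scheme has its prescribed initial value; the arbitrary
  -- choice `k` need not do so.
  set k' : Icc (0 : ℝ) T₀ → ℕ := fun s => if s = o then 0 else k s with hk'
  have hu0 : u 0 = o := by
    obtain ⟨i, hi⟩ := hsurj o (Finset.mem_insert_self _ _)
    exact le_antisymm (hi ▸ hu (Nat.zero_le i)) (ho_le _)
  have hk'' : ∀ s ∈ insert o P, u (k' s) = s := fun s hs => by
    by_cases h : s = o
    · simp only [hk', h, if_true, hu0]
    · simp only [hk', h, if_false, hk s hs]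
  set Sd := S.reindex u with hSd
  set Xd := fun i => X (u i) with hXd
  set Td := fun i j => T (u i) (u j) with hTd
  set Yd := Sd.euler J Xd Td with hYd
  have hsup := superadd_comp hw hu
  have hwu : ∀ i j, i ≤ j → w (u i) (u j) ≤ M := fun i j h =>
    (hw.mono le_rfl (u i).2.1 (hu h) (u j).2.2 le_rfl).trans hwM
  have hB : (Sd.withY Yd).Bound M (gauge p fun i j => w (u i) (u j)) Xd :=
    ⟨⟨(hS.reindex hu).f, (hS.reindex hu).a⟩, (hS.reindex hu).y⟩
  have herr := error_euler Sd J Xd Td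
  have hctrl := hL hp2 hp3 hγp hsup hwu hJ (hX.reindex hu) hB herr
  refine ⟨fun s => Yd (k' s), ?_, fun s hs t ht hst => ?_⟩
  · simp only [hk', if_true]
    change S.y (u 0) = _
    rw [hu0]
  have ht := Finset.mem_insert_of_mem (b := o) ht
  have hkle : k' s ≤ k' t := by
    rcases hst.eq_or_lt with rfl | hlt
    · exact le_rfl
    · by_contra h
      have := hu (not_le.1 h).le
      rw [hk'' s hs, hk'' t ht] at this
      exact absurd hlt (not_lt.2 this)
  have es := hk'' s hs
  have et := hk'' t ht
  refine ⟨?_, fun K hK => ?_⟩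
  · have := hctrl _ _ hkle
    simp only [CtrlY, Y', state, withY, hSd, reindex, gauge, es, et] at this ⊢
    exact this
  · have hc0 : 0 ≤ M * (M + L) + M * ((M + L) * (1 + M)) ^ 2 := by
      have : 0 ≤ M := by linarith
      positivity
    have h1 := norm_defect_germ_le (Z := (Sd.withY Yd).Z J) (Z' := (Sd.withY Yd).Z' J) (K := K)
      hp2 hp3 hsup (hX.reindex hu) hkle hc0
      (fun i j _ hij _ => (ctrl_state hJ (hB.a i j hij) (hctrl i j hij)).comp hB.f
        ((hX.reindex hu).X_le i j hij) (gauge_le (by linarith) hM (hsup.nonneg i j hij)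
          (hwu i j hij)))
      (fun m h1 h2 => by
        rw [es, et]
        exact hK (u m) (es ▸ hu h1) (et ▸ hu h2))
    rw [es, et] at h1
    have h2 := error_eq_defect (S := Sd.withY Yd) herr hkle
    rw [← h2] at h1
    simp only [error, germ, Z, Z', Y', state, state', withY, hSd, reindex, hXd, hTd, es, et]
      at h1 ⊢
    exact h1

/-- Existence of solutions, with the a priori bound. -/
theorem exists_solution [ProperSpace E] (γ M : ℝ) (hγ : 0 < γ) (hM : 1 ≤ M) : ∃ L, 0 ≤ L ∧
    ∀ {p : ℝ}, 2 < p → p < 3 → (2 : ℝ) ^ (1 - 3 / p) ≤ 1 - γ →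
    ∀ {T₀ : ℝ} {w : ℝ → ℝ → ℝ} (hT : 0 ≤ T₀), IsControl T₀ w → w 0 T₀ ≤ M →
    ∀ {S : RDE (Icc (0 : ℝ) T₀) V E U} {J : E →L[ℝ] U} {X : Icc (0 : ℝ) T₀ → V}
      {T : Icc (0 : ℝ) T₀ → Icc (0 : ℝ) T₀ → (V →L[ℝ] V →L[ℝ] E) →L[ℝ] E},
      ‖J‖ ≤ 1 → Driver (gauge p fun s t : Icc (0 : ℝ) T₀ => w s t) X T →
      S.Bound M (gauge p fun s t : Icc (0 : ℝ) T₀ => w s t) X →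
      ∃ Y : Icc (0 : ℝ) T₀ → E, Y ⟨0, le_rfl, hT⟩ = S.y ⟨0, le_rfl, hT⟩ ∧
        (S.withY Y).Solves J X T w ∧ ∀ s t, s ≤ t →
          (S.withY Y).CtrlY J L (gauge p fun s t : Icc (0 : ℝ) T₀ => w s t) X s t := by
  obtain ⟨L, hL0, hL⟩ := exists_solution_on_finset (V := V) (E := E) (U := U) γ M hγ hM
  refine ⟨L, hL0, ?_⟩
  intro p hp2 hp3 hγp T₀ w hT hw hwM S J X T hJ hX hS
  have hp0 : 0 < p := by linarith
  have hM0 : 0 ≤ M := by linarith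
  choose Yp hYp0 hYp using hL hp2 hp3 hγp hT hw hwM hJ hX hS
  set o : Icc (0 : ℝ) T₀ := ⟨0, le_rfl, hT⟩ with ho
  have ho_le : ∀ s : Icc (0 : ℝ) T₀, o ≤ s := fun s => s.2.1
  -- Finite sets of times ordered by inclusion; along `𝒰` every time eventually belongs to the grid.
  -- Uniform bounds in a proper space then give pointwise limits at all times at once, without
  -- equicontinuity.
  set 𝒰 : Ultrafilter (Finset (Icc (0 : ℝ) T₀)) := Ultrafilter.of atTop with h𝒰
  have hmem : ∀ t : Icc (0 : ℝ) T₀, ∀ᶠ P in (𝒰 : Filter (Finset (Icc (0 : ℝ) T₀))), t ∈ P := by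
    intro t
    refine (Ultrafilter.of_le atTop) ?_
    filter_upwards [eventually_ge_atTop {t}] with P hP
    exact hP (Finset.mem_singleton_self t)
  have hlim : ∀ t, ∃ z, Tendsto (fun P => Yp P t) 𝒰 (𝓝 z) := by
    intro t
    obtain ⟨z, -, hz⟩ := (isCompact_closedBall (S.y o) (L * (1 + M) * M)).ultrafilter_le_nhds
      (𝒰.map fun P => Yp P t) (by
        rw [Ultrafilter.coe_map, le_principal_iff, mem_map]
        filter_upwards [hmem t] with P hP
        have h1 := (hYp P o (Finset.mem_insert_self _ _) t hP (ho_le t)).1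
        have hv := gauge_le (p := p) (w := fun s t : Icc (0 : ℝ) T₀ => w s t) (i := o) (j := t)
          (by linarith) hM (hw.nonneg _ _ le_rfl (ho_le t) t.2.2)
          ((hw.mono le_rfl le_rfl (ho_le t) t.2.2 le_rfl).trans hwM)
        have h2 := h1.norm_sub_le (hX.X_le o t (ho_le t)) hv
        change ‖Yp P t - Yp P o‖ ≤ _ at h2
        rw [hYp0] at h2
        rw [mem_preimage, mem_closedBall_iff_norm]
        exact h2.trans (by gcongr))
    exact ⟨z, by rwa [Ultrafilter.coe_map] at hz⟩
  choose Y hYlim using hlim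
  have hst : ∀ t, Tendsto (fun P => (S.withY (Yp P)).state J t) 𝒰
      (𝓝 ((S.withY Y).state J t)) := fun t =>
    tendsto_const_nhds.add ((J.continuous.tendsto _).comp (hYlim t))
  have hZ : ∀ t, Tendsto (fun P => (S.withY (Yp P)).Z J t) 𝒰 (𝓝 ((S.withY Y).Z J t)) := fun t =>
    (hS.f.continuous.tendsto _).comp (hst t)
  have hY' : ∀ t, Tendsto (fun P => (S.withY (Yp P)).Y' J t) 𝒰 (𝓝 ((S.withY Y).Y' J t)) :=
    fun t => tendsto_const_nhds.add (hZ t)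
  have hst' : ∀ t, Tendsto (fun P => (S.withY (Yp P)).state' J t) 𝒰
      (𝓝 ((S.withY Y).state' J t)) := fun t =>
    tendsto_const_nhds.add ((((ContinuousLinearMap.compL ℝ V E U J).continuous.tendsto _).comp (hY' t)))
  have hZ' : ∀ t, Tendsto (fun P => (S.withY (Yp P)).Z' J t) 𝒰 (𝓝 ((S.withY Y).Z' J t)) :=
    fun t => tendsto_clm_comp ((hS.f.continuous_deriv.tendsto _).comp (hst t)) (hst' t)
  have herr : ∀ s t, Tendsto (fun P => (S.withY (Yp P)).error J X T s t) 𝒰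
      (𝓝 ((S.withY Y).error J X T s t)) := fun s t =>
    (((hYlim t).sub (hYlim s)).sub tendsto_const_nhds).sub
      ((tendsto_clm_apply (hZ s) tendsto_const_nhds).add (((T s t).continuous.tendsto _).comp (hZ' s)))
  have hev : ∀ s t : Icc (0 : ℝ) T₀, s ≤ t →
      ∀ᶠ P in (𝒰 : Filter (Finset (Icc (0 : ℝ) T₀))), s ∈ insert o P ∧ t ∈ P := fun s t _ => by
    filter_upwards [hmem s, hmem t] with P h1 h2
    exact ⟨Finset.mem_insert_of_mem h1, h2⟩
  refine ⟨Y, ?_, ?_, fun s t hle => ⟨?_, ?_, ?_, ?_⟩⟩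
  · refine tendsto_nhds_unique (hYlim o) ?_
    simp only [hYp0]
    exact tendsto_const_nhds
  -- The sewing bound for the error does not depend on the grid, so it passes to the limit.
  · refine solves_of_error_le (p := p)
      (C := sewConst p * (M * (M + L) + M * ((M + L) * (1 + M)) ^ 2)) hw hp0 hp3 ?_ ?_
    · have := sewConst_nonneg hp0 hp3
      positivity
    · intro s t hle K hK
      refine le_of_tendsto (herr s t).norm ?_
      filter_upwards [hev s t hle] with P hP
      exact (hYp P s hP.1 t hP.2 hle).2 K hK
  · refine le_of_tendsto (hY' s).norm ?_
    filter_upwards [hev s t hle] with P hP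
    exact (hYp P s hP.1 t hP.2 hle).1.left
  · refine le_of_tendsto (hY' t).norm ?_
    filter_upwards [hev s t hle] with P hP
    exact (hYp P s hP.1 t hP.2 hle).1.right
  · refine le_of_tendsto ((hY' t).sub (hY' s)).norm ?_
    filter_upwards [hev s t hle] with P hP
    exact (hYp P s hP.1 t hP.2 hle).1.deriv
  · refine le_of_tendsto (((hYlim t).sub (hYlim s)).sub
      (tendsto_clm_apply (hY' s) tendsto_const_nhds)).norm ?_
    filter_upwards [hev s t hle] with P hP
    exact (hYp P s hP.1 t hP.2 hle).1.rem

end Existence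

end RDE

end Solutions

end CadlagRough

namespace CadlagRough

/-! ### From smooth functions, càdlàg paths and rough paths to the abstract bounds. -/

noncomputable section Regularity

set_option maxSynthPendingDepth 3

section Smooth

variable {U W : Type*} [NormedAddCommGroup U] [NormedSpace ℝ U]
  [NormedAddCommGroup W] [NormedSpace ℝ W]

theorem c2Bound_of_norm_iteratedFDeriv_le {f : U → W} {M : ℝ} (hf : ContDiff ℝ 2 f)
    (hM : ∀ i ≤ 2, ∀ x, ‖iteratedFDeriv ℝ i f x‖ ≤ M) : C2Bound M f (fderiv ℝ f) where
  deriv x := (hf.differentiable (by norm_num) x).hasFDerivAt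
  bound x := by simpa using hM 0 (by norm_num) x
  bound_deriv x := by rw [← norm_iteratedFDeriv_one]; exact hM 1 (by norm_num) x
  lip_deriv x y := by
    have hf' : ContDiff ℝ 1 (fderiv ℝ f) := hf.fderiv_right (by norm_num)
    refine convex_univ.norm_image_sub_le_of_norm_hasFDerivWithin_le
      (fun z _ => (hf'.differentiable (by norm_num) z).hasFDerivAt.hasFDerivWithinAt)
      (fun z _ => ?_) (mem_univ y) (mem_univ x)
    rw [← norm_iteratedFDeriv_one, norm_iteratedFDeriv_fderiv]
    exact hM 2 le_rfl z

theorem IsCb.norm_iteratedFDeriv_le {n m : ℕ} {f : U → W} (hf : IsCb n f) (hmn : m ≤ n) {i : ℕ}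
    (hi : i ≤ m) (x : U) : ‖iteratedFDeriv ℝ i f x‖ ≤ cbNorm m f := by
  have h1 : ‖iteratedFDeriv ℝ i f x‖ ≤ ⨆ x, ‖iteratedFDeriv ℝ i f x‖ := by
    obtain ⟨B, hB⟩ := hf.bounded i (hi.trans hmn)
    exact le_ciSup (f := fun x => ‖iteratedFDeriv ℝ i f x‖)
      ⟨B, by rintro _ ⟨z, rfl⟩; exact hB z⟩ x
  refine h1.trans ?_
  exact Finset.single_le_sum (f := fun i => ⨆ x, ‖iteratedFDeriv ℝ i f x‖)
    (fun j _ => Real.iSup_nonneg fun x => norm_nonneg _) (Finset.mem_range.2 (by omega))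

theorem cbNorm_nonneg (n : ℕ) (f : U → W) : 0 ≤ cbNorm n f :=
  Finset.sum_nonneg fun _ _ => Real.iSup_nonneg fun _ => norm_nonneg _

theorem IsCb.c2Bound {f : U → W} (hf : IsCb 3 f) {M : ℝ} (hM : cbNorm 2 f ≤ M) :
    C2Bound M f (fderiv ℝ f) :=
  c2Bound_of_norm_iteratedFDeriv_le (hf.contDiff.of_le (by norm_num)) fun _ hi x =>
    (hf.norm_iteratedFDeriv_le (m := 2) (by norm_num) hi x).trans hM

theorem cbNorm_two_le_three (f : U → W) : cbNorm 2 f ≤ cbNorm 3 f := by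
  simp only [cbNorm]
  rw [Finset.sum_range_succ _ 3]
  have : 0 ≤ ⨆ x, ‖iteratedFDeriv ℝ 3 f x‖ := Real.iSup_nonneg fun _ => norm_nonneg _
  linarith

theorem IsCb.c2Bound_fderiv {f : U → W} (hf : IsCb 3 f) {M : ℝ} (hM : cbNorm 3 f ≤ M) :
    C2Bound M (fderiv ℝ f) (fderiv ℝ (fderiv ℝ f)) := by
  refine c2Bound_of_norm_iteratedFDeriv_le
    (ContDiff.fderiv_right (n := 3) (m := 2) (by exact_mod_cast hf.contDiff) (by norm_num))
    fun i hi x => ?_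
  rw [norm_iteratedFDeriv_fderiv]
  exact (hf.norm_iteratedFDeriv_le le_rfl (by omega) x).trans hM

theorem IsCb.sub {n : ℕ} {f g : U → W} (hf : IsCb n f) (hg : IsCb n g) :
    IsCb n (fun x => f x - g x) where
  contDiff := hf.contDiff.sub hg.contDiff
  bounded i hi := by
    obtain ⟨B, hB⟩ := hf.bounded i hi
    obtain ⟨B', hB'⟩ := hg.bounded i hi
    refine ⟨B + B', fun x => ?_⟩
    have hi' : (i : WithTop ℕ∞) ≤ n := by exact_mod_cast hi
    have e : iteratedFDeriv ℝ i (fun x => f x - g x) x =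
        iteratedFDeriv ℝ i f x - iteratedFDeriv ℝ i g x :=
      iteratedFDeriv_sub_apply (hf.contDiff.contDiffAt.of_le hi')
        (hg.contDiff.contDiffAt.of_le hi')
    rw [e]
    exact (norm_sub_le _ _).trans (add_le_add (hB x) (hB' x))

theorem IsCb.c2Bound_sub {f g : U → W} (hf : IsCb 3 f) (hg : IsCb 3 g) {η : ℝ}
    (h : cbNorm 2 (fun x => f x - g x) ≤ η) :
    C2Bound η (fun x => f x - g x) (fun x => fderiv ℝ f x - fderiv ℝ g x) := by
  have h1 := (hf.sub hg).c2Bound h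
  have e : fderiv ℝ (fun x => f x - g x) = fun x => fderiv ℝ f x - fderiv ℝ g x := by
    funext x
    exact fderiv_fun_sub (hf.contDiff.differentiable (by norm_num) x)
      (hg.contDiff.differentiable (by norm_num) x)
  rwa [e] at h1

theorem cbNorm_sub_self (n : ℕ) (f : U → W) : cbNorm n (fun x => f x - f x) = 0 := by
  simp only [cbNorm, sub_self]
  refine Finset.sum_eq_zero fun i _ => ?_
  have e : iteratedFDeriv ℝ i (fun _ : U => (0 : W)) = 0 := iteratedFDeriv_fun_zero
  simp [e]

end Smooth

section Cadlag

variable {E : Type*} [NormedAddCommGroup E]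

theorem IsCadlag.mono {a b a' b' : ℝ} {f : ℝ → E} (h : IsCadlag a b f) (ha : a ≤ a')
    (hb : b' ≤ b) : IsCadlag a' b' f :=
  ⟨fun t ht => h.1 t ⟨ha.trans ht.1, ht.2.trans_le hb⟩,
    fun t ht => h.2 t ⟨ha.trans_lt ht.1, ht.2.trans hb⟩⟩

theorem isCadlag_const {a b : ℝ} (c : E) : IsCadlag a b (fun _ => c) :=
  ⟨fun _ _ => continuousWithinAt_const, fun _ _ => ⟨c, tendsto_const_nhds⟩⟩

theorem IsCadlag.sub {a b : ℝ} {f g : ℝ → E} (hf : IsCadlag a b f) (hg : IsCadlag a b g) :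
    IsCadlag a b (fun t => f t - g t) :=
  ⟨fun t ht => (hf.1 t ht).sub (hg.1 t ht), fun t ht => by
    obtain ⟨l, hl⟩ := hf.2 t ht
    obtain ⟨l', hl'⟩ := hg.2 t ht
    exact ⟨l - l', hl.sub hl'⟩⟩

theorem IsCadlag.clm_apply {F : Type*} [NormedSpace ℝ E] [NormedAddCommGroup F]
    [NormedSpace ℝ F] {a b : ℝ} {f : ℝ → F →L[ℝ] E} {g : ℝ → F} (hf : IsCadlag a b f)
    (hg : IsCadlag a b g) : IsCadlag a b (fun t => f t (g t)) :=
  ⟨fun t ht => RDE.tendsto_clm_apply (hf.1 t ht) (hg.1 t ht), fun t ht => by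
    obtain ⟨l, hl⟩ := hf.2 t ht
    obtain ⟨l', hl'⟩ := hg.2 t ht
    exact ⟨l l', RDE.tendsto_clm_apply hl hl'⟩⟩

/-- Right-continuity comes from the smallness of `w` to the right of a point. Left limits come from
`IsControl.left`, which makes the values on left neighbourhoods Cauchy. -/
theorem isCadlag_of_isControl [CompleteSpace E] {T q L : ℝ} {w : ℝ → ℝ → ℝ} {f : ℝ → E}
    (hw : IsControl T w) (hq : 0 < q) (hL : 0 ≤ L)
    (h : ∀ s t, 0 ≤ s → s ≤ t → t ≤ T → ‖f t - f s‖ ≤ L * w s t ^ (1 / q)) : IsCadlag 0 T f := by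
  have key : ∀ ε > 0, ∃ κ > 0, ∀ s t, 0 ≤ s → s ≤ t → t ≤ T → w s t ≤ κ → ‖f t - f s‖ < ε := by
    intro ε hε
    have h1 : 0 < ε / (L + 1) := by positivity
    refine ⟨(ε / (L + 1)) ^ q, Real.rpow_pos_of_pos h1 q, fun s t h0 hst hT hwκ => ?_⟩
    have h2 := Real.rpow_le_rpow (hw.nonneg s t h0 hst hT) hwκ (by positivity : 0 ≤ 1 / q)
    rw [← Real.rpow_mul h1.le, mul_one_div_cancel hq.ne', Real.rpow_one] at h2
    calc ‖f t - f s‖ ≤ L * w s t ^ (1 / q) := h s t h0 hst hT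
      _ ≤ L * (ε / (L + 1)) := by gcongr
      _ < ε := by
        rw [mul_div_assoc', div_lt_iff₀ (by positivity)]; linarith
  refine ⟨fun s hs => ?_, fun t ht => ?_⟩
  · rw [Metric.continuousWithinAt_iff']
    intro ε hε
    obtain ⟨κ, hκ, hf⟩ := key ε hε
    obtain ⟨r, hr1, hr2, hr3⟩ := hw.right s hs.1 hs.2 κ hκ
    filter_upwards [Ico_mem_nhdsGE hr1] with t ht
    rw [dist_eq_norm]
    exact hf s t hs.1 ht.1 (ht.2.le.trans hr2) ((hw.mono hs.1 le_rfl ht.1 ht.2.le hr2).trans hr3)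
  · refine cauchy_map_iff_exists_tendsto.1 (Metric.cauchy_iff.2 ⟨inferInstance, fun ε hε => ?_⟩)
    obtain ⟨κ, hκ, hf⟩ := key ε hε
    obtain ⟨r, hr0, hr1, hr2⟩ := hw.left ht.1 ht.2 hκ
    refine ⟨f '' Ico r t, image_mem_map (Ico_mem_nhdsLT hr1), ?_⟩
    rintro _ ⟨a, ha, rfl⟩ _ ⟨b, hb, rfl⟩
    rcases le_total a b with hab | hab
    · rw [dist_comm, dist_eq_norm]
      exact hf a b (hr0.trans ha.1) hab (hb.2.le.trans ht.2) (hr2 a b ha.1 hab hb.2)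
    · rw [dist_eq_norm]
      exact hf b a (hr0.trans hb.1) hab (ha.2.le.trans ht.2) (hr2 b a hb.1 hab ha.2)

end Cadlag

section FiniteVariation

variable {E : Type*} [NormedAddCommGroup E]

/-- `A` vanishes on the diagonal, is right-continuous in its first variable, and has finite
`q`-variation on `[0, T]`. -/
structure IsVar (q T : ℝ) (A : ℝ → ℝ → E) : Prop where
  cont : ∀ t ∈ Icc 0 T, ∀ s ∈ Ico 0 t, ContinuousWithinAt (fun s => A s t) (Ici s) s
  diag : ∀ t ∈ Icc 0 T, A t t = 0
  finite : eVar q A 0 T < ∞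

theorem IsPath.isVar {p T : ℝ} {X : ℝ → E} (h : IsPath p T X) : IsVar p T (incr X) where
  cont _ ht s hs := continuousWithinAt_const.sub (h.cadlag.1 s ⟨hs.1, hs.2.trans_le ht.2⟩)
  diag _ _ := sub_self _
  finite := h.finite

theorem IsPath₂.isVar {q T : ℝ} {A : ℝ → ℝ → E} (h : IsPath₂ q T A)
    (hd : ∀ t ∈ Icc 0 T, A t t = 0) : IsVar q T A where
  cont t ht s hs := (h.cadlag_left t ht).1 s hs
  diag := hd
  finite := h.finite

namespace IsVar

variable {q T : ℝ} {A B : ℝ → ℝ → E}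

theorem exists_isControl (h : IsVar q T A) (hq1 : 1 ≤ q) (hq3 : q ≤ 3) {c η : ℝ} (hc : 0 ≤ c)
    (hη : 0 < η) (hle : pVar q A 0 T ≤ c * η) :
    ∃ w, IsControl T w ∧ w 0 T ≤ (1 + c) ^ 3 ∧
      ∀ s t, 0 ≤ s → s ≤ t → t ≤ T → ‖A s t‖ ≤ η * w s t ^ (1 / q) :=
  CadlagRough.exists_isControl hq1 hq3 h.finite h.cont h.diag hc hη hle

/-- The sum of the controls of `A` and `B` dominates the difference. -/
theorem sub (hA : IsVar q T A) (hB : IsVar q T B) (hq1 : 1 ≤ q) (hq3 : q ≤ 3) (hT : 0 ≤ T) :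
    IsVar q T (fun s t => A s t - B s t) where
  cont t ht s hs := (hA.cont t ht s hs).sub (hB.cont t ht s hs)
  diag t ht := by rw [hA.diag t ht, hB.diag t ht, sub_self]
  finite := by
    obtain ⟨w, hw, -, h⟩ := hA.exists_isControl hq1 hq3 (pVar_nonneg 0 T) one_pos (mul_one _).ge
    obtain ⟨w₁, hw₁, -, h₁⟩ := hB.exists_isControl hq1 hq3 (pVar_nonneg 0 T) one_pos
      (mul_one _).ge
    refine (eVar_le_of_isControl (L := 2) (by linarith) (hw.add hw₁) hT zero_le_two ?_).trans_lt
      ENNReal.ofReal_lt_top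
    intro s t h0 h1 h2
    have i0 := hw.nonneg s t h0 h1 h2
    have i1 := hw₁.nonneg s t h0 h1 h2
    have hq : 0 ≤ 1 / q := by positivity
    have i2 := Real.rpow_le_rpow i0 (by linarith : w s t ≤ w s t + w₁ s t) hq
    have i3 := Real.rpow_le_rpow i1 (by linarith : w₁ s t ≤ w s t + w₁ s t) hq
    linarith [norm_sub_le (A s t) (B s t), h s t h0 h1 h2, h₁ s t h0 h1 h2]

/-- With `c = 0`, every `η > 0` is admissible in `exists_isControl` while the control stays at most
`1`. -/
theorem eq_zero (hA : IsVar q T A) (hq1 : 1 ≤ q) (hq3 : q ≤ 3) (h : pVar q A 0 T ≤ 0) {s t : ℝ}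
    (h0 : 0 ≤ s) (h1 : s ≤ t) (h2 : t ≤ T) : A s t = 0 := by
  rw [← norm_le_zero_iff]
  refine le_of_forall_pos_le_add fun ε hε => ?_
  obtain ⟨w, hw, hw1, hA⟩ := hA.exists_isControl hq1 hq3 le_rfl hε (h.trans (by simp))
  have i1 : w s t ≤ 1 := (hw.mono le_rfl h0 h1 h2 le_rfl).trans (hw1.trans (by norm_num))
  have i2 := Real.rpow_le_one (z := 1 / q) (hw.nonneg s t h0 h1 h2) i1 (by positivity)
  have := hA s t h0 h1 h2
  nlinarith

end IsVar

theorem incr_sub {Y Z : ℝ → E} : incr (fun t => Y t - Z t) = fun s t => incr Y s t - incr Z s t := by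
  funext s t
  simp only [incr]
  abel

theorem pVar_eq_zero {q T : ℝ} {A : ℝ → ℝ → E} (hq : 0 < q) (hT : 0 ≤ T)
    (h : ∀ s t, A s t = 0) : pVar q A 0 T = 0 := by
  refine le_antisymm ?_ (pVar_nonneg 0 T)
  have hw : IsControl T (fun _ _ => (0 : ℝ)) :=
    ⟨fun _ _ _ _ _ => le_rfl, fun _ _ _ _ _ _ _ => by simp,
      fun s _ hs ε hε => ⟨T, hs, le_rfl, hε.le⟩⟩
  simpa using pVar_le_of_isControl (A := A) hq hw hT le_rfl (fun s t _ _ _ => by simp [h])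

end FiniteVariation

section Controlled

variable {d : ℕ} {E : Type*} [NormedAddCommGroup E] [NormedSpace ℝ E] {p T : ℝ}
  {X : ℝ → Vec d} {Y Z : ℝ → E} {Y' Z' : ℝ → Vec d →L[ℝ] E}

/-- The finite variation part of the definition of a controlled path. -/
structure CtrlVar (p T : ℝ) (X : ℝ → Vec d) (Y : ℝ → E) (Y' : ℝ → Vec d →L[ℝ] E) : Prop where
  deriv : IsVar p T (incr Y')
  rem : IsVar (p / 2) T (remainder X Y Y')

theorem IsControlled.ctrlVar (h : IsControlled p T X Y Y') : CtrlVar p T X Y Y' where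
  deriv := h.deriv_path.isVar
  rem := h.remainder_path.isVar fun t _ => by simp [remainder]

theorem remainder_sub : remainder X (fun t => Y t - Z t) (fun t => Y' t - Z' t) =
    fun s t => remainder X Y Y' s t - remainder X Z Z' s t := by
  funext s t
  simp only [remainder, sub_apply]
  abel

theorem CtrlVar.sub (h : CtrlVar p T X Y Y') (h₁ : CtrlVar p T X Z Z') (hp2 : 2 < p) (hp3 : p < 3)
    (hT : 0 ≤ T) : CtrlVar p T X (fun t => Y t - Z t) (fun t => Y' t - Z' t) where
  deriv := by
    rw [incr_sub]
    exact h.deriv.sub h₁.deriv (by linarith) hp3.le hT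
  rem := by
    rw [remainder_sub]
    exact h.rem.sub h₁.rem (by linarith) (by linarith) hT

theorem ctrlDist_eq : ctrlDist p T X Y Y' Z Z' =
    ctrlNorm p T X (fun t => Y t - Z t) (fun t => Y' t - Z' t) := by
  rw [ctrlDist, ctrlNorm, remainder_sub]

theorem ctrlNorm_nonneg : 0 ≤ ctrlNorm p T X Y Y' :=
  add_nonneg (add_nonneg (norm_nonneg _) (pVar_nonneg _ _)) (pVar_nonneg _ _)

theorem ctrlDist_nonneg : 0 ≤ ctrlDist p T X Y Y' Z Z' := by
  rw [ctrlDist_eq]; exact ctrlNorm_nonneg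

theorem rpow_half (p : ℝ) {x : ℝ} (hx : 0 ≤ x) : x ^ (1 / (p / 2)) = (x ^ (1 / p)) ^ 2 := by
  rw [← Real.rpow_natCast, ← Real.rpow_mul hx]
  congr 1
  push_cast
  rw [one_div_div]
  ring

/-- The bound produced by `CtrlVar.exists_isControl`. -/
def ctrlConst (c : ℝ) : ℝ := c + 1 + 2 * (1 + c) ^ 3

theorem le_ctrlConst {c : ℝ} (hc : 0 ≤ c) : c ≤ ctrlConst c := by
  have : 0 ≤ 2 * (1 + c) ^ 3 := by positivity
  rw [ctrlConst]; linarith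

/-- A controlled path is dominated by a control. -/
theorem CtrlVar.exists_isControl (h : CtrlVar p T X Y Y') (hp2 : 2 < p) (hp3 : p < 3)
    {c η : ℝ} (hc : 0 ≤ c) (hη : 0 < η) (hle : ctrlNorm p T X Y Y' ≤ c * η) :
    ∃ w, IsControl T w ∧ w 0 T ≤ ctrlConst c ∧ ∀ w₁ : ℝ → ℝ → ℝ,
      (∀ s t, 0 ≤ s → s ≤ t → t ≤ T → w s t ≤ w₁ s t) →
      ∀ s t, 0 ≤ s → s ≤ t → t ≤ T →
        Ctrl (ctrlConst c * η) (gauge p w₁ s t) (X t - X s) (Y s) (Y t) (Y' s) (Y' t) := by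
  have hp0 : 0 < p := by linarith
  have n1 := norm_nonneg (Y' 0)
  have n2 := pVar_nonneg (q := p) (A := incr Y') 0 T
  have n3 := pVar_nonneg (q := p / 2) (A := remainder X Y Y') 0 T
  have n4 : 0 ≤ c * η := by positivity
  rw [ctrlNorm] at hle
  obtain ⟨u, hu, huT, hA⟩ := h.deriv.exists_isControl (by linarith) hp3.le hc hη (by linarith)
  obtain ⟨v, hv, hvT, hR⟩ := h.rem.exists_isControl (by linarith) (by linarith) hc hη
    (by linarith)
  refine ⟨fun s t => u s t + v s t, hu.add hv, by rw [ctrlConst]; linarith,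
    fun w₁ hw₁ s t h0 h1 h2 => ?_⟩
  set K := ctrlConst c with hK
  have hK1 : 1 ≤ K := by
    rw [hK, ctrlConst]; have : 0 ≤ 2 * (1 + c) ^ 3 := by positivity
    linarith
  have key : ∀ s t, 0 ≤ s → s ≤ t → t ≤ T → u s t ^ (1 / p) ≤ gauge p w₁ s t ∧
      v s t ^ (1 / p) ≤ gauge p w₁ s t := by
    intro s t h0 h1 h2
    have := hw₁ s t h0 h1 h2
    have i1 := hu.nonneg s t h0 h1 h2
    have i2 := hv.nonneg s t h0 h1 h2
    exact ⟨Real.rpow_le_rpow i1 (by linarith) (by positivity),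
      Real.rpow_le_rpow i2 (by linarith) (by positivity)⟩
  -- The norm contains `Y'` at time `0` only; other times are reached through the variation of `Y'`.
  have hbd : ∀ t, 0 ≤ t → t ≤ T → ‖Y' t‖ ≤ K * η := by
    intro t h0 h2
    have i1 := hA 0 t le_rfl h0 h2
    have i2 : u 0 t ≤ (1 + c) ^ 3 := (hu.mono le_rfl le_rfl h0 h2 le_rfl).trans huT
    have i3 := gauge_le (p := p) (w := u) (i := 0) (j := t) (M := (1 + c) ^ 3) (by linarith)
      (one_le_pow₀ (by linarith)) (hu.nonneg 0 t le_rfl h0 h2) i2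
    have i4 := norm_add_le (Y' t - Y' 0) (Y' 0)
    rw [sub_add_cancel] at i4
    have i5 : η * u 0 t ^ (1 / p) ≤ η * (1 + c) ^ 3 := by gcongr; exact i3
    have i6 : 0 ≤ η * (1 + c) ^ 3 := by positivity
    simp only [incr] at i1
    have : K * η = c * η + η + 2 * (η * (1 + c) ^ 3) := by rw [hK, ctrlConst]; ring
    linarith
  obtain ⟨k1, k2⟩ := key s t h0 h1 h2
  have hg : 0 ≤ gauge p w₁ s t := (Real.rpow_nonneg (hu.nonneg s t h0 h1 h2) _).trans k1
  refine ⟨hbd s h0 (h1.trans h2), hbd t (h0.trans h1) h2, (hA s t h0 h1 h2).trans ?_, ?_⟩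
  · calc η * u s t ^ (1 / p) ≤ (1 * η) * gauge p w₁ s t := by rw [one_mul]; gcongr
      _ ≤ K * η * gauge p w₁ s t := by gcongr
  · have := hR s t h0 h1 h2
    rw [rpow_half p (hv.nonneg s t h0 h1 h2)] at this
    refine this.trans ?_
    have i0 := Real.rpow_nonneg (hv.nonneg s t h0 h1 h2) (1 / p)
    calc η * (v s t ^ (1 / p)) ^ 2 ≤ (1 * η) * gauge p w₁ s t ^ 2 := by rw [one_mul]; gcongr
      _ ≤ K * η * gauge p w₁ s t ^ 2 := by gcongr

end Controlled

section Tensor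

variable {d : ℕ} {E : Type*} [NormedAddCommGroup E] [NormedSpace ℝ E]

theorem norm_tensorApply_le (B : Vec d →L[ℝ] Vec d →L[ℝ] E) (A : Mat d) :
    ‖tensorApply B A‖ ≤ (d ^ 2 * ‖A‖) * ‖B‖ := by
  have h : ∀ i j : Fin d, ‖A (i, j) • B (EuclideanSpace.single i (1 : ℝ))
      (EuclideanSpace.single j (1 : ℝ))‖ ≤ ‖A‖ * ‖B‖ := by
    intro i j
    rw [norm_smul]
    have h1 : ‖A (i, j)‖ ≤ ‖A‖ := PiLp.norm_apply_le A (i, j)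
    have h2 := B.le_opNorm₂ (EuclideanSpace.single i (1 : ℝ)) (EuclideanSpace.single j (1 : ℝ))
    simp only [PiLp.norm_single, norm_one, mul_one] at h2
    gcongr
  rw [tensorApply]
  refine (norm_sum_le _ _).trans ((Finset.sum_le_sum fun i _ => (norm_sum_le _ _).trans
    (Finset.sum_le_sum fun j _ => h i j)).trans_eq ?_)
  simp only [Finset.sum_const, Finset.card_univ, Fintype.card_fin, nsmul_eq_mul]
  ring

/-- The action of a matrix on bilinear maps as a continuous linear map. -/
def tensorCLM (A : Mat d) : (Vec d →L[ℝ] Vec d →L[ℝ] E) →L[ℝ] E :=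
  LinearMap.mkContinuous
    { toFun := fun B => tensorApply B A
      map_add' := fun B C => by
        simp only [tensorApply, add_apply, smul_add, Finset.sum_add_distrib]
      map_smul' := fun c B => by
        simp only [tensorApply, smul_apply, Finset.smul_sum, RingHom.id_apply]
        exact Finset.sum_congr rfl fun i _ => Finset.sum_congr rfl fun j _ => smul_comm _ _ _ }
    (d ^ 2 * ‖A‖) (fun B => norm_tensorApply_le B A)

theorem tensorCLM_apply (A : Mat d) (B : Vec d →L[ℝ] Vec d →L[ℝ] E) :
    tensorCLM A B = tensorApply B A := rfl

theorem norm_tensorCLM_le (A : Mat d) :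
    ‖(tensorCLM A : (Vec d →L[ℝ] Vec d →L[ℝ] E) →L[ℝ] E)‖ ≤ d ^ 2 * ‖A‖ :=
  LinearMap.mkContinuous_norm_le _ (by positivity) _

theorem apply_apply_eq_sum (B : Vec d →L[ℝ] Vec d →L[ℝ] E) (x y : Vec d) :
    B x y = ∑ i : Fin d, ∑ j : Fin d, (x i * y j) •
      B (EuclideanSpace.single i (1 : ℝ)) (EuclideanSpace.single j (1 : ℝ)) := by
  have h : ∀ z : Vec d, z = ∑ i, z i • EuclideanSpace.single i (1 : ℝ) := fun z => by
    have := (EuclideanSpace.basisFun (Fin d) ℝ).sum_repr z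
    simpa using this.symm
  conv_lhs => rw [h x, h y]
  simp only [map_sum, map_smul, sum_apply, smul_apply, Finset.smul_sum, smul_smul]
  rw [Finset.sum_comm]
  exact Finset.sum_congr rfl fun i _ => Finset.sum_congr rfl fun j _ => by rw [mul_comm]

theorem IsRoughPath.tensor_chen {p T : ℝ} {X : ℝ → Vec d} {XX : ℝ → ℝ → Mat d}
    (h : IsRoughPath p T X XX) {s r t : ℝ} (h0 : 0 ≤ s) (h1 : s ≤ r) (h2 : r ≤ t) (h3 : t ≤ T)
    (B : Vec d →L[ℝ] Vec d →L[ℝ] E) :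
    tensorCLM (XX s t) B = tensorCLM (XX s r) B + tensorCLM (XX r t) B +
      B (X r - X s) (X t - X r) := by
  rw [apply_apply_eq_sum B]
  simp only [tensorCLM_apply, tensorApply, ← Finset.sum_add_distrib, ← add_smul]
  refine Finset.sum_congr rfl fun i _ => Finset.sum_congr rfl fun j _ => ?_
  rw [h.chen s r t h0 h1 h2 h3 i j]
  rfl

theorem IsRoughPath.diag {p T : ℝ} {X : ℝ → Vec d} {XX : ℝ → ℝ → Mat d}
    (h : IsRoughPath p T X XX) {t : ℝ} (ht : t ∈ Icc 0 T) : XX t t = 0 := by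
  ext ⟨i, j⟩
  have := h.chen t t t ht.1 le_rfl le_rfl ht.2 i j
  simp only [sub_self, mul_zero, add_zero] at this
  simpa using this

/-- The bound produced by `IsRoughPath.exists_isControl`. -/
def roughConst (d : ℕ) (c : ℝ) : ℝ := (1 + c) ^ 3 + (1 + c * (d ^ 2 + 1)) ^ 3

/-- A rough path is dominated by a control. -/
theorem IsRoughPath.exists_isControl {p T : ℝ} {X : ℝ → Vec d} {XX : ℝ → ℝ → Mat d}
    (h : IsRoughPath p T X XX) (hp2 : 2 < p) (hp3 : p < 3) {c : ℝ} (hc : 0 ≤ c)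
    (hle : roughNorm p T X XX ≤ c) :
    ∃ w, IsControl T w ∧ w 0 T ≤ roughConst d c ∧ ∀ w₁ : ℝ → ℝ → ℝ,
      (∀ s t, 0 ≤ s → s ≤ t → t ≤ T → w s t ≤ w₁ s t) →
      Driver (E := E) (gauge p fun s t : Icc (0 : ℝ) T => w₁ s t) (fun t => X t)
        (fun s t => tensorCLM (XX s t)) := by
  have hp0 : 0 < p := by linarith
  have n2 := pVar_nonneg (q := p) (A := incr X) 0 T
  have n3 := pVar_nonneg (q := p / 2) (A := XX) 0 T
  have hD : (0 : ℝ) < d ^ 2 + 1 := by positivity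
  rw [roughNorm] at hle
  obtain ⟨u, hu, huT, hA⟩ := h.path.isVar.exists_isControl (by linarith) hp3.le hc one_pos
    (by linarith)
  -- The weight `1 / (d ^ 2 + 1)` absorbs the factor `d ^ 2` in the norm of `tensorCLM`, so that the
  -- gauge dominates with constant one. Adding `1` covers `d = 0`.
  obtain ⟨v, hv, hvT, hR⟩ := (h.path₂.isVar fun t ht => h.diag ht).exists_isControl
    (by linarith) (by linarith) (c := c * (d ^ 2 + 1)) (η := 1 / (d ^ 2 + 1)) (by positivity)
    (by positivity) (by
      rw [mul_assoc, mul_one_div_cancel hD.ne']; linarith)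
  refine ⟨fun s t => u s t + v s t, hu.add hv, by rw [roughConst]; linarith,
    fun w₁ hw₁ => ⟨fun s t hst => ?_, fun s t hst => ?_, fun s r t h1 h2 B => ?_⟩⟩
  · have h1 := hA s t s.2.1 hst t.2.2
    have h2 := hw₁ s t s.2.1 hst t.2.2
    have h3 := hv.nonneg s t s.2.1 hst t.2.2
    rw [one_mul] at h1
    exact h1.trans (Real.rpow_le_rpow (hu.nonneg s t s.2.1 hst t.2.2) (by linarith)
      (by positivity))
  · have h1 := hR s t s.2.1 hst t.2.2
    have h2 := hw₁ s t s.2.1 hst t.2.2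
    have h3 := hu.nonneg s t s.2.1 hst t.2.2
    have h4 := hv.nonneg s t s.2.1 hst t.2.2
    rw [rpow_half p h4] at h1
    refine (norm_tensorCLM_le _).trans ?_
    have h5 : (v s t ^ (1 / p)) ^ 2 ≤ gauge p (fun s t : Icc (0 : ℝ) T => w₁ s t) s t ^ 2 := by
      have := Real.rpow_le_rpow h4 (by linarith : v s t ≤ w₁ s t) (by positivity : 0 ≤ 1 / p)
      have := Real.rpow_nonneg h4 (1 / p)
      simp only [gauge]
      gcongr
    refine le_trans ?_ h5
    calc (d : ℝ) ^ 2 * ‖XX s t‖ ≤ (d ^ 2 + 1) * (1 / (d ^ 2 + 1) * (v s t ^ (1 / p)) ^ 2) := by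
          gcongr; linarith
      _ = (v s t ^ (1 / p)) ^ 2 := by field_simp
  · exact h.tensor_chen s.2.1 h1 h2 t.2.2 B

end Tensor

end Regularity

end CadlagRough

namespace CadlagRough

/-! ### The controlled equation as an abstract system. -/

noncomputable section ControlledEquation

set_option maxSynthPendingDepth 3

variable {d k e : ℕ}

/-- The inclusion of the first factor of `ℝᵉ × ℝᵏ`. -/
def emb₁ (e k : ℕ) : Vec e →L[ℝ] Vec₂ e k :=
  (WithLp.prodContinuousLinearEquiv 2 ℝ (Vec e) (Vec k)).symm.toContinuousLinearMap.comp
    (ContinuousLinearMap.inl ℝ (Vec e) (Vec k))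

/-- The inclusion of the second factor of `ℝᵉ × ℝᵏ`. -/
def emb₂ (e k : ℕ) : Vec k →L[ℝ] Vec₂ e k :=
  (WithLp.prodContinuousLinearEquiv 2 ℝ (Vec e) (Vec k)).symm.toContinuousLinearMap.comp
    (ContinuousLinearMap.inr ℝ (Vec e) (Vec k))

theorem norm_emb₁_apply (x : Vec e) : ‖emb₁ e k x‖ = ‖x‖ :=
  WithLp.norm_toLp_fst 2 (Vec e) (Vec k) x

theorem norm_emb₁_le : ‖emb₁ e k‖ ≤ 1 :=
  ContinuousLinearMap.opNorm_le_bound _ zero_le_one fun x => by rw [norm_emb₁_apply, one_mul]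

theorem norm_emb₂_le : ‖emb₂ e k‖ ≤ 1 :=
  ContinuousLinearMap.opNorm_le_bound _ zero_le_one fun x => by
    rw [one_mul]; exact (WithLp.norm_toLp_snd 2 (Vec e) (Vec k) x).le

/-- The equation driven by a rough path as an abstract system on `[0, T]`. -/
def rde (T : ℝ) (f : Vec₂ e k → Vec d →L[ℝ] Vec k) (α : ℝ → Vec e) (α' : ℝ → Vec d →L[ℝ] Vec e)
    (y : ℝ → Vec k) (y' : ℝ → Vec d →L[ℝ] Vec k) (Y : ℝ → Vec k) :
    RDE (Icc (0 : ℝ) T) (Vec d) (Vec k) (Vec₂ e k) where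
  a t := emb₁ e k (α t)
  a' t := (emb₁ e k).comp (α' t)
  y t := y t
  y' t := y' t
  f := f
  Df := fderiv ℝ f
  Y t := Y t

variable {p T : ℝ} {X : ℝ → Vec d} {XX : ℝ → ℝ → Mat d} {f g : Vec₂ e k → Vec d →L[ℝ] Vec k}
  {α β : ℝ → Vec e} {α' β' : ℝ → Vec d →L[ℝ] Vec e} {y z Y Z : ℝ → Vec k}
  {y' z' Y' Z' : ℝ → Vec d →L[ℝ] Vec k}

theorem state_rde (t : Icc (0 : ℝ) T) :
    (rde T f α α' y y' Y).state (emb₂ e k) t = WithLp.toLp 2 (α t, Y t) := by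
  simp only [RDE.state, rde, emb₁, emb₂]
  change WithLp.toLp 2 (α t, (0 : Vec k)) + WithLp.toLp 2 ((0 : Vec e), Y t) = _
  rw [← WithLp.toLp_add]
  simp

theorem Z_rde (t : Icc (0 : ℝ) T) :
    (rde T f α α' y y' Y).Z (emb₂ e k) t = coeff f α Y t := by
  rw [RDE.Z, state_rde]; rfl

theorem Y'_rde (t : Icc (0 : ℝ) T) :
    (rde T f α α' y y' Y).Y' (emb₂ e k) t = y' t + coeff f α Y t := by
  rw [RDE.Y', state_rde]; rfl

theorem Z'_rde (t : Icc (0 : ℝ) T) (h : Y' t = y' t + coeff f α Y t) :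
    (rde T f α α' y y' Y).Z' (emb₂ e k) t = coeff' f α α' Y Y' t := by
  rw [RDE.Z', state_rde, RDE.state', Y'_rde, ← h]
  simp only [coeff', rde]
  congr 1
  ext1 x
  change emb₁ e k (α' t x) + emb₂ e k (Y' t x) = WithLp.toLp 2 (α' t x, Y' t x)
  change WithLp.toLp 2 (α' t x, (0 : Vec k)) + WithLp.toLp 2 ((0 : Vec e), Y' t x) = _
  rw [← WithLp.toLp_add]
  simp

/-- The compensated Riemann sums of the equation and of the abstract system agree. -/
theorem sum_germ_rde (h : ∀ t ∈ Icc 0 T, Y' t = y' t + coeff f α Y t) (n : ℕ)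
    (v : ℕ → Icc (0 : ℝ) T) (u : ℕ → ℝ) (huv : ∀ i ≤ n, (v i : ℝ) = u i) :
    ∑ i ∈ Finset.range n, germ (fun t : Icc (0 : ℝ) T => X t)
      (fun s t : Icc (0 : ℝ) T => tensorCLM (XX s t))
      ((rde T f α α' y y' Y).Z (emb₂ e k)) ((rde T f α α' y y' Y).Z' (emb₂ e k)) (v i) (v (i + 1)) =
    ∑ i ∈ Finset.range n, (coeff f α Y (u i) (X (u (i + 1)) - X (u i)) +
      tensorApply (coeff' f α α' Y Y' (u i)) (XX (u i) (u (i + 1)))) := by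
  refine Finset.sum_congr rfl fun i hi => ?_
  have hi := Finset.mem_range.1 hi
  simp only [germ]
  rw [Z_rde, Z'_rde (Y' := Y') _ (h _ (v i).2), tensorCLM_apply, huv i hi.le, huv (i + 1) hi]

/-- The integral over `[0, 0]` is tested with the empty partition, whose Riemann sum is zero. -/
theorem IsSolution.left_eq (h : IsSolution p T X XX f α α' y y' Y Y') (hT : 0 ≤ T) :
    Y 0 = y 0 := by
  rw [← sub_eq_zero, ← norm_le_zero_iff]
  refine le_of_forall_pos_le_add fun ε hε => ?_
  obtain ⟨δ, -, h⟩ := h.integral_eq 0 ⟨le_rfl, hT⟩ ε hε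
  have := h 0 _ (IsPartition.refl 0) (by simp)
  rw [Finset.range_zero, Finset.sum_empty, zero_sub, norm_neg] at this
  linarith

/-- The increments of a solution are limits of compensated Riemann sums. -/
theorem IsSolution.exists_sum_germ (h : IsSolution p T X XX f α α' y y' Y Y')
    (s t : Icc (0 : ℝ) T) (hst : s ≤ t) {ε : ℝ} (hε : 0 < ε) :
    ∃ (v : ℕ → Icc (0 : ℝ) T) (n : ℕ), Monotone v ∧ v 0 = s ∧ v n = t ∧
      ‖∑ i ∈ Finset.range n, germ (fun t : Icc (0 : ℝ) T => X t)
        (fun s t : Icc (0 : ℝ) T => tensorCLM (XX s t))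
        ((rde T f α α' y y' Y).Z (emb₂ e k)) ((rde T f α α' y y' Y).Z' (emb₂ e k))
        (v i) (v (i + 1)) - (Y t - Y s - (y t - y s))‖ ≤ ε := by
  obtain ⟨δ₁, hδ₁, h₁⟩ := h.integral_eq s s.2 (ε / 2) (half_pos hε)
  obtain ⟨δ₂, hδ₂, h₂⟩ := h.integral_eq t t.2 (ε / 2) (half_pos hε)
  have hδ : 0 < min δ₁ δ₂ := lt_min hδ₁ hδ₂
  obtain ⟨n, u, hu, hum⟩ := exists_partition s.2.1 hδ
  obtain ⟨m, v, hv, hvm⟩ := exists_partition (show (s : ℝ) ≤ t from hst) hδ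
  have huv : u n = v 0 := by rw [hu.right, hv.left]
  have e1 := h₁ n u hu fun i hi => (hum i hi).trans_le (min_le_left _ _)
  have e2 := h₂ _ _ (hu.concat hv) fun i hi =>
    (mesh_concatSeq huv hum hvm i hi).trans_le (min_le_right _ _)
  -- The sum over `[0, t]` along a partition through `s` minus the sum over `[0, s]` is the sum over
  -- `[s, t]`.
  rw [sum_concatSeq (fun a b => coeff f α Y a (X b - X a) +
    tensorApply (coeff' f α α' Y Y' a) (XX a b)) huv] at e2
  have hc : ∀ i ≤ m, (hv.seq s.2.1 t.2.2 i : ℝ) = v i := fun i hi => hv.coe_seq s.2.1 t.2.2 hi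
  refine ⟨hv.seq s.2.1 t.2.2, m, hv.monotone_seq _ _, Subtype.ext ((hc 0 (Nat.zero_le m)).trans
    hv.left), Subtype.ext ((hc m le_rfl).trans hv.right), ?_⟩
  rw [sum_germ_rde h.deriv_eq m _ v hc]
  refine le_of_eq_of_le (congrArg norm ?_) ((norm_sub_le _ _).trans (add_le_add e2.le e1.le) |>.trans
    (add_halves ε).le)
  abel

end ControlledEquation

end CadlagRough

namespace CadlagRough

/-! ### Existence for the controlled equation. -/

noncomputable section WellPosedness

set_option maxSynthPendingDepth 3

section Controlled

variable {d : ℕ} {E : Type*} [NormedAddCommGroup E] [NormedSpace ℝ E] {p T c M : ℝ}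
  {X : ℝ → Vec d} {Y : ℝ → E} {Y' : ℝ → Vec d →L[ℝ] E} {w : ℝ → ℝ → ℝ}

/-- A path that is controlled with respect to a control is a controlled path. -/
theorem isControlled_of_ctrl [CompleteSpace E] (hw : IsControl T w) (hp2 : 2 < p) (hT : 0 ≤ T)
    (hM : 1 ≤ M) (hwM : w 0 T ≤ M) (hX : IsPath p T X)
    (hXw : ∀ s t, 0 ≤ s → s ≤ t → t ≤ T → ‖X t - X s‖ ≤ gauge p w s t)
    (h : ∀ s t, 0 ≤ s → s ≤ t → t ≤ T →
      Ctrl c (gauge p w s t) (X t - X s) (Y s) (Y t) (Y' s) (Y' t)) :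
    IsControlled p T X Y Y' := by
  have hp0 : 0 < p := by linarith
  have hc : 0 ≤ c := (h 0 0 le_rfl le_rfl hT).nonneg
  have hY : ∀ s t, 0 ≤ s → s ≤ t → t ≤ T → ‖Y t - Y s‖ ≤ c * (1 + M) * w s t ^ (1 / p) :=
    fun s t h0 h1 h2 => (h s t h0 h1 h2).norm_sub_le (hXw s t h0 h1 h2)
      (gauge_le (by linarith) hM (hw.nonneg s t h0 h1 h2)
        ((hw.mono le_rfl h0 h1 h2 le_rfl).trans hwM))
  have hY' : ∀ s t, 0 ≤ s → s ≤ t → t ≤ T → ‖Y' t - Y' s‖ ≤ c * w s t ^ (1 / p) :=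
    fun s t h0 h1 h2 => (h s t h0 h1 h2).deriv
  have hR : ∀ s t, 0 ≤ s → s ≤ t → t ≤ T →
      ‖remainder X Y Y' s t‖ ≤ c * w s t ^ (1 / (p / 2)) := fun s t h0 h1 h2 => by
    rw [rpow_half p (hw.nonneg s t h0 h1 h2)]
    exact (h s t h0 h1 h2).rem
  have hcM : 0 ≤ c * (1 + M) := by positivity
  have cY := isCadlag_of_isControl hw hp0 hcM hY
  have cY' := isCadlag_of_isControl hw hp0 hc hY'
  refine ⟨⟨cY, ?_⟩, ⟨cY', ?_⟩, fun t ht => ?_, fun s hs => ?_, ?_⟩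
  · exact (eVar_le_of_isControl hp0 hw hT hcM hY).trans_lt ENNReal.ofReal_lt_top
  · exact (eVar_le_of_isControl hp0 hw hT hc hY').trans_lt ENNReal.ofReal_lt_top
  · exact ((isCadlag_const _).sub (cY.mono le_rfl ht.2)).sub
      ((cY'.mono le_rfl ht.2).clm_apply ((isCadlag_const _).sub (hX.cadlag.mono le_rfl ht.2)))
  · exact ((cY.mono hs.1 le_rfl).sub (isCadlag_const _)).sub
      ((isCadlag_const _).clm_apply ((hX.cadlag.mono hs.1 le_rfl).sub (isCadlag_const _)))
  · exact (eVar_le_of_isControl (by positivity) hw hT hc hR).trans_lt ENNReal.ofReal_lt_top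

theorem ctrlNorm_le_of_ctrl (hw : IsControl T w) (hp2 : 2 < p) (hT : 0 ≤ T)
    (hM : 1 ≤ M) (hwM : w 0 T ≤ M)
    (h : ∀ s t, 0 ≤ s → s ≤ t → t ≤ T →
      Ctrl c (gauge p w s t) (X t - X s) (Y s) (Y t) (Y' s) (Y' t)) :
    ctrlNorm p T X Y Y' ≤ c * (1 + M + M ^ 2) := by
  have hp0 : 0 < p := by linarith
  have hc : 0 ≤ c := (h 0 0 le_rfl le_rfl hT).nonneg
  have h0 := hw.nonneg 0 T le_rfl hT le_rfl
  have hg : w 0 T ^ (1 / p) ≤ M := gauge_le (w := w) (by linarith) hM h0 hwM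
  have hg0 : 0 ≤ w 0 T ^ (1 / p) := Real.rpow_nonneg h0 _
  have h1 := pVar_le_of_isControl (A := incr Y') hp0 hw hT hc
    fun s t h0 h1 h2 => (h s t h0 h1 h2).deriv
  have h2 := pVar_le_of_isControl (A := remainder X Y Y') (q := p / 2) (by positivity) hw hT hc
    fun s t h0 h1 h2 => by
      rw [rpow_half p (hw.nonneg s t h0 h1 h2)]
      exact (h s t h0 h1 h2).rem
  rw [rpow_half p h0] at h2
  have h3 : c * w 0 T ^ (1 / p) ≤ c * M := by gcongr
  have h4 : c * (w 0 T ^ (1 / p)) ^ 2 ≤ c * M ^ 2 := by gcongr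
  have h5 := (h 0 0 le_rfl le_rfl hT).left
  rw [ctrlNorm, mul_add, mul_add, mul_one]
  linarith

end Controlled

variable {d k e : ℕ}

variable {p T M c : ℝ} {X : ℝ → Vec d} {XX : ℝ → ℝ → Mat d}
  {f g : Vec₂ e k → Vec d →L[ℝ] Vec k}
  {α β : ℝ → Vec e} {α' β' : ℝ → Vec d →L[ℝ] Vec e} {y z Y Z : ℝ → Vec k}
  {y' z' Y' Z' : ℝ → Vec d →L[ℝ] Vec k} {w : ℝ → ℝ → ℝ}

theorem stateBound_rde (hf : C2Bound M f (fderiv ℝ f))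
    (hα : ∀ s t, 0 ≤ s → s ≤ t → t ≤ T →
      Ctrl M (gauge p w s t) (X t - X s) (α s) (α t) (α' s) (α' t)) :
    (rde T f α α' y y' Y).StateBound M (gauge p fun s t : Icc (0 : ℝ) T => w s t)
      (fun t => X t) :=
  ⟨hf, fun s t hst => (hα s t s.2.1 hst t.2.2).map _ norm_emb₁_le⟩

theorem IsSolution.ctrlY (h : IsSolution p T X XX f α α' y y' Y Y')
    (hY : ∀ s t, 0 ≤ s → s ≤ t → t ≤ T →
      Ctrl c (gauge p w s t) (X t - X s) (Y s) (Y t) (Y' s) (Y' t)) (s t : Icc (0 : ℝ) T)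
    (hst : s ≤ t) :
    (rde T f α α' y y' Y).CtrlY (emb₂ e k) c (gauge p fun s t : Icc (0 : ℝ) T => w s t)
      (fun t => X t) s t := by
  rw [RDE.CtrlY, Y'_rde, Y'_rde, ← h.deriv_eq s s.2, ← h.deriv_eq t t.2]
  exact hY s t s.2.1 hst t.2.2

theorem IsSolution.solves (h : IsSolution p T X XX f α α' y y' Y Y') (hw : IsControl T w)
    (hp2 : 2 < p) (hp3 : p < 3) (hM : 1 ≤ M) (hwM : w 0 T ≤ M) (hc : 0 ≤ c)
    (hX : Driver (E := Vec k) (gauge p fun s t : Icc (0 : ℝ) T => w s t) (fun t => X t)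
      (fun s t => tensorCLM (XX s t)))
    (hf : C2Bound M f (fderiv ℝ f))
    (hα : ∀ s t, 0 ≤ s → s ≤ t → t ≤ T →
      Ctrl M (gauge p w s t) (X t - X s) (α s) (α t) (α' s) (α' t))
    (hY : ∀ s t, 0 ≤ s → s ≤ t → t ≤ T →
      Ctrl c (gauge p w s t) (X t - X s) (Y s) (Y t) (Y' s) (Y' t)) :
    (rde T f α α' y y' Y).Solves (emb₂ e k) (fun t => X t) (fun s t => tensorCLM (XX s t)) w :=
  RDE.solves_of_riemann hw hp2 hp3 hM hwM norm_emb₂_le hX (stateBound_rde hf hα) hc (h.ctrlY hY)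
    fun s t hst _ hε => h.exists_sum_germ s t hst hε

theorem isSolution_of_solves (hw : IsControl T w)
    (h0 : 0 ≤ T → Y 0 = y 0)
    (hY : IsControlled p T X Y fun t => y' t + coeff f α Y t)
    (h : (rde T f α α' y y' Y).Solves (emb₂ e k) (fun t => X t)
      (fun s t => tensorCLM (XX s t)) w) :
    IsSolution p T X XX f α α' y y' Y fun t => y' t + coeff f α Y t where
  controlled := hY
  deriv_eq _ _ := rfl
  integral_eq t ht ε hε := by
    obtain ⟨δ, hδ, h⟩ := h.riemann hw hε
    refine ⟨δ, hδ, fun n u hu hum => ?_⟩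
    have hc : ∀ i ≤ n, (hu.seq le_rfl ht.2 i : ℝ) = u i := fun i hi => hu.coe_seq le_rfl ht.2 hi
    have h1 := h _ n (hu.monotone_seq le_rfl ht.2) fun i _ => hu.mesh_seq le_rfl ht.2 hδ hum i
    rw [sum_germ_rde (Y' := fun t => y' t + coeff f α Y t) (fun _ _ => rfl) n _ u hc] at h1
    simp only [rde] at h1
    rw [hc n le_rfl, hc 0 (Nat.zero_le n), hu.left, hu.right, h0 (ht.1.trans ht.2)] at h1
    convert h1 using 3
    abel

theorem rpow_sewing_lt_one (hp2 : 2 < p) (hp3 : p < 3) : (2 : ℝ) ^ (1 - 3 / p) < 1 := by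
  refine Real.rpow_lt_one_of_one_lt_of_neg one_lt_two (sub_neg.2 ?_)
  rw [one_lt_div (by linarith)]
  exact hp3

theorem ctrlConst_nonneg (hc : 0 ≤ c) : 0 ≤ ctrlConst c := hc.trans (le_ctrlConst hc)

theorem roughConst_nonneg (d : ℕ) (hc : 0 ≤ c) : 0 ≤ roughConst d c := by
  rw [roughConst]; positivity

/-- Existence of solutions, with a bound that is uniform over bounded sets of data. -/
theorem exists_isSolution (d k e : ℕ) (hp2 : 2 < p) (hp3 : p < 3) {q : ℝ} (hq : 0 ≤ q) :
    ∃ B, 0 ≤ B ∧ ∀ {T : ℝ}, 0 < T → ∀ {X : ℝ → Vec d} {XX : ℝ → ℝ → Mat d},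
      IsRoughPath p T X XX → ∀ {f : Vec₂ e k → Vec d →L[ℝ] Vec k}, IsCb 3 f →
      ∀ {α : ℝ → Vec e} {α' : ℝ → Vec d →L[ℝ] Vec e}, IsControlled p T X α α' →
      ∀ {y : ℝ → Vec k} {y' : ℝ → Vec d →L[ℝ] Vec k}, IsControlled p T X y y' →
      cbNorm 2 f ≤ q → ctrlNorm p T X y y' ≤ q → ctrlNorm p T X α α' ≤ q →
      roughNorm p T X XX ≤ q →
      ∃ Y Y', IsSolution p T X XX f α α' y y' Y Y' ∧ ctrlNorm p T X Y Y' ≤ B := by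
  have hcc := ctrlConst_nonneg hq
  have hrc := roughConst_nonneg d hq
  -- Large enough for `f` and for the sum of the three controls, of `X`, `α` and `y`.
  set M := 1 + q + roughConst d q + 2 * ctrlConst q with hMdef
  have hM : 1 ≤ M := by linarith
  obtain ⟨L, hL0, hL⟩ := RDE.exists_solution (V := Vec d) (E := Vec k) (U := Vec₂ e k)
    (1 - (2 : ℝ) ^ (1 - 3 / p)) M (by linarith [rpow_sewing_lt_one hp2 hp3]) hM
  refine ⟨L * (1 + M + M ^ 2), by positivity, ?_⟩
  intro T hT X XX hX f hf α α' hα y y' hy nf ny nα nX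
  obtain ⟨wX, cX, bX, HX⟩ := hX.exists_isControl (E := Vec k) hp2 hp3 hq nX
  obtain ⟨wα, cα, bα, Hα⟩ := hα.ctrlVar.exists_isControl hp2 hp3 hq one_pos (by linarith)
  obtain ⟨wy, cy, b_y, Hy⟩ := hy.ctrlVar.exists_isControl hp2 hp3 hq one_pos (by linarith)
  set w : ℝ → ℝ → ℝ := fun s t => wX s t + wα s t + wy s t with hwdef
  have hw : IsControl T w := (cX.add cα).add cy
  have hwM : w 0 T ≤ M := by simp only [hwdef]; linarith
  have hg : ∀ s t, 0 ≤ s → s ≤ t → t ≤ T → 0 ≤ gauge p w s t := fun s t h0 h1 h2 =>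
    gauge_nonneg (hw.nonneg s t h0 h1 h2)
  have HX := HX w fun s t h0 h1 h2 => by
    have := cα.nonneg s t h0 h1 h2
    have := cy.nonneg s t h0 h1 h2
    simp only [hwdef]; linarith
  have Hα := Hα w fun s t h0 h1 h2 => by
    have := cX.nonneg s t h0 h1 h2
    have := cy.nonneg s t h0 h1 h2
    simp only [hwdef]; linarith
  have Hy := Hy w fun s t h0 h1 h2 => by
    have := cX.nonneg s t h0 h1 h2
    have := cα.nonneg s t h0 h1 h2
    simp only [hwdef]; linarith
  obtain ⟨Y, hY0, hYs, hYc⟩ := hL hp2 hp3 (by linarith) hT.le hw hwM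
    (S := rde T f α α' y y' y) norm_emb₂_le HX
    ⟨stateBound_rde (hf.c2Bound (by linarith)) fun s t h0 h1 h2 =>
      (Hα s t h0 h1 h2).mono (hg s t h0 h1 h2) (by linarith),
      fun s t hst => (Hy s t s.2.1 hst t.2.2).mono (hg s t s.2.1 hst t.2.2) (by linarith)⟩
  -- The solution lives on `[0, T]`; it is extended to the real line by constants, which does not
  -- affect the restricted system.
  set Ŷ : ℝ → Vec k := fun t => Y (projIcc 0 T hT.le t) with hŶ
  have e : (rde T f α α' y y' y).withY Y = rde T f α α' y y' Ŷ := by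
    simp only [RDE.withY, rde, hŶ, projIcc_val]
  rw [e] at hYs hYc
  have hctrl : ∀ s t, 0 ≤ s → s ≤ t → t ≤ T → Ctrl L (gauge p w s t) (X t - X s) (Ŷ s) (Ŷ t)
      (y' s + coeff f α Ŷ s) (y' t + coeff f α Ŷ t) := by
    intro s t h0 h1 h2
    have := hYc ⟨s, h0, h1.trans h2⟩ ⟨t, h0.trans h1, h2⟩ h1
    rwa [RDE.CtrlY, Y'_rde, Y'_rde] at this
  refine ⟨Ŷ, _, isSolution_of_solves hw (fun _ => ?_) (isControlled_of_ctrl hw hp2 hT.le hM hwM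
    hX.path (fun s t h0 h1 h2 => HX.X_le ⟨s, h0, h1.trans h2⟩ ⟨t, h0.trans h1, h2⟩ h1) hctrl) hYs,
    ctrlNorm_le_of_ctrl hw hp2 hT.le hM hwM hctrl⟩
  simp only [hŶ, projIcc_left]
  exact hY0

end WellPosedness

end CadlagRough

namespace CadlagRough

/-! ### Lipschitz dependence and uniqueness. -/

noncomputable section Stability

set_option maxSynthPendingDepth 3

variable {d k e : ℕ}

theorem dist_rde {p T η : ℝ} {X : ℝ → Vec d} {f g : Vec₂ e k → Vec d →L[ℝ] Vec k}
    {α β : ℝ → Vec e} {α' β' : ℝ → Vec d →L[ℝ] Vec e} {y z Y Z : ℝ → Vec k}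
    {y' z' : ℝ → Vec d →L[ℝ] Vec k} {w : ℝ → ℝ → ℝ}
    (hf : C2Bound η (fun x => f x - g x) (fun x => fderiv ℝ f x - fderiv ℝ g x))
    (hα₀ : ∀ t, 0 ≤ t → t ≤ T → ‖α t - β t‖ ≤ η)
    (hα : ∀ s t, 0 ≤ s → s ≤ t → t ≤ T → Ctrl η (gauge p w s t) (X t - X s)
      (α s - β s) (α t - β t) (α' s - β' s) (α' t - β' t))
    (hy : ∀ s t, 0 ≤ s → s ≤ t → t ≤ T → Ctrl η (gauge p w s t) (X t - X s)
      (y s - z s) (y t - z t) (y' s - z' s) (y' t - z' t)) :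
    (rde T f α α' y y' Y).Dist (rde T g β β' z z' Z) η
      (gauge p fun s t : Icc (0 : ℝ) T => w s t) (fun t => X t) where
  f := hf
  a_le t := by
    simp only [rde]
    rw [← map_sub, norm_emb₁_apply]
    exact hα₀ t t.2.1 t.2.2
  a s t hst := by
    have := (hα s t s.2.1 hst t.2.2).map (emb₁ e k) norm_emb₁_le
    rwa [map_sub, map_sub, ContinuousLinearMap.comp_sub, ContinuousLinearMap.comp_sub] at this
  y s t hst := hy s t s.2.1 hst t.2.2

/-- Local Lipschitz dependence on the data, with a constant that is uniform in `p` as long as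
`2 ^ (1 - 3 / p)` stays away from `1`. -/
theorem exists_ctrlDist_le (d k e : ℕ) {γ q : ℝ} (hγ : 0 < γ) (hq : 0 ≤ q) :
    ∃ B, 0 ≤ B ∧ ∀ {p : ℝ}, 2 < p → p < 3 → (2 : ℝ) ^ (1 - 3 / p) ≤ 1 - γ →
      ∀ {T : ℝ}, 0 < T → ∀ {X : ℝ → Vec d} {XX : ℝ → ℝ → Mat d}, IsRoughPath p T X XX →
      ∀ {f g : Vec₂ e k → Vec d →L[ℝ] Vec k}, IsCb 3 f → IsCb 3 g →
      ∀ {α : ℝ → Vec e} {α' : ℝ → Vec d →L[ℝ] Vec e}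
        {β : ℝ → Vec e} {β' : ℝ → Vec d →L[ℝ] Vec e},
        IsControlled p T X α α' → IsControlled p T X β β' →
      ∀ {y : ℝ → Vec k} {y' : ℝ → Vec d →L[ℝ] Vec k}
        {z : ℝ → Vec k} {z' : ℝ → Vec d →L[ℝ] Vec k},
        IsControlled p T X y y' → IsControlled p T X z z' →
      ∀ {Y : ℝ → Vec k} {Y' : ℝ → Vec d →L[ℝ] Vec k}
        {Z : ℝ → Vec k} {Z' : ℝ → Vec d →L[ℝ] Vec k},
        IsSolution p T X XX f α α' y y' Y Y' → IsSolution p T X XX g β β' z z' Z Z' →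
        cbNorm 3 f ≤ q → cbNorm 3 g ≤ q → ctrlNorm p T X α α' ≤ q → ctrlNorm p T X β β' ≤ q →
        ctrlNorm p T X Y Y' ≤ q → ctrlNorm p T X Z Z' ≤ q → roughNorm p T X XX ≤ q →
        ‖Y 0 - Z 0‖ + ctrlDist p T X Y Y' Z Z' ≤
          B * (‖y 0 - z 0‖ + ctrlDist p T X y y' z z' + cbNorm 2 (fun x => f x - g x) +
            ‖α 0 - β 0‖ + ctrlDist p T X α α' β β') := by
  have hcc := ctrlConst_nonneg hq
  have hc1 := ctrlConst_nonneg (zero_le_one' ℝ)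
  have hrc := roughConst_nonneg d hq
  -- Seven controls are added: one for `X`, four of size `ctrlConst q` for `α`, `β`, `Y` and `Z`,
  -- and two of size `ctrlConst 1` for the differences of `α` and of `y` measured in units of `η`.
  obtain ⟨M, hMdef⟩ : ∃ M, M = 1 + q + roughConst d q + 4 * ctrlConst q + 2 * ctrlConst 1 :=
    ⟨_, rfl⟩
  have hM : 1 ≤ M := by linarith
  -- The distance of the abstract systems contains the supremum of `α - β`, which is its initial
  -- value plus an increment bounded through the control.
  obtain ⟨D, hDdef⟩ : ∃ D, D = 1 + ctrlConst 1 * (1 + (1 + M) * M) := ⟨_, rfl⟩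
  have hD1 : ctrlConst 1 ≤ D := by
    have : 0 ≤ ctrlConst 1 * ((1 + M) * M) := by positivity
    rw [hDdef, mul_add]; linarith
  have hD2 : 1 ≤ D := by rw [hDdef]; exact le_add_of_nonneg_right (by positivity)
  obtain ⟨C, hC0, hC⟩ := RDE.exists_stability (V := Vec d) (E := Vec k) (U := Vec₂ e k) γ M hγ hM
  obtain ⟨B, hBdef⟩ : ∃ B, B = 1 + C * D * (1 + M + M ^ 2) := ⟨_, rfl⟩
  have hB : 1 ≤ B := by rw [hBdef]; exact le_add_of_nonneg_right (by positivity)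
  refine ⟨B, by linarith, ?_⟩
  intro p hp2 hp3 hγp T hT X XX hX f g hf hg α α' β β' hα hβ y y' z z' hy hz Y Y' Z Z' hY hZ
    nf ng nα nβ nY nZ nX
  have d1 := norm_nonneg (y 0 - z 0)
  have d2 := ctrlDist_nonneg (p := p) (T := T) (X := X) (Y := y) (Y' := y') (Z := z) (Z' := z')
  have d3 := cbNorm_nonneg 2 (fun x => f x - g x)
  have d4 := norm_nonneg (α 0 - β 0)
  have d5 := ctrlDist_nonneg (p := p) (T := T) (X := X) (Y := α) (Y' := α') (Z := β) (Z' := β')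
  refine le_of_forall_pos_le_add fun ε hε => ?_
  -- The summand `ε / B` makes `η` positive even when the data agree; it costs exactly `ε` in the
  -- final estimate.
  obtain ⟨η, hηdef⟩ : ∃ η, η = ‖y 0 - z 0‖ + ctrlDist p T X y y' z z' +
      cbNorm 2 (fun x => f x - g x) + ‖α 0 - β 0‖ + ctrlDist p T X α α' β β' + ε / B := ⟨_, rfl⟩
  have hε' : 0 < ε / B := by positivity
  have hη : 0 < η := by rw [hηdef]; positivity
  have hBη : B * η = B * (‖y 0 - z 0‖ + ctrlDist p T X y y' z z' + cbNorm 2 (fun x => f x - g x) +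
      ‖α 0 - β 0‖ + ctrlDist p T X α α' β β') + ε := by
    rw [hηdef, mul_add, mul_div_cancel₀ ε (by positivity : B ≠ 0)]
  rw [← hBη]
  have hηD : η ≤ D * η := le_mul_of_one_le_left hη.le hD2
  have hD0 : 0 < D := by linarith
  obtain ⟨wX, cX, bX, HX⟩ := hX.exists_isControl (E := Vec k) hp2 hp3 hq nX
  obtain ⟨w₁, c₁, b₁, H₁⟩ := hα.ctrlVar.exists_isControl hp2 hp3 hq one_pos (by linarith)
  obtain ⟨w₂, c₂, b₂, H₂⟩ := hβ.ctrlVar.exists_isControl hp2 hp3 hq one_pos (by linarith)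
  obtain ⟨w₃, c₃, b₃, H₃⟩ := hY.controlled.ctrlVar.exists_isControl hp2 hp3 hq one_pos
    (by linarith)
  obtain ⟨w₄, c₄, b₄, H₄⟩ := hZ.controlled.ctrlVar.exists_isControl hp2 hp3 hq one_pos
    (by linarith)
  obtain ⟨w₅, c₅, b₅, H₅⟩ := (hα.ctrlVar.sub hβ.ctrlVar hp2 hp3 hT.le).exists_isControl hp2 hp3
    zero_le_one hη (by rw [← ctrlDist_eq]; linarith)
  obtain ⟨w₆, c₆, b₆, H₆⟩ := (hy.ctrlVar.sub hz.ctrlVar hp2 hp3 hT.le).exists_isControl hp2 hp3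
    zero_le_one hη (by rw [← ctrlDist_eq]; linarith)
  obtain ⟨w, hwdef⟩ : ∃ w : ℝ → ℝ → ℝ, w = fun s t =>
      wX s t + w₁ s t + w₂ s t + w₃ s t + w₄ s t + w₅ s t + w₆ s t := ⟨_, rfl⟩
  have hw : IsControl T w := by
    rw [hwdef]; exact (((((cX.add c₁).add c₂).add c₃).add c₄).add c₅).add c₆
  have hwM : w 0 T ≤ M := by simp only [hwdef]; linarith
  have hle : ∀ s t, 0 ≤ s → s ≤ t → t ≤ T → wX s t ≤ w s t ∧ w₁ s t ≤ w s t ∧ w₂ s t ≤ w s t ∧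
      w₃ s t ≤ w s t ∧ w₄ s t ≤ w s t ∧ w₅ s t ≤ w s t ∧ w₆ s t ≤ w s t := by
    intro s t h0 h1 h2
    have i0 := cX.nonneg s t h0 h1 h2
    have i1 := c₁.nonneg s t h0 h1 h2
    have i2 := c₂.nonneg s t h0 h1 h2
    have i3 := c₃.nonneg s t h0 h1 h2
    have i4 := c₄.nonneg s t h0 h1 h2
    have i5 := c₅.nonneg s t h0 h1 h2
    have i6 := c₆.nonneg s t h0 h1 h2
    simp only [hwdef]
    refine ⟨?_, ?_, ?_, ?_, ?_, ?_, ?_⟩ <;> linarith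
  replace HX := HX w fun s t h0 h1 h2 => (hle s t h0 h1 h2).1
  replace H₁ := H₁ w fun s t h0 h1 h2 => (hle s t h0 h1 h2).2.1
  replace H₂ := H₂ w fun s t h0 h1 h2 => (hle s t h0 h1 h2).2.2.1
  replace H₃ := H₃ w fun s t h0 h1 h2 => (hle s t h0 h1 h2).2.2.2.1
  replace H₄ := H₄ w fun s t h0 h1 h2 => (hle s t h0 h1 h2).2.2.2.2.1
  replace H₅ := H₅ w fun s t h0 h1 h2 => (hle s t h0 h1 h2).2.2.2.2.2.1
  replace H₆ := H₆ w fun s t h0 h1 h2 => (hle s t h0 h1 h2).2.2.2.2.2.2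
  have h0g : ∀ s t, 0 ≤ s → s ≤ t → t ≤ T → 0 ≤ gauge p w s t := fun s t h0 h1 h2 =>
    gauge_nonneg (hw.nonneg s t h0 h1 h2)
  have hgM : ∀ s t, 0 ≤ s → s ≤ t → t ≤ T → gauge p w s t ≤ M := fun s t h0 h1 h2 =>
    gauge_le (by linarith) hM (hw.nonneg s t h0 h1 h2)
      ((hw.mono le_rfl h0 h1 h2 le_rfl).trans hwM)
  have hqM : ctrlConst q * 1 ≤ M := by linarith
  replace H₁ := fun s t h0 h1 h2 => (H₁ s t h0 h1 h2).mono (h0g s t h0 h1 h2) hqM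
  replace H₂ := fun s t h0 h1 h2 => (H₂ s t h0 h1 h2).mono (h0g s t h0 h1 h2) hqM
  replace H₃ := fun s t h0 h1 h2 => (H₃ s t h0 h1 h2).mono (h0g s t h0 h1 h2) hqM
  replace H₄ := fun s t h0 h1 h2 => (H₄ s t h0 h1 h2).mono (h0g s t h0 h1 h2) hqM
  have hDη : ctrlConst 1 * η ≤ D * η := by gcongr
  have hfM : C2Bound M f (fderiv ℝ f) :=
    hf.c2Bound ((cbNorm_two_le_three f).trans (by linarith))
  have hgM' : C2Bound M g (fderiv ℝ g) :=
    hg.c2Bound ((cbNorm_two_le_three g).trans (by linarith))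
  have hdist : (rde T f α α' y y' Y).Dist (rde T g β β' z z' Z) (D * η)
      (gauge p fun s t : Icc (0 : ℝ) T => w s t) (fun t => X t) := by
    refine dist_rde (hf.c2Bound_sub hg (by linarith)) (fun t h1 h2 => ?_)
      (fun s t h0 h1 h2 => (H₅ s t h0 h1 h2).mono (h0g s t h0 h1 h2) hDη)
      (fun s t h0 h1 h2 => (H₆ s t h0 h1 h2).mono (h0g s t h0 h1 h2) hDη)
    have h3 := (H₅ 0 t le_rfl h1 h2).norm_sub_le (HX.X_le ⟨0, le_rfl, hT.le⟩ ⟨t, h1, h2⟩ h1)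
      (hgM 0 t le_rfl h1 h2)
    have h4 : ctrlConst 1 * η * (1 + M) * gauge p w 0 t ≤ ctrlConst 1 * η * (1 + M) * M := by
      gcongr
      exact hgM 0 t le_rfl h1 h2
    have h5 := norm_add_le (α t - β t - (α 0 - β 0)) (α 0 - β 0)
    rw [sub_add_cancel] at h5
    have h6 : D * η = η + ctrlConst 1 * η + ctrlConst 1 * η * (1 + M) * M := by
      rw [hDdef]; ring
    have h7 : 0 ≤ ctrlConst 1 * η := by positivity
    have h8 := h3.trans h4
    linarith
  have hinit : Y 0 - Z 0 = y 0 - z 0 := by rw [hY.left_eq hT.le, hZ.left_eq hT.le]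
  have key := hC hp2 hp3 hγp hT.le hw hwM norm_emb₂_le HX (stateBound_rde hfM H₁)
    (stateBound_rde hgM' H₂) (hg.c2Bound_fderiv (by linarith)) (by positivity) hdist
    (hY.solves hw hp2 hp3 hM hwM (by linarith) HX hfM H₁ H₃)
    (hZ.solves hw hp2 hp3 hM hwM (by linarith) HX hgM' H₂ H₄) (hY.ctrlY H₃) (hZ.ctrlY H₄) (by
      change ‖Y 0 - Z 0‖ ≤ D * η
      rw [hinit]; linarith)
  have hctrl : ∀ s t, 0 ≤ s → s ≤ t → t ≤ T → Ctrl (C * (D * η)) (gauge p w s t) (X t - X s)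
      (Y s - Z s) (Y t - Z t) (Y' s - Z' s) (Y' t - Z' t) := by
    intro s t h0 h1 h2
    have := (key ⟨s, h0, h1.trans h2⟩ ⟨t, h0.trans h1, h2⟩ h1).2
    rwa [RDE.CtrlSub, Y'_rde, Y'_rde, Y'_rde, Y'_rde, ← hY.deriv_eq s ⟨h0, h1.trans h2⟩,
      ← hY.deriv_eq t ⟨h0.trans h1, h2⟩, ← hZ.deriv_eq s ⟨h0, h1.trans h2⟩,
      ← hZ.deriv_eq t ⟨h0.trans h1, h2⟩] at this
  have hfin := ctrlNorm_le_of_ctrl hw hp2 hT.le hM hwM hctrl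
  rw [ctrlDist_eq, hinit]
  have : B * η = η + C * (D * η) * (1 + M + M ^ 2) := by rw [hBdef]; ring
  linarith

variable {p T : ℝ} {X : ℝ → Vec d} {XX : ℝ → ℝ → Mat d} {f : Vec₂ e k → Vec d →L[ℝ] Vec k}
  {α : ℝ → Vec e} {α' : ℝ → Vec d →L[ℝ] Vec e} {y Y Z : ℝ → Vec k}
  {y' Y' Z' : ℝ → Vec d →L[ℝ] Vec k}

theorem ctrlDist_self (hp : 0 < p) (hT : 0 ≤ T) {E : Type*} [NormedAddCommGroup E]
    [NormedSpace ℝ E] (W : ℝ → E) (W' : ℝ → Vec d →L[ℝ] E) : ctrlDist p T X W W' W W' = 0 := by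
  rw [ctrlDist, pVar_eq_zero hp hT fun s t => by simp [incr],
    pVar_eq_zero (by positivity) hT fun s t => sub_self _, sub_self, norm_zero]
  simp

/-- Uniqueness of solutions. -/
theorem IsSolution.eq (hp2 : 2 < p) (hp3 : p < 3) (hT : 0 < T) (hX : IsRoughPath p T X XX)
    (hf : IsCb 3 f) (hα : IsControlled p T X α α') (hy : IsControlled p T X y y')
    (hY : IsSolution p T X XX f α α' y y' Y Y') (hZ : IsSolution p T X XX f α α' y y' Z Z')
    {t : ℝ} (ht : t ∈ Icc 0 T) : Z t = Y t ∧ Z' t = Y' t := by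
  have n1 := cbNorm_nonneg 3 f
  have n2 := ctrlNorm_nonneg (p := p) (T := T) (X := X) (Y := α) (Y' := α')
  have n3 := ctrlNorm_nonneg (p := p) (T := T) (X := X) (Y := Y) (Y' := Y')
  have n4 := ctrlNorm_nonneg (p := p) (T := T) (X := X) (Y := Z) (Y' := Z')
  have n5 : 0 ≤ roughNorm p T X XX := add_nonneg (pVar_nonneg _ _) (pVar_nonneg _ _)
  obtain ⟨B, -, hB⟩ := exists_ctrlDist_le d k e (γ := 1 - (2 : ℝ) ^ (1 - 3 / p))
    (q := cbNorm 3 f + ctrlNorm p T X α α' + ctrlNorm p T X Y Y' + ctrlNorm p T X Z Z' +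
      roughNorm p T X XX) (by linarith [rpow_sewing_lt_one hp2 hp3]) (by linarith)
  have h := hB hp2 hp3 (by linarith) hT hX hf hf hα hα hy hy hY hZ (by linarith) (by linarith)
    (by linarith) (by linarith) (by linarith) (by linarith) (by linarith)
  rw [ctrlDist_self (by linarith) hT.le, ctrlDist_self (by linarith) hT.le, cbNorm_sub_self,
    sub_self, sub_self, norm_zero, norm_zero] at h
  simp only [add_zero, mul_zero, ctrlDist_eq, ctrlNorm] at h
  have hv := hY.controlled.ctrlVar.sub hZ.controlled.ctrlVar hp2 hp3 hT.le
  have m1 := norm_nonneg (Y 0 - Z 0)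
  have m2 := norm_nonneg (Y' 0 - Z' 0)
  have m3 := pVar_nonneg (q := p) (A := incr fun t => Y' t - Z' t) 0 T
  have m4 := pVar_nonneg (q := p / 2)
    (A := remainder X (fun t => Y t - Z t) fun t => Y' t - Z' t) 0 T
  have e0 : Y 0 - Z 0 = 0 := norm_le_zero_iff.1 (by linarith)
  have e0' : Y' 0 - Z' 0 = 0 := norm_le_zero_iff.1 (by linarith)
  have e1 := hv.deriv.eq_zero (by linarith) hp3.le (by linarith) le_rfl ht.1 ht.2
  have e2 := hv.rem.eq_zero (by linarith) (by linarith) (by linarith) le_rfl ht.1 ht.2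
  simp only [incr, e0', sub_zero] at e1
  simp only [remainder, e0, e0', sub_zero, zero_apply] at e2
  exact ⟨(sub_eq_zero.1 e2).symm, (sub_eq_zero.1 e1).symm⟩

end Stability

end CadlagRough

/-! ### Assembling the constants. -/

namespace CadlagRough

theorem monotone_sum_range_ceil {B : ℕ → ℝ} (hB : ∀ n, 0 ≤ B n) :
    Monotone fun x : ℝ => ∑ m ∈ Finset.range (⌈x⌉₊ + 1), B m := fun _ _ hxy =>
  Finset.sum_le_sum_of_subset_of_nonneg
    (Finset.range_mono (Nat.add_le_add_right (Nat.ceil_mono hxy) 1)) fun n _ _ => hB n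

theorem le_sum_range_succ {B : ℕ → ℝ} (hB : ∀ n, 0 ≤ B n) (n : ℕ) :
    B n ≤ ∑ m ∈ Finset.range (n + 1), B m :=
  Finset.single_le_sum (fun m _ => hB m) (Finset.self_mem_range_succ n)

/-- A bound on `1 / (3 - p)` keeps `p` below `3 - 1 / (n + 2)`, so one contraction factor serves all
such `p`. The shift by `2` keeps this threshold inside `(2, 3)`, also for `n = 0`. -/
theorem rpow_sewing_le {p : ℝ} (hp2 : 2 < p) (hp3 : p < 3) {n : ℕ} (hn : 1 / (3 - p) ≤ n) :
    (2 : ℝ) ^ (1 - 3 / p) ≤ 2 ^ (1 - 3 / (3 - 1 / ((n : ℝ) + 2))) := by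
  have h1 : 1 / ((n : ℝ) + 2) ≤ 3 - p := by
    rw [div_le_iff₀ (by linarith)] at hn
    rw [div_le_iff₀ (by positivity)]
    nlinarith
  refine Real.rpow_le_rpow_of_exponent_le one_le_two (sub_le_sub_left ?_ 1)
  exact div_le_div_of_nonneg_left (by norm_num) (by linarith) (by linarith)

theorem bddAbove_image_of_monotone {S : Set (ℝ × (Fin 5 → ℝ))} (hS : S ⊆ Ioo 2 3 ×ˢ Ici 0)
    (hc : IsCompact S) {F : ℝ → ℝ} (hF : Monotone F) :
    BddAbove ((fun x : ℝ × (Fin 5 → ℝ) => F (1 / (3 - x.1) + ∑ i, |x.2 i|)) '' S) := by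
  have hcont : ContinuousOn (fun x : ℝ × (Fin 5 → ℝ) => 1 / (3 - x.1) + ∑ i, |x.2 i|) S := by
    refine ContinuousOn.add (continuousOn_const.div (by fun_prop) fun x hx => ?_) (by fun_prop)
    have := (hS hx).1.2
    exact (sub_pos.2 this).ne'
  obtain ⟨R, hR⟩ := (hc.image_of_continuousOn hcont).bddAbove
  refine ⟨F R, ?_⟩
  rintro _ ⟨x, hx, rfl⟩
  exact hF (hR ⟨x, hx, rfl⟩)

end CadlagRough

theorem corollary3p3 (d k e : ℕ) :
    -- (i) existence, uniqueness and the a priori bound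
    (∀ p : ℝ, 2 < p → p < 3 →
      ∃ K : (Fin 5 → ℝ) → ℝ, MonotoneOn K (Ici 0) ∧ MapsTo K (Ici 0) (Ici 0) ∧
        ∀ (T : ℝ), 0 < T → ∀ (X : ℝ → Vec d) (XX : ℝ → ℝ → Mat d), IsRoughPath p T X XX →
        ∀ f : Vec₂ e k → Vec d →L[ℝ] Vec k, IsCb 3 f →
        ∀ (α : ℝ → Vec e) (α' : ℝ → Vec d →L[ℝ] Vec e), IsControlled p T X α α' →
        ∀ (y : ℝ → Vec k) (y' : ℝ → Vec d →L[ℝ] Vec k), IsControlled p T X y y' →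
        ∃ (Y : ℝ → Vec k) (Y' : ℝ → Vec d →L[ℝ] Vec k),
          IsSolution p T X XX f α α' y y' Y Y' ∧
          (∀ (Z : ℝ → Vec k) (Z' : ℝ → Vec d →L[ℝ] Vec k),
            IsSolution p T X XX f α α' y y' Z Z' →
            ∀ t ∈ Icc 0 T, Z t = Y t ∧ Z' t = Y' t) ∧
          ctrlNorm p T X Y Y' ≤
            K ![cbNorm 2 f, ctrlNorm p T X y y', pVar p (incr α) 0 T,
              ctrlNorm p T X α α', roughNorm p T X XX]) ∧
    -- (ii) local Lipschitz continuity, with a constant that is locally bounded in the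
    -- quantities on which it depends
    (∃ C : ℝ × (Fin 5 → ℝ) → ℝ,
      (∀ S : Set (ℝ × (Fin 5 → ℝ)), S ⊆ Ioo 2 3 ×ˢ Ici 0 → IsCompact S → BddAbove (C '' S)) ∧
      ∀ p : ℝ, 2 < p → p < 3 → ∀ T : ℝ, 0 < T →
        ∀ (X : ℝ → Vec d) (XX : ℝ → ℝ → Mat d), IsRoughPath p T X XX →
        ∀ f g : Vec₂ e k → Vec d →L[ℝ] Vec k, IsCb 3 f → IsCb 3 g →
        ∀ (α : ℝ → Vec e) (α' : ℝ → Vec d →L[ℝ] Vec e)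
          (β : ℝ → Vec e) (β' : ℝ → Vec d →L[ℝ] Vec e),
          IsControlled p T X α α' → IsControlled p T X β β' →
        ∀ (y : ℝ → Vec k) (y' : ℝ → Vec d →L[ℝ] Vec k)
          (z : ℝ → Vec k) (z' : ℝ → Vec d →L[ℝ] Vec k),
          IsControlled p T X y y' → IsControlled p T X z z' →
        ∀ (Y : ℝ → Vec k) (Y' : ℝ → Vec d →L[ℝ] Vec k)
          (Z : ℝ → Vec k) (Z' : ℝ → Vec d →L[ℝ] Vec k),
          IsSolution p T X XX f α α' y y' Y Y' → IsSolution p T X XX g β β' z z' Z Z' →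
        ∀ K : ℝ, 0 < K → ctrlNorm p T X Y Y' ≤ K → ctrlNorm p T X Z Z' ≤ K →
          ‖Y 0 - Z 0‖ + ctrlDist p T X Y Y' Z Z' ≤
            C (p, ![max (cbNorm 3 f) (cbNorm 3 g), ctrlNorm p T X α α', ctrlNorm p T X β β',
                K, roughNorm p T X XX]) *
              (‖y 0 - z 0‖ + ctrlDist p T X y y' z z' + cbNorm 2 (fun x => f x - g x) +
                ‖α 0 - β 0‖ + ctrlDist p T X α α' β β')) := by
  constructor
  · intro p hp2 hp3
    choose B hB0 hB using fun n : ℕ => exists_isSolution d k e hp2 hp3 n.cast_nonneg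
    -- `B n` is valid for data of size at most `n` but need not be monotone in `n`; summing over all
    -- `m` up to the rounded total size restores monotonicity.
    refine ⟨fun v => ∑ m ∈ Finset.range (⌈∑ i, v i⌉₊ + 1), B m, fun v _ v' _ hv =>
      monotone_sum_range_ceil hB0 (Finset.sum_le_sum fun i _ => hv i), fun v _ =>
      Finset.sum_nonneg fun m _ => hB0 m, ?_⟩
    intro T hT X XX hX f hf α α' hα y y' hy
    obtain ⟨n, hn⟩ : ∃ n, n = ⌈∑ i, ![cbNorm 2 f, ctrlNorm p T X y y', pVar p (incr α) 0 T,
      ctrlNorm p T X α α', roughNorm p T X XX] i⌉₊ := ⟨_, rfl⟩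
    have hle := hn ▸ Nat.le_ceil _
    simp only [Fin.sum_univ_five, Matrix.cons_val] at hle
    have n1 := cbNorm_nonneg 2 f
    have n2 := ctrlNorm_nonneg (p := p) (T := T) (X := X) (Y := y) (Y' := y')
    have n3 := pVar_nonneg (q := p) (A := incr α) 0 T
    have n4 := ctrlNorm_nonneg (p := p) (T := T) (X := X) (Y := α) (Y' := α')
    have n5 : 0 ≤ roughNorm p T X XX := add_nonneg (pVar_nonneg _ _) (pVar_nonneg _ _)
    obtain ⟨Y, Y', hY, hYB⟩ := hB n hT hX hf hα hy (by linarith) (by linarith) (by linarith)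
      (by linarith)
    refine ⟨Y, Y', hY, fun Z Z' hZ t ht => hY.eq hp2 hp3 hT hX hf hα hy hZ ht, ?_⟩
    simp only [← hn]
    exact hYB.trans (le_sum_range_succ hB0 n)
  · have hγ : ∀ n : ℕ, 0 < 1 - (2 : ℝ) ^ (1 - 3 / (3 - 1 / ((n : ℝ) + 2))) := fun n => by
      have h1 : 1 / ((n : ℝ) + 2) ≤ 1 / 2 := by gcongr; linarith [n.cast_nonneg (α := ℝ)]
      have h2 : 0 < 1 / ((n : ℝ) + 2) := by positivity
      linarith [rpow_sewing_lt_one (p := 3 - 1 / ((n : ℝ) + 2)) (by linarith) (by linarith)]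
    choose B hB0 hB using fun n : ℕ => exists_ctrlDist_le d k e (hγ n) n.cast_nonneg
    -- The term `1 / (3 - p)` joins the sizes of the data, so one integer `n` bounds all of them and
    -- also selects the contraction factor. It is continuous for `p < 3`, hence bounded on compact
    -- sets.
    refine ⟨fun x => ∑ m ∈ Finset.range (⌈1 / (3 - x.1) + ∑ i, |x.2 i|⌉₊ + 1), B m,
      fun S hS hc => bddAbove_image_of_monotone hS hc (monotone_sum_range_ceil hB0), ?_⟩
    intro p hp2 hp3 T hT X XX hX f g hf hg α α' β β' hα hβ y y' z z' hy hz Y Y' Z Z' hY hZ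
      K hK hYK hZK
    obtain ⟨n, hn⟩ : ∃ n, n = ⌈1 / (3 - p) + ∑ i, |![max (cbNorm 3 f) (cbNorm 3 g),
      ctrlNorm p T X α α', ctrlNorm p T X β β', K, roughNorm p T X XX] i|⌉₊ := ⟨_, rfl⟩
    have hle := hn ▸ Nat.le_ceil _
    simp only [Fin.sum_univ_five, Matrix.cons_val] at hle
    have n0 : 0 < 1 / (3 - p) := one_div_pos.2 (by linarith)
    have n1 := le_max_left (cbNorm 3 f) (cbNorm 3 g)
    have n1' := le_max_right (cbNorm 3 f) (cbNorm 3 g)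
    have a1 := le_abs_self (max (cbNorm 3 f) (cbNorm 3 g))
    have a2 := le_abs_self (ctrlNorm p T X α α')
    have a3 := le_abs_self (ctrlNorm p T X β β')
    have a4 := le_abs_self K
    have a5 := le_abs_self (roughNorm p T X XX)
    have b1 := abs_nonneg (max (cbNorm 3 f) (cbNorm 3 g))
    have b2 := abs_nonneg (ctrlNorm p T X α α')
    have b3 := abs_nonneg (ctrlNorm p T X β β')
    have b4 := abs_nonneg K
    have b5 := abs_nonneg (roughNorm p T X XX)
    have hγn := rpow_sewing_le hp2 hp3 (n := n) (by linarith)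
    have key := hB n hp2 hp3 (by linarith) hT hX hf hg hα hβ hy hz hY hZ (by linarith)
      (by linarith) (by linarith) (by linarith) (by linarith) (by linarith) (by linarith)
    refine key.trans ?_
    simp only [← hn]
    refine mul_le_mul_of_nonneg_right (le_sum_range_succ hB0 n) ?_
    have := ctrlDist_nonneg (p := p) (T := T) (X := X) (Y := y) (Y' := y') (Z := z) (Z' := z')
    have := ctrlDist_nonneg (p := p) (T := T) (X := X) (Y := α) (Y' := α') (Z := β) (Z' := β')
    have := cbNorm_nonneg 2 (fun x => f x - g x)
    positivity
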